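/- Consider the linear quantum $\lambda$-calculus with types $A,B::=\mathtt{bit}\mid\mathtt{qbit}\mid 1\mid A\multimap B\mid A\otimes B$, terms built from variables, abstraction, application, $*$, $\mathsf{let}\ *=M\ \mathsf{in}\ N$, pairs, $\mathsf{let}\ \langle x,y\rangle=M\ \mathsf{in}\ N$, conditionals $\mathsf{if}\ M\ \mathsf{then}\ N\ \mathsf{else}\ P$ and operators $c$ (creation and discarding of bits, $\mathtt{new}$, $\mathtt{meas}$, unitary gates), and its standard linear typing rules; in the conditional rule, $\Delta\vdash M:\mathtt{bit}$, $\Gamma\vdash N:A$ and $\Gamma\vdash P:A$ yield $\Delta,\Gamma\vdash \mathsf{if}\ M\ \mathsf{then}\ N\ \mathsf{else}\ P:A$. Let $\pi$ be a typing derivation. A *position* of $\pi$ is an occurrence of an atom ($\mathtt{bit}$, $\mathtt{qbit}$ or $1$) in a sequent of $\pi$, with its sign in that sequent (signs are reversed on the left of $\vdash$). Tokens travel along corresponding occurrences of atoms, entering the derivation of a premise at negative positions of its conclusion and leaving it at positive ones. The *synchronization points* of $\pi$ are its if-then-else rules, its operator axioms, and, for each identity axiom $x:A\vdash x:A$ and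 each atom occurrence $\mathbb A$ in $A$, the axiom $\mathbb A\vdash\mathbb A$ that it contains (synchronization points inside branches of conditionals included). An axiom waits for tokens at the negative positions of its conclusion and releases them at the positive ones; an if-then-else rule as above waits at its guard (the conclusion $\mathtt{bit}$ of the derivation of $M$) and at the negative positions of $\Gamma\vdash A$, and releases tokens at the positive positions of $\Gamma\vdash A$. The *synchronization graph* $\mathscr G_\pi$ has the synchronization points as nodes, and an edge $i\to j$ whenever a token path that crosses no synchronization point leads from a position where $i$ releases a token to a position where $j$ waits for one. The *synchronous compilation* of $\pi$ starts with tokens on all negative positions of the conclusion of $\pi$ and on all unit axioms $\vdash *:1$ outside the branches of conditionals, and builds a circuit while tokens move. An axiom is crossed when a token lies on each of its negative positions (an operator axiom appends its operator to the circuit). A conditional is executed, only once, when tokens lie on its guard $l$ and on all negative positions of $\Gamma\vdash A$, and the synchronous compilations of its two branches, each started separately in its initial configuration, reach final configurations with circuits $E_1,E_2$; then the tokens jump to the positive positions of $\Gamma\vdash A$, the guard is marked as used, and $\mathsf{if}\ l\ \mathsf{then}\ E_1\ \mathsf{else}\ E_2$ is appended to the circuit. A configuration is *final* if its tokens lie exactly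 on the positive positions of the conclusion, on the left premises $\vdash M:1$ of the rules for $\mathsf{let}\ *=M\ \mathsf{in}\ N$ outside the branches of conditionals, and on the guards, all marked as used, of the conditionals outside the branches of conditionals. A *deadlock* is a configuration that is not final and from which no step is possible. **Proposition.** For every typing derivation $\pi$, the graph $\mathscr G_\pi$ is acyclic if and only if the synchronous compilation of $\pi$ never reaches a deadlock. In that case the synchronous compilation has no infinite run, and every configuration that it reaches can be continued to a final one: the tokens that started from the negative positions of the conclusion and from the unit axioms reach, after finitely many steps, all positive positions of the conclusion of $\pi$. -/

import Mathlib

namespace QLambda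

/-! ## Types, operators, terms -/

/-- Base types. -/
inductive Base
  | bit
  | qbit
deriving DecidableEq

/-- Types `A, B ::= bit | qbit | 1 | A ⊸ B | A ⊗ B`. -/
inductive Ty
  | base (b : Base)
  | one
  | lolli (A B : Ty)
  | tensor (A B : Ty)
deriving DecidableEq

/-- The operators: creation and discarding of classical bits, qubit initialisation, measurement,
and arbitrary unitary gates (in particular `H`, `S`, `T`, `CNOT`). -/
inductive Op
  | zero
  | one
  | discard
  | new
  | meas
  | gate (n : ℕ) (U : Matrix.unitaryGroup (Fin (2 ^ n)) ℂ)

/-- The input types of an operator. -/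
def Op.inputs : Op → List Base
  | zero => []
  | one => []
  | discard => [.bit]
  | new => [.bit]
  | meas => [.qbit]
  | gate n _ => List.replicate n .qbit

/-- The output types of an operator. -/
def Op.outputs : Op → List Base
  | zero => [.bit]
  | one => [.bit]
  | discard => []
  | new => [.qbit]
  | meas => [.bit]
  | gate n _ => List.replicate n .qbit

/-- `𝔹₁ ⊗ ⋯ ⊗ 𝔹ₙ`, which is `1` for `n = 0`. -/
def tensorList : List Base → Ty
  | [] => .one
  | [b] => .base b
  | b :: c :: l => .tensor (.base b) (tensorList (c :: l))

/-- The type `𝔹₁ ⊗ ⋯ ⊗ 𝔹ₙ ⊸ 𝔹'₁ ⊗ ⋯ ⊗ 𝔹'ₘ` of an operator. -/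
def Op.ty (c : Op) : Ty := .lolli (tensorList c.inputs) (tensorList c.outputs)

/-- Terms; variables are named by natural numbers. -/
inductive Term
  | var (x : ℕ)
  | lam (x : ℕ) (M : Term)
  | app (M N : Term)
  | star
  | letStar (M N : Term)
  | pair (M N : Term)
  | letPair (x y : ℕ) (M N : Term)
  | ite (M N P : Term)
  | op (c : Op)

/-! ## Typing derivations -/

/-- Typing contexts: sets of pairs of a variable and its type. -/
abbrev Ctx := Finset (ℕ × Ty)

/-- The variables declared in a context. -/
def Ctx.dom (Γ : Ctx) : Finset ℕ := Finset.image Prod.fst Γ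

/-- `Θ` is `Δ, Γ`: the union of two contexts without common variable. -/
def Split (Θ Δ Γ : Ctx) : Prop := Disjoint Δ.dom Γ.dom ∧ Θ = Δ ∪ Γ

/-- Typing derivations of `Γ ⊢ M : A`. -/
inductive Deriv : Ctx → Term → Ty → Type
  | ax {Γ : Ctx} {x : ℕ} {A : Ty} (hΓ : Γ = {(x, A)}) : Deriv Γ (.var x) A
  | lam {Γ : Ctx} {x : ℕ} {M : Term} {A B : Ty} (hx : x ∉ Γ.dom)
      (d : Deriv (insert (x, A) Γ) M B) : Deriv Γ (.lam x M) (.lolli A B)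
  | app {Θ Δ Γ : Ctx} {M N : Term} {A B : Ty} (hΘ : Split Θ Δ Γ)
      (d₀ : Deriv Δ M (.lolli A B)) (d₁ : Deriv Γ N A) : Deriv Θ (.app M N) B
  | star {Γ : Ctx} (hΓ : Γ = ∅) : Deriv Γ .star .one
  | letStar {Θ Δ Γ : Ctx} {M N : Term} {A : Ty} (hΘ : Split Θ Δ Γ)
      (d₀ : Deriv Δ M .one) (d₁ : Deriv Γ N A) : Deriv Θ (.letStar M N) A
  | pair {Θ Δ Γ : Ctx} {M N : Term} {A B : Ty} (hΘ : Split Θ Δ Γ)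
      (d₀ : Deriv Δ M A) (d₁ : Deriv Γ N B) : Deriv Θ (.pair M N) (.tensor A B)
  | letPair {Θ Δ Γ : Ctx} {x y : ℕ} {M N : Term} {A B C : Ty} (hΘ : Split Θ Δ Γ)
      (hxy : x ≠ y) (hx : x ∉ Γ.dom) (hy : y ∉ Γ.dom) (d₀ : Deriv Δ M (.tensor A B))
      (d₁ : Deriv (insert (x, A) (insert (y, B) Γ)) N C) : Deriv Θ (.letPair x y M N) C
  | ite {Θ Δ Γ : Ctx} {M N P : Term} {A : Ty} (hΘ : Split Θ Δ Γ)
      (d₀ : Deriv Δ M (.base .bit)) (d₁ : Deriv Γ N A) (d₂ : Deriv Γ P A) :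
      Deriv Θ (.ite M N P) A
  | op {Γ : Ctx} {c : Op} {A : Ty} (hΓ : Γ = ∅) (hA : A = c.ty) : Deriv Γ (.op c) A

/-! ## Positions -/

/-- A step from a compound type to one of its two components. -/
inductive Dir
  | left
  | right

/-- The sign of the occurrence of an atom (`bit`, `qbit` or `1`) found at the end of a path in a
type: `some true` if it is positive, `some false` if it is negative, `none` if the path does not
end in an atom. -/
def Ty.sign : Ty → List Dir → Option Bool
  | .base _, [] => some true
  | .one, [] => some true
  | .lolli A _, .left :: p => (A.sign p).map not
  | .lolli _ B, .right :: p => B.sign p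
  | .tensor A _, .left :: p => A.sign p
  | .tensor _ B, .right :: p => B.sign p
  | _, _ => none

/-- The formulas of a sequent: that of a variable, and the one on the right. -/
inductive Place
  | ctx (x : ℕ)
  | concl

/-- The address of a rule in a derivation: the root has address `[]`, and the premise number `i`
(counted from `0`) of the rule at address `a` has address `i :: a`. -/
abbrev Addr := List ℕ

/-- A position: the occurrence of an atom in the sequent that concludes the rule at `addr`. -/
structure Pos where
  addr : Addr
  place : Place
  path : List Dir

/-- The positions of sign `s` in the sequent `Γ ⊢ A` that concludes the rule at address `a`.
Signs are reversed on the left of the turnstile. Tokens enter a derivation at the negative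
positions of its conclusion and leave it at the positive ones. -/
def seqPos (Γ : Ctx) (A : Ty) (a : Addr) (s : Bool) : Set Pos :=
  {q | q.addr = a ∧
    match q.place with
    | .concl => A.sign q.path = some s
    | .ctx x => ∃ B, (x, B) ∈ Γ ∧ B.sign q.path = some (!s)}

/-! ## Structural moves -/

/-- `q` and `r` are corresponding occurrences in two copies of the type `C`, the first one lying
below `f`, the second one being the right-hand side formula (after removal of `pre`) of the rule
at address `b`; `s` is the sign of `r` in its sequent. -/
def glueConcl (C : Ty) (f : List Dir → Pos) (b : Addr) (pre : List Dir)
    (q r : Pos) (s : Bool) : Prop :=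
  ∃ p, C.sign p = some s ∧ q = f p ∧ r = ⟨b, .concl, pre ++ p⟩

/-- As before, but the second copy of `C` is the type of the variable `x` in the context of the
rule at address `b`. -/
def glueVar (C : Ty) (f : List Dir → Pos) (b : Addr) (x : ℕ)
    (q r : Pos) (s : Bool) : Prop :=
  ∃ p, C.sign p = some (!s) ∧ q = f p ∧ r = ⟨b, .ctx x, p⟩

/-- `q` and `r` are corresponding occurrences in the context `Γ` at addresses `a` and `b`. -/
def glueCtx (Γ : Ctx) (a b : Addr) (q r : Pos) (s : Bool) : Prop :=
  ∃ x C, (x, C) ∈ Γ ∧ glueVar C (fun p => ⟨a, .ctx x, p⟩) b x q r s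

/-- The occurrences `q` and `r` that the last rule of a derivation (placed at address `a`)
identifies. Here `r` belongs to a premise and has sign `s` there, while `q` belongs to the
conclusion or, for the types cut by the rules of application and of `let ⟨x, y⟩ = M in N`, to the
first premise. Across a conditional only the context of the guard is identified. -/
def Deriv.Corr : ∀ {Γ : Ctx} {M : Term} {A : Ty}, Deriv Γ M A → Addr → Pos → Pos → Bool → Prop
  | _, _, _, .ax _, _, _, _, _ => False
  | _, _, _, .lam (Γ := Γ) (x := x) (A := A) (B := B) _ _, a, q, r, s =>
      glueCtx Γ a (0 :: a) q r s ∨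
      glueVar A (fun p => ⟨a, .concl, .left :: p⟩) (0 :: a) x q r s ∨
      glueConcl B (fun p => ⟨a, .concl, .right :: p⟩) (0 :: a) [] q r s
  | _, _, _, .app (Δ := Δ) (Γ := Γ) (A := A) (B := B) _ _ _, a, q, r, s =>
      glueCtx Δ a (0 :: a) q r s ∨
      glueCtx Γ a (1 :: a) q r s ∨
      glueConcl B (fun p => ⟨a, .concl, p⟩) (0 :: a) [.right] q r s ∨
      glueConcl A (fun p => ⟨0 :: a, .concl, .left :: p⟩) (1 :: a) [] q r s
  | _, _, _, .star _, _, _, _, _ => False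
  | _, _, _, .letStar (Δ := Δ) (Γ := Γ) (A := A) _ _ _, a, q, r, s =>
      glueCtx Δ a (0 :: a) q r s ∨
      glueCtx Γ a (1 :: a) q r s ∨
      glueConcl A (fun p => ⟨a, .concl, p⟩) (1 :: a) [] q r s
  | _, _, _, .pair (Δ := Δ) (Γ := Γ) (A := A) (B := B) _ _ _, a, q, r, s =>
      glueCtx Δ a (0 :: a) q r s ∨
      glueCtx Γ a (1 :: a) q r s ∨
      glueConcl A (fun p => ⟨a, .concl, .left :: p⟩) (0 :: a) [] q r s ∨
      glueConcl B (fun p => ⟨a, .concl, .right :: p⟩) (1 :: a) [] q r s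
  | _, _, _, .letPair (Δ := Δ) (Γ := Γ) (x := x) (y := y) (A := A) (B := B) (C := C)
        _ _ _ _ _ _, a, q, r, s =>
      glueCtx Δ a (0 :: a) q r s ∨
      glueCtx Γ a (1 :: a) q r s ∨
      glueConcl C (fun p => ⟨a, .concl, p⟩) (1 :: a) [] q r s ∨
      glueVar A (fun p => ⟨0 :: a, .concl, .left :: p⟩) (1 :: a) x q r s ∨
      glueVar B (fun p => ⟨0 :: a, .concl, .right :: p⟩) (1 :: a) y q r s
  | _, _, _, .ite (Δ := Δ) _ _ _ _, a, q, r, s => glueCtx Δ a (0 :: a) q r s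
  | _, _, _, .op _ _, _, _, _, _ => False

/-- The last rule of a derivation (placed at address `a`) lets a token move from `p` to `q`:
tokens enter a premise at its negative positions and leave it at its positive ones. -/
def Deriv.Move {Γ : Ctx} {M : Term} {A : Ty} (d : Deriv Γ M A) (a : Addr) (p q : Pos) : Prop :=
  d.Corr a p q false ∨ d.Corr a q p true

/-- The property `P` holds for some sub-derivation of a derivation placed at address `a`. If
`deep` is `false`, only the sub-derivations that do not lie inside a branch of a conditional are
considered. -/
def Deriv.Any (deep : Bool)
    (P : ∀ {Γ : Ctx} {M : Term} {A : Ty}, Deriv Γ M A → Addr → Prop) :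
    ∀ {Γ : Ctx} {M : Term} {A : Ty}, Deriv Γ M A → Addr → Prop
  | _, _, _, .ax h, a => P (.ax h) a
  | _, _, _, .lam h d, a => P (.lam h d) a ∨ d.Any deep P (0 :: a)
  | _, _, _, .app h d₀ d₁, a =>
      P (.app h d₀ d₁) a ∨ d₀.Any deep P (0 :: a) ∨ d₁.Any deep P (1 :: a)
  | _, _, _, .star h, a => P (.star h) a
  | _, _, _, .letStar h d₀ d₁, a =>
      P (.letStar h d₀ d₁) a ∨ d₀.Any deep P (0 :: a) ∨ d₁.Any deep P (1 :: a)
  | _, _, _, .pair h d₀ d₁, a =>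
      P (.pair h d₀ d₁) a ∨ d₀.Any deep P (0 :: a) ∨ d₁.Any deep P (1 :: a)
  | _, _, _, .letPair h hxy hx hy d₀ d₁, a =>
      P (.letPair h hxy hx hy d₀ d₁) a ∨ d₀.Any deep P (0 :: a) ∨ d₁.Any deep P (1 :: a)
  | _, _, _, .ite h d₀ d₁ d₂, a =>
      P (.ite h d₀ d₁ d₂) a ∨ d₀.Any deep P (0 :: a) ∨
        (deep = true ∧ (d₁.Any deep P (1 :: a) ∨ d₂.Any deep P (2 :: a)))
  | _, _, _, .op h h', a => P (.op h h') a

/-! ## The synchronization graph -/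

/-- Names of synchronization points: the if-then-else rule at an address, the operator axiom at
an address, and the axiom `𝔸 ⊢ 𝔸` that the identity axiom `x : A ⊢ x : A` at an address contains
for the occurrence of the atom `𝔸` in `A` at the end of a path. -/
inductive SyncPt
  | ite (a : Addr)
  | op (a : Addr)
  | ax (a : Addr) (p : List Dir)

/-- The position of the guard of the if-then-else rule at address `a`. -/
def guardPos (a : Addr) : Pos := ⟨0 :: a, .concl, []⟩

/-- If the last rule of a derivation (placed at address `a`) gives rise to the synchronization
point `i`, then `q` is a position where `i` waits for a token (`s = false`) or one where `i`
releases a token (`s = true`). An if-then-else rule with conclusion `Δ, Γ ⊢ A`, where `Δ` is the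
context of the guard, waits at its guard and at the negative positions of `Γ ⊢ A`, and releases
tokens at the positive positions of `Γ ⊢ A`. -/
def Deriv.RootPort : ∀ {Γ : Ctx} {M : Term} {A : Ty},
    Deriv Γ M A → Addr → SyncPt → Bool → Pos → Prop
  | Γ, _, A, .ax _, a, i, s, q => i = .ax a q.path ∧ q ∈ seqPos Γ A a s
  | _, _, A, .ite (Γ := Γ) _ _ _ _, a, i, s, q =>
      i = .ite a ∧ (q ∈ seqPos Γ A a s ∨ (s = false ∧ q = guardPos a))
  | Γ, _, A, .op _ _, a, i, s, q => i = .op a ∧ q ∈ seqPos Γ A a s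
  | _, _, _, _, _, _, _, _ => False

/-- `q` is a position where the synchronization point `i` of `π` waits for a token
(`s = false`), or one where it releases a token (`s = true`). -/
def Deriv.Port {Γ : Ctx} {M : Term} {A : Ty} (π : Deriv Γ M A) (i : SyncPt) (s : Bool)
    (q : Pos) : Prop :=
  π.Any true (fun d a => d.RootPort a i s q) []

/-- The synchronization points of a derivation, at any depth. -/
def Deriv.syncPoints {Γ : Ctx} {M : Term} {A : Ty} (π : Deriv Γ M A) : Set SyncPt :=
  {i | ∃ s q, π.Port i s q}

/-- Elementary moves of tokens anywhere in `π`. They do not cross synchronization points. -/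
def Deriv.Link {Γ : Ctx} {M : Term} {A : Ty} (π : Deriv Γ M A) (p q : Pos) : Prop :=
  π.Any true (fun d a => d.Move a p q) []

/-- The synchronization graph: there is an edge from `i` to `j` when a simple token path (one that
crosses no synchronization point) leads from a position where `i` releases a token to a position
where `j` waits for a token. -/
def Deriv.syncGraph {Γ : Ctx} {M : Term} {A : Ty} (π : Deriv Γ M A) : Digraph π.syncPoints where
  Adj i j := ∃ p q, π.Port i true p ∧ Relation.ReflTransGen π.Link p q ∧ π.Port j false q

/-- A directed graph without directed cycles (loops count as cycles). -/
def AcyclicDigraph {V : Type} (G : Digraph V) : Prop := ∀ v, ¬ Relation.TransGen G.Adj v v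

/-! ## The synchronous token machine -/

/-- Circuits with classical control flow. Wires are labelled by the positions of the tokens that
carry them; `relabel f` does nothing but rename every wire `l` into `f l`. -/
inductive Circ
  | op (c : Op) (ins outs : List Pos)
  | seq (C D : Circ)
  | ite (l : Pos) (C D : Circ)
  | relabel (f : Pos → Pos)

/-- The circuit that renames the wire `p` into `q`. -/
noncomputable def Circ.rename (p q : Pos) : Circ :=
  open Classical in .relabel (fun l => if l = p then q else l)

/-- The circuit that renames the wires at address `a` into the same wires at address `b`. -/
def Circ.transfer (a b : Addr) : Circ :=
  .relabel (fun l => if l.addr = a then ⟨b, l.place, l.path⟩ else l)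

/-- A token: its position, and a flag, which is only used on the guards of conditionals and turned
on when the conditional has been executed. -/
structure Token where
  pos : Pos
  flag : Bool

/-- The tokens with flag off at the positions of a set. -/
def off (S : Set Pos) : Set Token := {t | t.pos ∈ S ∧ t.flag = false}

/-- The tokens with flag on at the positions of a set. -/
def on (S : Set Pos) : Set Token := {t | t.pos ∈ S ∧ t.flag = true}

/-- Configurations: the tokens and the circuit built so far. -/
structure Config where
  tokens : Set Token
  circ : Circ

/-- The unit axioms `⊢ * : 1` outside the branches of conditionals. -/
def Deriv.units {Γ : Ctx} {M : Term} {A : Ty} (d : Deriv Γ M A) (a : Addr) : Set Pos :=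
  {q | d.Any false (fun e b => (match e with | .star _ => True | _ => False) ∧
    q = ⟨b, .concl, []⟩) a}

/-- The right-hand side of the first premise of the rules for `let * = M in N` outside the branches
of conditionals; tokens stop there. -/
def Deriv.unitCuts {Γ : Ctx} {M : Term} {A : Ty} (d : Deriv Γ M A) (a : Addr) : Set Pos :=
  {q | d.Any false (fun e b => (match e with | .letStar _ _ _ => True | _ => False) ∧
    q = ⟨0 :: b, .concl, []⟩) a}

/-- The guards of the outermost conditionals. -/
def Deriv.guards {Γ : Ctx} {M : Term} {A : Ty} (d : Deriv Γ M A) (a : Addr) : Set Pos :=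
  {q | d.Any false (fun e b => (match e with | .ite _ _ _ _ => True | _ => False) ∧
    q = guardPos b) a}

/-- The initial configuration for a derivation placed at address `a`: tokens lie on the negative
positions of the conclusion and on the unit axioms; the circuit is the identity. -/
def Deriv.init {Γ : Ctx} {M : Term} {A : Ty} (d : Deriv Γ M A) (a : Addr) : Config :=
  ⟨off (seqPos Γ A a false ∪ d.units a), .relabel id⟩

/-- The final configurations for a derivation placed at address `a`: tokens lie exactly on the
positive positions of the conclusion, on the positions where units are consumed, and on the guards
of the conditionals, all of which have been executed. -/
def Deriv.Final {Γ : Ctx} {M : Term} {A : Ty} (d : Deriv Γ M A) (a : Addr) (C : Config) : Prop :=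
  C.tokens = off (seqPos Γ A a true ∪ d.unitCuts a) ∪ on (d.guards a)

/-- Closure of a family of transitions, which consume the tokens `I`, produce the tokens `O` and
append the circuit `E`, into a relation between configurations. -/
def stepOf (F : Set Token → Set Token → Circ → Prop) (C C' : Config) : Prop :=
  ∃ I O E, F I O E ∧ I ⊆ C.tokens ∧ C' = ⟨(C.tokens \ I) ∪ O, .seq C.circ E⟩

/-- The paths to the factors of an `n`-fold tensor product of base types. -/
def factors : ℕ → List (List Dir)
  | 0 => []
  | 1 => [[]]
  | n + 2 => [.left] :: (factors (n + 1)).map (.right :: ·)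

/-- The wires of the `n` factors of the type found below `dir` on the right-hand side of the rule
at address `a`. -/
def opWires (a : Addr) (dir : Dir) (n : ℕ) : List Pos :=
  (factors n).map (fun p => ⟨a, .concl, dir :: p⟩)

/-- The structural transitions of the last rule: a token moves, its wire is renamed. -/
def Deriv.Structural {Γ : Ctx} {M : Term} {A : Ty} (d : Deriv Γ M A) (a : Addr)
    (I O : Set Token) (E : Circ) : Prop :=
  ∃ p q, d.Move a p q ∧ I = off {p} ∧ O = off {q} ∧ E = .rename p q

/-- The transitions of the synchronous machine on a derivation placed at address `a`:
structural moves, crossing of an atomic identity axiom, application of an operator when all its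
inputs have arrived, and the synchronous rule. The latter applies to an if-then-else rule as soon
as an unused token lies on its guard and tokens lie on all negative positions of `Γ ⊢ A`
(`Γ` being the context of the branches), provided that the machine, started separately on each
branch, reaches a final configuration; the tokens then jump to the positive positions of `Γ ⊢ A`,
and the two circuits obtained become the branches of a conditional circuit. -/
def Deriv.Fires : ∀ {Γ : Ctx} {M : Term} {A : Ty},
    Deriv Γ M A → Addr → Set Token → Set Token → Circ → Prop
  | Γ, _, A, .ax _, a, I, O, E =>
      ∃ p q, p ∈ seqPos Γ A a false ∧ q ∈ seqPos Γ A a true ∧ p.path = q.path ∧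
        I = off {p} ∧ O = off {q} ∧ E = .rename p q
  | _, _, _, .lam h d, a, I, O, E =>
      (Deriv.lam h d).Structural a I O E ∨ d.Fires (0 :: a) I O E
  | _, _, _, .app h d₀ d₁, a, I, O, E =>
      (Deriv.app h d₀ d₁).Structural a I O E ∨
        d₀.Fires (0 :: a) I O E ∨ d₁.Fires (1 :: a) I O E
  | _, _, _, .star _, _, _, _, _ => False
  | _, _, _, .letStar h d₀ d₁, a, I, O, E =>
      (Deriv.letStar h d₀ d₁).Structural a I O E ∨
        d₀.Fires (0 :: a) I O E ∨ d₁.Fires (1 :: a) I O E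
  | _, _, _, .pair h d₀ d₁, a, I, O, E =>
      (Deriv.pair h d₀ d₁).Structural a I O E ∨
        d₀.Fires (0 :: a) I O E ∨ d₁.Fires (1 :: a) I O E
  | _, _, _, .letPair h hxy hx hy d₀ d₁, a, I, O, E =>
      (Deriv.letPair h hxy hx hy d₀ d₁).Structural a I O E ∨
        d₀.Fires (0 :: a) I O E ∨ d₁.Fires (1 :: a) I O E
  | _, _, A, .ite (Γ := Γ) h d₀ d₁ d₂, a, I, O, E =>
      (Deriv.ite h d₀ d₁ d₂).Structural a I O E ∨ d₀.Fires (0 :: a) I O E ∨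
        ∃ C₁ C₂ : Config,
          Relation.ReflTransGen (stepOf (d₁.Fires (1 :: a))) (d₁.init (1 :: a)) C₁ ∧
          d₁.Final (1 :: a) C₁ ∧
          Relation.ReflTransGen (stepOf (d₂.Fires (2 :: a))) (d₂.init (2 :: a)) C₂ ∧
          d₂.Final (2 :: a) C₂ ∧
          I = off {guardPos a} ∪ off (seqPos Γ A a false) ∧
          O = on {guardPos a} ∪ off (seqPos Γ A a true) ∧
          E = .ite (guardPos a)
            (.seq (.transfer a (1 :: a)) (.seq C₁.circ (.transfer (1 :: a) a)))
            (.seq (.transfer a (2 :: a)) (.seq C₂.circ (.transfer (2 :: a) a)))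
  | Γ, _, A, .op (c := c) _ _, a, I, O, E =>
      I = off (seqPos Γ A a false) ∧ O = off (seqPos Γ A a true) ∧
        E = .op c (opWires a .left c.inputs.length) (opWires a .right c.outputs.length)

/-- One step of the synchronous compilation of `π`. -/
def Deriv.Step {Γ : Ctx} {M : Term} {A : Ty} (π : Deriv Γ M A) : Config → Config → Prop :=
  stepOf (π.Fires [])

/-- The configurations that the synchronous compilation of `π` can reach. -/
def Deriv.Reachable {Γ : Ctx} {M : Term} {A : Ty} (π : Deriv Γ M A) (C : Config) : Prop :=
  Relation.ReflTransGen π.Step (π.init []) C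

/-- A deadlock: no step is possible although the configuration is not final. -/
def Deriv.Deadlock {Γ : Ctx} {M : Term} {A : Ty} (π : Deriv Γ M A) (C : Config) : Prop :=
  ¬ π.Final [] C ∧ ∀ C', ¬ π.Step C C'

end QLambda

namespace QLambda

/-! ## Outer sub-derivations -/

/-! Outside the branches of conditionals, the machine plays the token game of a finite net,
`outerNet`, whose events are the structural moves and the crossings of synchronization points.
Typing is linear, so each place of the net has at most one producer and at most one consumer
(`Deriv.mv_unique`, `Node.bd_unique`). An event therefore occurs at most once, and the machine
always terminates, whether or not the graph is acyclic (`Net.Game.acc`). If moreover the flow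
between places is well-founded and the branches can be executed, then every event has occurred when
the machine is stuck (`Net.Inv.eq_events`), and the configuration is final (`final_of_inv`).

It remains to compare cycles of the flow with cycles of the synchronization graph. A flow cycle
might cross no synchronization point at all; conversely, a cycle through axioms and operators that
no token ever enters would not prevent a final configuration. Typing excludes both. By
`Judgement.exists_increasing`, positions carry rational labels that strictly increase along
structural moves, axioms and operators. These labels come from a realizability argument: a type is
interpreted by a biorthogonally closed family of sets of labellings, and every derivation realizes
its type (`Deriv.behaviour_mem`). Hence every cycle passes through a conditional
(`OuterFlow.exists_ite`). In a final configuration all guards are used, so each conditional has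
fired, its inputs have a finite history, and no cycle can pass through it
(`Judgement.acyclic_of_final`).

Nested conditionals are treated by induction. No token path links the outer part with a branch, or
two branches, so the graph is the disjoint union of its regions (`deepAcyclic_iff`), and a branch
can be executed exactly when its own graph is acyclic (`Deriv.exec_iff`). -/

/-- A derivation bundled with its conclusion. -/
structure Judgement where
  {ctx : Ctx}
  {term : Term}
  {ty : Ty}
  deriv : Deriv ctx term ty

/-- The premise with a given number of the last rule; the branches of a conditional are left
out. -/
def Deriv.prem : ∀ {Γ : Ctx} {M : Term} {A : Ty}, Deriv Γ M A → ℕ → Option Judgement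
  | _, _, _, .lam _ d, 0 => some ⟨d⟩
  | _, _, _, .app _ d₀ _, 0 => some ⟨d₀⟩
  | _, _, _, .app _ _ d₁, 1 => some ⟨d₁⟩
  | _, _, _, .letStar _ d₀ _, 0 => some ⟨d₀⟩
  | _, _, _, .letStar _ _ d₁, 1 => some ⟨d₁⟩
  | _, _, _, .pair _ d₀ _, 0 => some ⟨d₀⟩
  | _, _, _, .pair _ _ d₁, 1 => some ⟨d₁⟩
  | _, _, _, .letPair _ _ _ _ d₀ _, 0 => some ⟨d₀⟩
  | _, _, _, .letPair _ _ _ _ _ d₁, 1 => some ⟨d₁⟩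
  | _, _, _, .ite _ d₀ _ _, 0 => some ⟨d₀⟩
  | _, _, _, _, _ => none

/-- `Node r a e b`: in the derivation `r` placed at address `a`, the sub-derivation at address `b`
is `e`, and it does not lie inside a branch of a conditional. -/
inductive Node (r : Judgement) (a : Addr) : Judgement → Addr → Prop
  | root : Node r a r a
  | child {e e' : Judgement} {b : Addr} {k : ℕ} :
      Node r a e b → e.deriv.prem k = some e' → Node r a e' (k :: b)

/-- `Node` extends addresses at the deep end, whereas recursion on derivations peels off the root.
This lemma and `Node.cases_head` translate between the two. -/
theorem Node.of_prem {r r' e : Judgement} {a b : Addr} {k : ℕ} (h : r.deriv.prem k = some r')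
    (hn : Node r' (k :: a) e b) : Node r a e b := by
  induction hn with
  | root => exact .child .root h
  | child _ h' ih => exact .child ih h'

theorem Node.cases_head {r e : Judgement} {a b : Addr} (h : Node r a e b) :
    (e = r ∧ b = a) ∨ ∃ k r', r.deriv.prem k = some r' ∧ Node r' (k :: a) e b := by
  induction h with
  | root => exact .inl ⟨rfl, rfl⟩
  | @child e e' b k hn hp ih =>
    rcases ih with ⟨rfl, rfl⟩ | ⟨j, r', hr, hn'⟩
    · exact .inr ⟨k, e', hp, .root⟩
    · exact .inr ⟨j, r', hr, .child hn' hp⟩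

theorem Node.suffix {r e : Judgement} {a b : Addr} (h : Node r a e b) : a <:+ b := by
  induction h with
  | root => exact List.suffix_rfl
  | child _ _ ih => exact ih.trans (List.suffix_cons _ _)

theorem Node.length_le {r e : Judgement} {a b : Addr} (h : Node r a e b) : a.length ≤ b.length :=
  h.suffix.length_le

theorem Node.eq_of_root {r e : Judgement} {a b : Addr} (h : Node r a e b) (hb : b = a) :
    e = r := by
  cases h with
  | root => rfl
  | child hn _ =>
    have := hn.length_le
    rw [← hb, List.length_cons] at this
    omega

theorem Node.unique {r e e' : Judgement} {a b : Addr} (h : Node r a e b) (h' : Node r a e' b) :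
    e = e' := by
  induction h generalizing e' with
  | root => exact (h'.eq_of_root rfl).symm
  | @child e₁ e₂ b k hn hp ih =>
    cases h' with
    | root => have := hn.length_le; simp at this
    | child hn' hp' =>
      obtain rfl := ih hn'
      exact Option.some_injective _ (hp.symm.trans hp')

/-- This replaces the recursive `Deriv.Any` by a quantifier over addressed rules. Global arguments
can then compare two rules through their addresses, without induction on the derivation. -/
theorem Deriv.any_false_iff
    (P : ∀ {Γ : Ctx} {M : Term} {A : Ty}, Deriv Γ M A → Addr → Prop) {Γ : Ctx} {M : Term} {A : Ty}
    (d : Deriv Γ M A) (a : Addr) :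
    d.Any false P a ↔ ∃ e b, Node ⟨d⟩ a e b ∧ P e.deriv b := by
  have key : ∀ {Γ : Ctx} {M : Term} {A : Ty} (d : Deriv Γ M A) (a : Addr),
      (∃ e b, Node ⟨d⟩ a e b ∧ P e.deriv b) ↔
        P d a ∨ ∃ k r', d.prem k = some r' ∧ ∃ e b, Node r' (k :: a) e b ∧ P e.deriv b := by
    intro Γ M A d a
    constructor
    · rintro ⟨e, b, hn, hP⟩
      rcases hn.cases_head with ⟨rfl, rfl⟩ | ⟨k, r', h, hn'⟩
      · exact .inl hP
      · exact .inr ⟨k, r', h, e, b, hn', hP⟩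
    · rintro (h | ⟨k, r', h, e, b, hn, hP⟩)
      · exact ⟨_, _, .root, h⟩
      · exact ⟨e, b, .of_prem h hn, hP⟩
  have one : ∀ {Γ : Ctx} {M : Term} {A : Ty} (d : Deriv Γ M A) (Q : ℕ → Judgement → Prop)
      (r : Judgement), d.prem 0 = some r → (∀ k, d.prem (k + 1) = none) →
      ((∃ k r', d.prem k = some r' ∧ Q k r') ↔ Q 0 r) := by
    intro Γ M A d Q r h h'
    constructor
    · rintro ⟨_ | k, r', hk, hQ⟩
      · simp_all
      · simp_all
    · exact fun hQ => ⟨0, r, h, hQ⟩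
  have two : ∀ {Γ : Ctx} {M : Term} {A : Ty} (d : Deriv Γ M A) (Q : ℕ → Judgement → Prop)
      (r s : Judgement), d.prem 0 = some r → d.prem 1 = some s → (∀ k, d.prem (k + 2) = none) →
      ((∃ k r', d.prem k = some r' ∧ Q k r') ↔ Q 0 r ∨ Q 1 s) := by
    intro Γ M A d Q r s h h' h''
    constructor
    · rintro ⟨_ | _ | k, r', hk, hQ⟩
      · simp_all
      · simp_all
      · simp_all
    · rintro (hQ | hQ)
      · exact ⟨0, r, h, hQ⟩
      · exact ⟨1, s, h', hQ⟩
  have none' : ∀ {Γ : Ctx} {M : Term} {A : Ty} (d : Deriv Γ M A) (Q : ℕ → Judgement → Prop),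
      (∀ k, d.prem k = none) → ((∃ k r', d.prem k = some r' ∧ Q k r') ↔ False) := by
    intro Γ M A d Q h
    simp [h]
  rw [key]
  induction d generalizing a with
  | ax h => rw [none' _ _ (fun _ => rfl)]; simp [Deriv.Any]
  | star h => rw [none' _ _ (fun _ => rfl)]; simp [Deriv.Any]
  | op h h' => rw [none' _ _ (fun _ => rfl)]; simp [Deriv.Any]
  | lam h d ih =>
    rw [one _ _ ⟨d⟩ rfl (fun _ => rfl), key]
    exact or_congr Iff.rfl (ih _)
  | app h d₀ d₁ ih₀ ih₁ =>
    rw [two _ _ ⟨d₀⟩ ⟨d₁⟩ rfl rfl (fun _ => rfl), key, key]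
    exact or_congr Iff.rfl (or_congr (ih₀ _) (ih₁ _))
  | letStar h d₀ d₁ ih₀ ih₁ =>
    rw [two _ _ ⟨d₀⟩ ⟨d₁⟩ rfl rfl (fun _ => rfl), key, key]
    exact or_congr Iff.rfl (or_congr (ih₀ _) (ih₁ _))
  | pair h d₀ d₁ ih₀ ih₁ =>
    rw [two _ _ ⟨d₀⟩ ⟨d₁⟩ rfl rfl (fun _ => rfl), key, key]
    exact or_congr Iff.rfl (or_congr (ih₀ _) (ih₁ _))
  | letPair h _ _ _ d₀ d₁ ih₀ ih₁ =>
    rw [two _ _ ⟨d₀⟩ ⟨d₁⟩ rfl rfl (fun _ => rfl), key, key]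
    exact or_congr Iff.rfl (or_congr (ih₀ _) (ih₁ _))
  | ite h d₀ d₁ d₂ ih₀ _ _ =>
    rw [one _ _ ⟨d₀⟩ rfl (fun _ => rfl), key]
    refine or_congr Iff.rfl (Iff.trans (or_iff_left (by simp)) (ih₀ _))

/-! ## Contexts and paths -/

theorem Ctx.mem_dom {Γ : Ctx} {x : ℕ} {B : Ty} (h : (x, B) ∈ Γ) : x ∈ Γ.dom :=
  Finset.mem_image.2 ⟨_, h, rfl⟩

theorem Ctx.exists_of_mem_dom {Γ : Ctx} {x : ℕ} (h : x ∈ Γ.dom) : ∃ B, (x, B) ∈ Γ := by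
  obtain ⟨⟨y, B⟩, hB, rfl⟩ := Finset.mem_image.1 h
  exact ⟨B, hB⟩

theorem Split.mem {Θ Δ Γ : Ctx} (h : Split Θ Δ Γ) {x : ℕ} {B : Ty} :
    (x, B) ∈ Θ ↔ (x, B) ∈ Δ ∨ (x, B) ∈ Γ := by
  rw [h.2, Finset.mem_union]

theorem Split.not_both {Θ Δ Γ : Ctx} (h : Split Θ Δ Γ) {x : ℕ} {B C : Ty} (hB : (x, B) ∈ Δ)
    (hC : (x, C) ∈ Γ) : False :=
  Finset.disjoint_left.1 h.1 (Ctx.mem_dom hB) (Ctx.mem_dom hC)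

/-- A variable is declared at most once in the context of a derivable judgement. -/
theorem Deriv.ctx_functional {Γ : Ctx} {M : Term} {A : Ty} (d : Deriv Γ M A) :
    ∀ {x : ℕ} {B C : Ty}, (x, B) ∈ Γ → (x, C) ∈ Γ → B = C := by
  have union : ∀ {Θ Δ Γ : Ctx}, Split Θ Δ Γ →
      (∀ {x : ℕ} {B C : Ty}, (x, B) ∈ Δ → (x, C) ∈ Δ → B = C) →
      (∀ {x : ℕ} {B C : Ty}, (x, B) ∈ Γ → (x, C) ∈ Γ → B = C) →
      ∀ {x : ℕ} {B C : Ty}, (x, B) ∈ Θ → (x, C) ∈ Θ → B = C := by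
    intro Θ Δ Γ hs h₁ h₂ x B C hB hC
    rcases hs.mem.1 hB with hB | hB <;> rcases hs.mem.1 hC with hC | hC
    · exact h₁ hB hC
    · exact (hs.not_both hB hC).elim
    · exact (hs.not_both hC hB).elim
    · exact h₂ hB hC
  induction d with
  | ax h => subst h; simp +contextual
  | star h => subst h; simp
  | op h _ => subst h; simp
  | lam _ d ih =>
    intro x B C hB hC
    exact ih (Finset.mem_insert_of_mem hB) (Finset.mem_insert_of_mem hC)
  | app h _ _ ih₀ ih₁ => exact union h @ih₀ @ih₁
  | letStar h _ _ ih₀ ih₁ => exact union h @ih₀ @ih₁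
  | pair h _ _ ih₀ ih₁ => exact union h @ih₀ @ih₁
  | letPair h _ _ _ _ _ ih₀ ih₁ =>
    intro x B C
    refine union h @ih₀ (fun {x B C} hB hC => ?_)
    exact ih₁ (Finset.mem_insert_of_mem (Finset.mem_insert_of_mem hB))
      (Finset.mem_insert_of_mem (Finset.mem_insert_of_mem hC))
  | ite h _ _ _ ih₀ ih₁ _ => exact union h @ih₀ @ih₁

theorem Ty.finite_paths (A : Ty) : {p | (A.sign p).isSome}.Finite := by
  induction A with
  | base b =>
    refine (Set.finite_singleton []).subset ?_
    rintro (_ | ⟨_, _⟩) h <;> simp_all [Ty.sign]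
  | one =>
    refine (Set.finite_singleton []).subset ?_
    rintro (_ | ⟨_, _⟩) h <;> simp_all [Ty.sign]
  | lolli A B hA hB =>
    refine ((hA.image (.left :: ·)).union (hB.image (.right :: ·))).subset ?_
    rintro (_ | ⟨_ | _, _⟩) h <;> simp_all [Ty.sign]
  | tensor A B hA hB =>
    refine ((hA.image (.left :: ·)).union (hB.image (.right :: ·))).subset ?_
    rintro (_ | ⟨_ | _, _⟩) h <;> simp_all [Ty.sign]

/-- Contexts are sets of pairs and could give a variable two types. Derivability is what excludes
this, so that a position has only one sign. -/
theorem seqPos_disjoint {Γ : Ctx} {M : Term} {A : Ty} (d : Deriv Γ M A) {a : Addr} {q : Pos}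
    {s t : Bool} (h : q ∈ seqPos Γ A a s) (h' : q ∈ seqPos Γ A a t) : s = t := by
  obtain ⟨b, pl, p⟩ := q
  obtain ⟨-, h⟩ := h
  obtain ⟨-, h'⟩ := h'
  cases pl with
  | concl => simp_all
  | ctx x =>
    obtain ⟨B, hB, h⟩ := h
    obtain ⟨C, hC, h'⟩ := h'
    obtain rfl := d.ctx_functional hB hC
    simp_all

theorem finite_seqPos (Γ : Ctx) (A : Ty) (a : Addr) (s : Bool) : (seqPos Γ A a s).Finite := by
  have h₁ := (A.finite_paths.image fun p => (⟨a, .concl, p⟩ : Pos))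
  have h₂ : (⋃ c ∈ Γ, (fun p => (⟨a, .ctx c.1, p⟩ : Pos)) ''
      {p | (c.2.sign p).isSome}).Finite :=
    Γ.finite_toSet.biUnion fun c _ => c.2.finite_paths.image _
  refine (h₁.union h₂).subset ?_
  rintro ⟨b, pl, p⟩ ⟨rfl, h⟩
  cases pl with
  | concl => exact .inl ⟨p, by simp at h; simp [h], rfl⟩
  | ctx x =>
    obtain ⟨B, hB, h⟩ := h
    refine .inr (Set.mem_biUnion hB ⟨p, by simp [h], rfl⟩)

/-! ## The interface of a rule -/

theorem mem_seqPos_concl {Γ : Ctx} {A : Ty} {a b : Addr} {s : Bool} {p : List Dir} :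
    (⟨b, .concl, p⟩ : Pos) ∈ seqPos Γ A a s ↔ b = a ∧ A.sign p = some s := Iff.rfl

theorem mem_seqPos_ctx {Γ : Ctx} {A : Ty} {a b : Addr} {s : Bool} {x : ℕ} {p : List Dir} :
    (⟨b, .ctx x, p⟩ : Pos) ∈ seqPos Γ A a s ↔
      b = a ∧ ∃ B, (x, B) ∈ Γ ∧ B.sign p = some (!s) := Iff.rfl

/-- The positions where a rule takes over a token (`s = false`): the negative positions of its
conclusion and the positive positions of its premises; and those where it hands over a token
(`s = true`). -/
def Deriv.bd {Γ : Ctx} {M : Term} {A : Ty} (d : Deriv Γ M A) (b : Addr) (s : Bool) : Set Pos :=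
  seqPos Γ A b s ∪ {q | ∃ k e, d.prem k = some e ∧ q ∈ seqPos e.ctx e.ty (k :: b) (!s)}

/-- A structural move from `q` to `r` (`s = false`), or from `r` to `q` (`s = true`). -/
def Deriv.Mv {Γ : Ctx} {M : Term} {A : Ty} (d : Deriv Γ M A) (b : Addr) (s : Bool) (q r : Pos) :
    Prop :=
  d.Corr b q r s ∨ d.Corr b r q (!s)

/-- The positions where units are consumed (`s = false`) and created (`s = true`). -/
def Deriv.UnitPos : ∀ {Γ : Ctx} {M : Term} {A : Ty}, Deriv Γ M A → Addr → Bool → Pos → Prop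
  | _, _, _, .letStar _ _ _, b, false, q => q = ⟨0 :: b, .concl, []⟩
  | _, _, _, .star _, b, true, q => q = ⟨b, .concl, []⟩
  | _, _, _, _, _, _, _ => False

theorem Deriv.move_iff {Γ : Ctx} {M : Term} {A : Ty} (d : Deriv Γ M A) (b : Addr) (q r : Pos) :
    d.Move b q r ↔ d.Mv b false q r := Iff.rfl

theorem Deriv.mv_not {Γ : Ctx} {M : Term} {A : Ty} (d : Deriv Γ M A) (b : Addr) (s : Bool)
    (q r : Pos) : d.Mv b (!s) r q ↔ d.Mv b s q r := by
  simp [Deriv.Mv, or_comm]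

theorem Deriv.mem_bd_zero {Γ : Ctx} {M : Term} {A : Ty} (d : Deriv Γ M A) {b : Addr} {s : Bool}
    {q : Pos} (h : ∀ k, d.prem k = none) : q ∈ d.bd b s ↔ q ∈ seqPos Γ A b s := by
  simp [Deriv.bd, h]

theorem Deriv.mem_bd_one {Γ : Ctx} {M : Term} {A : Ty} (d : Deriv Γ M A) {b : Addr} {s : Bool}
    {q : Pos} {e : Judgement} (h : d.prem 0 = some e) (h' : ∀ k, d.prem (k + 1) = none) :
    q ∈ d.bd b s ↔ q ∈ seqPos Γ A b s ∨ q ∈ seqPos e.ctx e.ty (0 :: b) (!s) := by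
  refine or_congr Iff.rfl ⟨?_, fun hq => ⟨0, e, h, hq⟩⟩
  rintro ⟨_ | k, f, hf, hq⟩ <;> simp_all

theorem Deriv.mem_bd_two {Γ : Ctx} {M : Term} {A : Ty} (d : Deriv Γ M A) {b : Addr} {s : Bool}
    {q : Pos} {e f : Judgement} (h : d.prem 0 = some e) (h' : d.prem 1 = some f)
    (h'' : ∀ k, d.prem (k + 2) = none) :
    q ∈ d.bd b s ↔ q ∈ seqPos Γ A b s ∨ q ∈ seqPos e.ctx e.ty (0 :: b) (!s) ∨
      q ∈ seqPos f.ctx f.ty (1 :: b) (!s) := by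
  refine or_congr Iff.rfl ⟨?_, ?_⟩
  · rintro ⟨_ | _ | k, g, hg, hq⟩ <;> simp_all
  · rintro (hq | hq)
    · exact ⟨0, e, h, hq⟩
    · exact ⟨1, f, h', hq⟩

/-! ### Each position of the interface of a rule has exactly one role there. -/

theorem Deriv.corr_mem {Γ : Ctx} {M : Term} {A : Ty} (d : Deriv Γ M A) {b : Addr} {s : Bool}
    {q r : Pos} (h : d.Corr b q r s) : q ∈ d.bd b s ∧ r ∈ d.bd b (!s) := by
  cases d with
  | ax => exact h.elim
  | star => exact h.elim
  | op => exact h.elim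
  | lam h d =>
    rw [Deriv.mem_bd_one _ rfl (fun _ => rfl), Deriv.mem_bd_one _ rfl (fun _ => rfl)]
    simp only [Deriv.Corr, glueCtx, glueVar, glueConcl] at h
    rcases h with ⟨x, C, hx, p, hs, rfl, rfl⟩ | ⟨p, hs, rfl, rfl⟩ | ⟨p, hs, rfl, rfl⟩ <;>
        simp [mem_seqPos_concl, mem_seqPos_ctx, Ty.sign, hs] <;> grind
  | app hsp d₀ d₁ =>
    have hm := fun x B => hsp.mem (x := x) (B := B)
    rw [Deriv.mem_bd_two _ rfl rfl (fun _ => rfl), Deriv.mem_bd_two _ rfl rfl (fun _ => rfl)]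
    simp only [Deriv.Corr, glueCtx, glueVar, glueConcl] at h
    rcases h with ⟨x, C, hx, p, hs, rfl, rfl⟩ | ⟨x, C, hx, p, hs, rfl, rfl⟩ | ⟨p, hs, rfl, rfl⟩ | ⟨p, hs, rfl, rfl⟩ <;>
        simp [mem_seqPos_concl, mem_seqPos_ctx, Ty.sign, hs] <;> grind
  | letStar hsp d₀ d₁ =>
    have hm := fun x B => hsp.mem (x := x) (B := B)
    rw [Deriv.mem_bd_two _ rfl rfl (fun _ => rfl), Deriv.mem_bd_two _ rfl rfl (fun _ => rfl)]
    simp only [Deriv.Corr, glueCtx, glueVar, glueConcl] at h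
    rcases h with ⟨x, C, hx, p, hs, rfl, rfl⟩ | ⟨x, C, hx, p, hs, rfl, rfl⟩ | ⟨p, hs, rfl, rfl⟩ <;>
        simp [mem_seqPos_concl, mem_seqPos_ctx, hs] <;> grind
  | pair hsp d₀ d₁ =>
    have hm := fun x B => hsp.mem (x := x) (B := B)
    rw [Deriv.mem_bd_two _ rfl rfl (fun _ => rfl), Deriv.mem_bd_two _ rfl rfl (fun _ => rfl)]
    simp only [Deriv.Corr, glueCtx, glueVar, glueConcl] at h
    rcases h with ⟨x, C, hx, p, hs, rfl, rfl⟩ | ⟨x, C, hx, p, hs, rfl, rfl⟩ | ⟨p, hs, rfl, rfl⟩ | ⟨p, hs, rfl, rfl⟩ <;>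
        simp [mem_seqPos_concl, mem_seqPos_ctx, Ty.sign, hs] <;> grind
  | letPair hsp _ _ _ d₀ d₁ =>
    have hm := fun x B => hsp.mem (x := x) (B := B)
    rw [Deriv.mem_bd_two _ rfl rfl (fun _ => rfl), Deriv.mem_bd_two _ rfl rfl (fun _ => rfl)]
    simp only [Deriv.Corr, glueCtx, glueVar, glueConcl] at h
    rcases h with ⟨x, C, hx, p, hs, rfl, rfl⟩ | ⟨x, C, hx, p, hs, rfl, rfl⟩ | ⟨p, hs, rfl, rfl⟩ | ⟨p, hs, rfl, rfl⟩ | ⟨p, hs, rfl, rfl⟩ <;>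
        simp [mem_seqPos_concl, mem_seqPos_ctx, Ty.sign, hs] <;> grind
  | ite hsp d₀ d₁ d₂ =>
    have hm := fun x B => hsp.mem (x := x) (B := B)
    rw [Deriv.mem_bd_one _ rfl (fun _ => rfl), Deriv.mem_bd_one _ rfl (fun _ => rfl)]
    simp only [Deriv.Corr, glueCtx, glueVar] at h
    rcases h with ⟨x, C, hx, p, hs, rfl, rfl⟩ <;>
        simp [mem_seqPos_ctx] <;> grind

/-- This is linearity: the contexts of the premises share no variable and bound variables are fresh,
so the correspondences of one rule do not overlap. -/
theorem Deriv.mv_unique {Γ : Ctx} {M : Term} {A : Ty} (d : Deriv Γ M A) {b : Addr} {s : Bool}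
    {q r r' : Pos} (h : d.Mv b s q r) (h' : d.Mv b s q r') : r = r' := by
  cases d with
  | ax => exact (h.elim id id).elim
  | star => exact (h.elim id id).elim
  | op => exact (h.elim id id).elim
  | lam hx d =>
    have hx' := fun C hC => hx (Ctx.mem_dom (B := C) hC)
    simp only [Deriv.Mv, Deriv.Corr, glueCtx, glueVar, glueConcl] at h h'
    rcases h with h | h <;> rcases h with ⟨x, C, hx, p, hs, rfl, rfl⟩ | ⟨p, hs, rfl, rfl⟩ | ⟨p, hs, rfl, rfl⟩ <;>
      rcases h' with h' | h' <;> simp at h' <;> grind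
  | app hsp d₀ d₁ =>
    have hm := fun x B C => hsp.not_both (x := x) (B := B) (C := C)
    simp only [Deriv.Mv, Deriv.Corr, glueCtx, glueVar, glueConcl] at h h'
    rcases h with h | h <;> rcases h with ⟨x, C, hx, p, hs, rfl, rfl⟩ | ⟨x, C, hx, p, hs, rfl, rfl⟩ | ⟨p, hs, rfl, rfl⟩ | ⟨p, hs, rfl, rfl⟩ <;>
      rcases h' with h' | h' <;> simp at h' <;> grind
  | letStar hsp d₀ d₁ =>
    have hm := fun x B C => hsp.not_both (x := x) (B := B) (C := C)
    simp only [Deriv.Mv, Deriv.Corr, glueCtx, glueVar, glueConcl] at h h'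
    rcases h with h | h <;> rcases h with ⟨x, C, hx, p, hs, rfl, rfl⟩ | ⟨x, C, hx, p, hs, rfl, rfl⟩ | ⟨p, hs, rfl, rfl⟩ <;>
      rcases h' with h' | h' <;> simp at h' <;> grind
  | pair hsp d₀ d₁ =>
    have hm := fun x B C => hsp.not_both (x := x) (B := B) (C := C)
    simp only [Deriv.Mv, Deriv.Corr, glueCtx, glueVar, glueConcl] at h h'
    rcases h with h | h <;> rcases h with ⟨x, C, hx, p, hs, rfl, rfl⟩ | ⟨x, C, hx, p, hs, rfl, rfl⟩ | ⟨p, hs, rfl, rfl⟩ | ⟨p, hs, rfl, rfl⟩ <;>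
      rcases h' with h' | h' <;> simp at h' <;> grind
  | letPair hsp hxy hx hy d₀ d₁ =>
    have hm := fun x B C => hsp.not_both (x := x) (B := B) (C := C)
    have hx' := fun C hC => hx (Ctx.mem_dom (B := C) hC)
    have hy' := fun C hC => hy (Ctx.mem_dom (B := C) hC)
    simp only [Deriv.Mv, Deriv.Corr, glueCtx, glueVar, glueConcl] at h h'
    rcases h with h | h <;> rcases h with ⟨x, C, hx, p, hs, rfl, rfl⟩ | ⟨x, C, hx, p, hs, rfl, rfl⟩ | ⟨p, hs, rfl, rfl⟩ | ⟨p, hs, rfl, rfl⟩ | ⟨p, hs, rfl, rfl⟩ <;>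
      rcases h' with h' | h' <;> simp at h' <;> grind
  | ite hsp d₀ d₁ d₂ =>
    have hm := fun x B C => hsp.not_both (x := x) (B := B) (C := C)
    simp only [Deriv.Mv, Deriv.Corr, glueCtx, glueVar] at h h'
    rcases h with h | h <;> rcases h with ⟨x, C, hx, p, hs, rfl, rfl⟩ <;>
      rcases h' with h' | h' <;> simp at h' <;> grind

/-- Only conditionals have both moves and ports. Their moves concern the context of the guard, their
ports that of the branches, and these are disjoint. -/
theorem Deriv.not_mv_of_rootPort {Γ : Ctx} {M : Term} {A : Ty} (d : Deriv Γ M A) {b : Addr}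
    {s : Bool} {i : SyncPt} {q r : Pos} (h : d.RootPort b i s q) (h' : d.Mv b s q r) : False := by
  cases d with
  | ax => exact h'.elim id id
  | op => exact h'.elim id id
  | ite hsp d₀ d₁ d₂ =>
    have hm := fun x B C => hsp.not_both (x := x) (B := B) (C := C)
    simp only [Deriv.Mv, Deriv.Corr, glueCtx, glueVar] at h'
    obtain ⟨-, h⟩ := h
    rcases h' with ⟨x, C, hx, p, hs, rfl, rfl⟩ | ⟨x, C, hx, p, hs, rfl, rfl⟩
    · simp [mem_seqPos_ctx, guardPos] at h
      grind
    · simp [mem_seqPos_ctx, guardPos] at h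
  | _ => exact h.elim

theorem Deriv.not_mv_of_unitPos {Γ : Ctx} {M : Term} {A : Ty} (d : Deriv Γ M A) {b : Addr}
    {s : Bool} {q r : Pos} (h : d.UnitPos b s q) (h' : d.Mv b s q r) : False := by
  cases d with
  | star => exact h'.elim id id
  | letStar hsp d₀ d₁ =>
    cases s with
    | true => exact h
    | false =>
      simp only [Deriv.UnitPos] at h
      subst h
      simp [Deriv.Mv, Deriv.Corr, glueCtx, glueVar, glueConcl] at h'
  | _ => cases s <;> exact h

theorem Deriv.not_rootPort_of_unitPos {Γ : Ctx} {M : Term} {A : Ty} (d : Deriv Γ M A) {b : Addr}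
    {s : Bool} {i : SyncPt} {q : Pos} (h : d.UnitPos b s q) (h' : d.RootPort b i s q) : False := by
  cases d with
  | star => exact h'
  | letStar => exact h'
  | _ => cases s <;> exact h

theorem Deriv.rootPort_unique {Γ : Ctx} {M : Term} {A : Ty} (d : Deriv Γ M A) {b : Addr}
    {s : Bool} {i j : SyncPt} {q : Pos} (h : d.RootPort b i s q) (h' : d.RootPort b j s q) :
    i = j := by
  cases d with
  | ax => exact h.1.trans h'.1.symm
  | op => exact h.1.trans h'.1.symm
  | ite => exact h.1.trans h'.1.symm
  | _ => exact h.elim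

theorem Deriv.rootPort_mem {Γ : Ctx} {M : Term} {A : Ty} (d : Deriv Γ M A) {b : Addr}
    {s : Bool} {i : SyncPt} {q : Pos} (h : d.RootPort b i s q) : q ∈ d.bd b s := by
  cases d with
  | ax => exact .inl h.2
  | op => exact .inl h.2
  | ite hsp d₀ d₁ d₂ =>
    rw [Deriv.mem_bd_one _ rfl (fun _ => rfl)]
    rcases h with ⟨-, ⟨hq, h⟩ | ⟨rfl, rfl⟩⟩
    · left
      refine ⟨hq, ?_⟩
      obtain ⟨c, _ | x, p⟩ := q
      · obtain ⟨B, hB, h⟩ := h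
        exact ⟨B, hsp.mem.2 (.inr hB), h⟩
      · exact h
    · right
      simp [guardPos, mem_seqPos_concl, Ty.sign]
  | _ => exact h.elim

theorem Deriv.mv_mem {Γ : Ctx} {M : Term} {A : Ty} (d : Deriv Γ M A) {b : Addr}
    {s : Bool} {q r : Pos} (h : d.Mv b s q r) : q ∈ d.bd b s := by
  rcases h with h | h
  · exact (d.corr_mem h).1
  · simpa using (d.corr_mem h).2

theorem Ty.sign_lolli {A B : Ty} {p : List Dir} {s : Bool}
    (h : (Ty.lolli A B).sign p = some s) :
    (∃ p', p = .left :: p' ∧ A.sign p' = some (!s)) ∨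
      ∃ p', p = .right :: p' ∧ B.sign p' = some s := by
  rcases p with _ | ⟨_ | _, p⟩
  · simp [Ty.sign] at h
  · simp only [Ty.sign, Option.map_eq_some_iff] at h
    obtain ⟨t, h, rfl⟩ := h
    exact .inl ⟨p, rfl, by simpa using h⟩
  · exact .inr ⟨p, rfl, h⟩

theorem Ty.sign_tensor {A B : Ty} {p : List Dir} {s : Bool}
    (h : (Ty.tensor A B).sign p = some s) :
    (∃ p', p = .left :: p' ∧ A.sign p' = some s) ∨
      ∃ p', p = .right :: p' ∧ B.sign p' = some s := by
  rcases p with _ | ⟨_ | _, p⟩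
  · simp [Ty.sign] at h
  · exact .inl ⟨p, rfl, h⟩
  · exact .inr ⟨p, rfl, h⟩

theorem Ty.sign_one {p : List Dir} {s : Bool} (h : Ty.one.sign p = some s) : p = [] ∧ s = true := by
  rcases p with _ | ⟨_ | _, p⟩ <;> simp_all [Ty.sign]

theorem Ty.sign_base {c : Base} {p : List Dir} {s : Bool} (h : (Ty.base c).sign p = some s) :
    p = [] ∧ s = true := by
  rcases p with _ | ⟨_ | _, p⟩ <;> simp_all [Ty.sign]

theorem glueCtx_of_mem {Γ : Ctx} {a b : Addr} {x : ℕ} {C : Ty} {p : List Dir} {s : Bool}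
    (h : (x, C) ∈ Γ) (hs : C.sign p = some (!s)) :
    glueCtx Γ a b ⟨a, .ctx x, p⟩ ⟨b, .ctx x, p⟩ s :=
  ⟨x, C, h, p, hs, rfl, rfl⟩

/-- Every position where a rule takes over or hands over a token belongs to a structural move, to
a synchronization point, or is one where units are consumed or created. -/
theorem Deriv.bd_cases {Γ : Ctx} {M : Term} {A : Ty} (d : Deriv Γ M A) {b : Addr}
    {s : Bool} {q : Pos} (h : q ∈ d.bd b s) :
    (∃ r, d.Mv b s q r) ∨ (∃ i, d.RootPort b i s q) ∨ d.UnitPos b s q := by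
  obtain ⟨c, pl, p⟩ := q
  cases d with
  | ax => exact .inr (.inl ⟨_, rfl, by simpa [Deriv.bd, Deriv.prem] using h⟩)
  | op => exact .inr (.inl ⟨_, rfl, by simpa [Deriv.bd, Deriv.prem] using h⟩)
  | star hΓ =>
    subst hΓ
    rw [Deriv.mem_bd_zero _ (fun _ => rfl)] at h
    rcases pl with x | _
    · simp [mem_seqPos_ctx] at h
    · obtain ⟨rfl, h⟩ := h
      obtain ⟨rfl, rfl⟩ := Ty.sign_one h
      exact .inr (.inr rfl)
  | lam hx d =>
    rw [Deriv.mem_bd_one _ rfl (fun _ => rfl)] at h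
    rcases h with ⟨rfl, h⟩ | ⟨rfl, h⟩ <;> rcases pl with y | _
    · obtain ⟨B, hB, h⟩ := h
      exact .inl ⟨_, .inl (.inl (glueCtx_of_mem hB h))⟩
    · obtain ⟨p, rfl, h₁⟩ | ⟨p, rfl, h₁⟩ := Ty.sign_lolli h
      · exact .inl ⟨_, .inl (.inr (.inl ⟨p, h₁, rfl, rfl⟩))⟩
      · exact .inl ⟨_, .inl (.inr (.inr ⟨p, h₁, rfl, rfl⟩))⟩
    · obtain ⟨B, hB, h⟩ := h
      rcases Finset.mem_insert.1 hB with hB | hB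
      · cases hB
        exact .inl ⟨_, .inr (.inr (.inl ⟨p, h, rfl, rfl⟩))⟩
      · exact .inl ⟨_, .inr (.inl (glueCtx_of_mem hB h))⟩
    · exact .inl ⟨_, .inr (.inr (.inr ⟨p, h, rfl, rfl⟩))⟩
  | app hsp d₀ d₁ =>
    rw [Deriv.mem_bd_two _ rfl rfl (fun _ => rfl)] at h
    rcases h with ⟨rfl, h⟩ | ⟨rfl, h⟩ | ⟨rfl, h⟩ <;> rcases pl with y | _
    · obtain ⟨B, hB, h⟩ := h
      rcases hsp.mem.1 hB with hB | hB
      · exact .inl ⟨_, .inl (.inl (glueCtx_of_mem hB h))⟩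
      · exact .inl ⟨_, .inl (.inr (.inl (glueCtx_of_mem hB h)))⟩
    · exact .inl ⟨_, .inl (.inr (.inr (.inl ⟨p, h, rfl, rfl⟩)))⟩
    · obtain ⟨B, hB, h⟩ := h
      exact .inl ⟨_, .inr (.inl (glueCtx_of_mem hB h))⟩
    · obtain ⟨p, rfl, h₁⟩ | ⟨p, rfl, h₁⟩ := Ty.sign_lolli h
      · exact .inl ⟨_, .inl (.inr (.inr (.inr ⟨p, by simpa using h₁, rfl, rfl⟩)))⟩
      · exact .inl ⟨_, .inr (.inr (.inr (.inl ⟨p, h₁, rfl, rfl⟩)))⟩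
    · obtain ⟨B, hB, h⟩ := h
      exact .inl ⟨_, .inr (.inr (.inl (glueCtx_of_mem hB h)))⟩
    · exact .inl ⟨_, .inr (.inr (.inr (.inr ⟨p, h, rfl, rfl⟩)))⟩
  | letStar hsp d₀ d₁ =>
    rw [Deriv.mem_bd_two _ rfl rfl (fun _ => rfl)] at h
    rcases h with ⟨rfl, h⟩ | ⟨rfl, h⟩ | ⟨rfl, h⟩ <;> rcases pl with y | _
    · obtain ⟨B, hB, h⟩ := h
      rcases hsp.mem.1 hB with hB | hB
      · exact .inl ⟨_, .inl (.inl (glueCtx_of_mem hB h))⟩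
      · exact .inl ⟨_, .inl (.inr (.inl (glueCtx_of_mem hB h)))⟩
    · exact .inl ⟨_, .inl (.inr (.inr ⟨p, h, rfl, rfl⟩))⟩
    · obtain ⟨B, hB, h⟩ := h
      exact .inl ⟨_, .inr (.inl (glueCtx_of_mem hB h))⟩
    · obtain ⟨rfl, hs⟩ := Ty.sign_one h
      obtain rfl : s = false := by simpa using hs
      exact .inr (.inr rfl)
    · obtain ⟨B, hB, h⟩ := h
      exact .inl ⟨_, .inr (.inr (.inl (glueCtx_of_mem hB h)))⟩
    · exact .inl ⟨_, .inr (.inr (.inr ⟨p, h, rfl, rfl⟩))⟩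
  | pair hsp d₀ d₁ =>
    rw [Deriv.mem_bd_two _ rfl rfl (fun _ => rfl)] at h
    rcases h with ⟨rfl, h⟩ | ⟨rfl, h⟩ | ⟨rfl, h⟩ <;> rcases pl with y | _
    · obtain ⟨B, hB, h⟩ := h
      rcases hsp.mem.1 hB with hB | hB
      · exact .inl ⟨_, .inl (.inl (glueCtx_of_mem hB h))⟩
      · exact .inl ⟨_, .inl (.inr (.inl (glueCtx_of_mem hB h)))⟩
    · obtain ⟨p, rfl, h₁⟩ | ⟨p, rfl, h₁⟩ := Ty.sign_tensor h
      · exact .inl ⟨_, .inl (.inr (.inr (.inl ⟨p, h₁, rfl, rfl⟩)))⟩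
      · exact .inl ⟨_, .inl (.inr (.inr (.inr ⟨p, h₁, rfl, rfl⟩)))⟩
    · obtain ⟨B, hB, h⟩ := h
      exact .inl ⟨_, .inr (.inl (glueCtx_of_mem hB h))⟩
    · exact .inl ⟨_, .inr (.inr (.inr (.inl ⟨p, h, rfl, rfl⟩)))⟩
    · obtain ⟨B, hB, h⟩ := h
      exact .inl ⟨_, .inr (.inr (.inl (glueCtx_of_mem hB h)))⟩
    · exact .inl ⟨_, .inr (.inr (.inr (.inr ⟨p, h, rfl, rfl⟩)))⟩
  | letPair hsp hxy hx hy d₀ d₁ =>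
    rw [Deriv.mem_bd_two _ rfl rfl (fun _ => rfl)] at h
    rcases h with ⟨rfl, h⟩ | ⟨rfl, h⟩ | ⟨rfl, h⟩ <;> rcases pl with y | _
    · obtain ⟨B, hB, h⟩ := h
      rcases hsp.mem.1 hB with hB | hB
      · exact .inl ⟨_, .inl (.inl (glueCtx_of_mem hB h))⟩
      · exact .inl ⟨_, .inl (.inr (.inl (glueCtx_of_mem hB h)))⟩
    · exact .inl ⟨_, .inl (.inr (.inr (.inl ⟨p, h, rfl, rfl⟩)))⟩
    · obtain ⟨B, hB, h⟩ := h
      exact .inl ⟨_, .inr (.inl (glueCtx_of_mem hB h))⟩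
    · obtain ⟨p, rfl, h₁⟩ | ⟨p, rfl, h₁⟩ := Ty.sign_tensor h
      · exact .inl ⟨_, .inl (.inr (.inr (.inr (.inl ⟨p, h₁, rfl, rfl⟩))))⟩
      · exact .inl ⟨_, .inl (.inr (.inr (.inr (.inr ⟨p, h₁, rfl, rfl⟩))))⟩
    · obtain ⟨B, hB, h⟩ := h
      rcases Finset.mem_insert.1 hB with hB | hB
      · cases hB
        exact .inl ⟨_, .inr (.inr (.inr (.inr (.inl ⟨p, h, rfl, rfl⟩))))⟩
      rcases Finset.mem_insert.1 hB with hB | hB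
      · cases hB
        exact .inl ⟨_, .inr (.inr (.inr (.inr (.inr ⟨p, h, rfl, rfl⟩))))⟩
      · exact .inl ⟨_, .inr (.inr (.inl (glueCtx_of_mem hB h)))⟩
    · exact .inl ⟨_, .inr (.inr (.inr (.inl ⟨p, h, rfl, rfl⟩)))⟩
  | ite hsp d₀ d₁ d₂ =>
    rw [Deriv.mem_bd_one _ rfl (fun _ => rfl)] at h
    rcases h with ⟨rfl, h⟩ | ⟨rfl, h⟩ <;> rcases pl with y | _
    · obtain ⟨B, hB, h⟩ := h
      rcases hsp.mem.1 hB with hB | hB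
      · exact .inl ⟨_, .inl (glueCtx_of_mem hB h)⟩
      · exact .inr (.inl ⟨_, rfl, .inl ⟨rfl, B, hB, h⟩⟩)
    · exact .inr (.inl ⟨_, rfl, .inl ⟨rfl, h⟩⟩)
    · obtain ⟨B, hB, h⟩ := h
      exact .inl ⟨_, .inr (glueCtx_of_mem hB h)⟩
    · obtain ⟨rfl, hs⟩ := Ty.sign_base h
      obtain rfl : s = false := by simpa using hs
      exact .inr (.inl ⟨_, rfl, .inr ⟨rfl, rfl⟩⟩)

/-! ## Realizability by labellings

A labelling assigns times to the atoms of a type. A type is interpreted by a family of sets of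
labellings that is closed under biorthogonality; this shows that no token path through axioms and
operators is cyclic. -/

/-- Labellings of the atoms of a type. -/
abbrev Lab := List Dir → ℚ

/-- The labelling of the left component. -/
def Lab.l (σ : Lab) : Lab := fun p => σ (.left :: p)

/-- The labelling of the right component. -/
def Lab.r (σ : Lab) : Lab := fun p => σ (.right :: p)

/-- The labelling with given components. -/
def Lab.join (σ τ : Lab) : Lab
  | [] => 0
  | .left :: p => σ p
  | .right :: p => τ p

@[simp] theorem Lab.join_l (σ τ : Lab) : (Lab.join σ τ).l = σ := rfl
@[simp] theorem Lab.join_r (σ τ : Lab) : (Lab.join σ τ).r = τ := rfl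

/-- Along a copy of the type `A`, positive atoms go from `σ` to `τ` and negative ones from `τ` to
`σ`, with increasing labels. -/
def Below (A : Ty) (σ τ : Lab) : Prop :=
  ∀ p, (A.sign p = some true → σ p < τ p) ∧ (A.sign p = some false → τ p < σ p)

theorem below_lolli {A B : Ty} {σ τ : Lab} :
    Below (.lolli A B) σ τ ↔ Below A τ.l σ.l ∧ Below B σ.r τ.r := by
  constructor
  · intro h
    refine ⟨fun p => ⟨fun hs => ?_, fun hs => ?_⟩, fun p => ?_⟩
    · exact (h (.left :: p)).2 (by simp [Ty.sign, hs])
    · exact (h (.left :: p)).1 (by simp [Ty.sign, hs])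
    · exact h (.right :: p)
  · rintro ⟨h, h'⟩ (_ | ⟨_ | _, p⟩)
    · simp [Ty.sign]
    · refine ⟨fun hs => (h p).2 ?_, fun hs => (h p).1 ?_⟩ <;> simpa [Ty.sign] using hs
    · exact h' p

theorem below_tensor {A B : Ty} {σ τ : Lab} :
    Below (.tensor A B) σ τ ↔ Below A σ.l τ.l ∧ Below B σ.r τ.r := by
  constructor
  · exact fun h => ⟨fun p => h (.left :: p), fun p => h (.right :: p)⟩
  · rintro ⟨h, h'⟩ (_ | ⟨_ | _, p⟩)
    · simp [Ty.sign]
    · exact h p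
    · exact h' p

/-- The labelling halfway between two labellings. -/
def Lab.mid (σ τ : Lab) : Lab := fun p => (σ p + τ p) / 2

/-- Density of the rationals: the copy of a formula in the conclusion of a rule has to be inserted
strictly between the copy in a premise and the one in the environment. -/
theorem Below.mid_right {A : Ty} {σ τ : Lab} (h : Below A σ τ) : Below A σ (σ.mid τ) := by
  refine fun p => ⟨fun hs => ?_, fun hs => ?_⟩
  · have := (h p).1 hs
    simp only [Lab.mid]
    linarith
  · have := (h p).2 hs
    simp only [Lab.mid]
    linarith

theorem Below.mid_left {A : Ty} {σ τ : Lab} (h : Below A σ τ) : Below A (σ.mid τ) τ := by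
  refine fun p => ⟨fun hs => ?_, fun hs => ?_⟩
  · have := (h p).1 hs
    simp only [Lab.mid]
    linarith
  · have := (h p).2 hs
    simp only [Lab.mid]
    linarith

theorem exists_below (A : Ty) (τ : Lab) : ∃ σ, Below A σ τ := by
  refine ⟨fun p => if A.sign p = some true then τ p - 1 else τ p + 1, fun p => ⟨?_, ?_⟩⟩ <;>
    intro hs <;> simp [hs]

theorem exists_above (A : Ty) (σ : Lab) : ∃ τ, Below A σ τ := by
  refine ⟨fun p => if A.sign p = some true then σ p + 1 else σ p - 1, fun p => ⟨?_, ?_⟩⟩ <;>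
    intro hs <;> simp [hs]

/-- Two sets of labellings are orthogonal if they can be connected. -/
def Orth (A : Ty) (S T : Set Lab) : Prop := ∃ σ ∈ S, ∃ τ ∈ T, Below A σ τ

/-- The labellings whose components belong to given sets. -/
def pairSet (S T : Set Lab) : Set Lab := {ρ | ρ.l ∈ S ∧ ρ.r ∈ T}

/-- The interpretation of types. -/
def PosT : Ty → Set (Set Lab)
  | .base b => {S | Orth (.base b) S Set.univ}
  | .one => {S | Orth .one S Set.univ}
  | .lolli A B => {R | ∀ S ∈ PosT A, ∀ T, (∀ S' ∈ PosT B, Orth B S' T) →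
      Orth (.lolli A B) R (pairSet S T)}
  | .tensor A B => {R | ∀ T,
      (∀ S₁ ∈ PosT A, ∀ S₂ ∈ PosT B, Orth (.tensor A B) (pairSet S₁ S₂) T) →
      Orth (.tensor A B) R T}

/-- The orthogonal of the interpretation of a type. -/
def NegT (A : Ty) : Set (Set Lab) := {T | ∀ S ∈ PosT A, Orth A S T}

/-- A test for a function is an argument together with a test for the result; this is the defining
clause of `PosT` at `⊸`. -/
theorem pairSet_mem_negT {A B : Ty} {S T : Set Lab} (hS : S ∈ PosT A) (hT : T ∈ NegT B) :
    pairSet S T ∈ NegT (.lolli A B) := fun _ hR => hR S hS T hT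

theorem pairSet_mem_posT {A B : Ty} {S T : Set Lab} (hS : S ∈ PosT A) (hT : T ∈ PosT B) :
    pairSet S T ∈ PosT (.tensor A B) := fun _ hR => hR S hS T hT

/-- The interpretation of a type is biorthogonally closed. -/
theorem mem_posT_of_orth {A : Ty} {S : Set Lab} (h : ∀ T ∈ NegT A, Orth A S T) : S ∈ PosT A := by
  cases A with
  | base b => exact h _ fun _ h => h
  | one => exact h _ fun _ h => h
  | lolli A B => exact fun S' hS' T hT => h _ (pairSet_mem_negT hS' hT)
  | tensor A B => exact fun T hT => h _ fun R hR => hR T hT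

theorem mem_negT_tensor {A B : Ty} {T : Set Lab}
    (h : ∀ S₁ ∈ PosT A, ∀ S₂ ∈ PosT B, Orth (.tensor A B) (pairSet S₁ S₂) T) :
    T ∈ NegT (.tensor A B) := fun _ hR => hR T h

/-- Labels are unbounded, so an unconstrained partner can always be chosen late enough. At an atomic
type, `PosT` thus consists of exactly the nonempty sets. -/
theorem orth_univ_right {A : Ty} {S : Set Lab} (h : S.Nonempty) : Orth A S Set.univ := by
  obtain ⟨σ, hσ⟩ := h
  obtain ⟨τ, h⟩ := exists_above A σ
  exact ⟨σ, hσ, τ, trivial, h⟩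

theorem orth_univ_left {A : Ty} {T : Set Lab} (h : T.Nonempty) : Orth A Set.univ T := by
  obtain ⟨τ, hτ⟩ := h
  obtain ⟨σ, h⟩ := exists_below A τ
  exact ⟨σ, trivial, τ, hτ, h⟩

theorem Orth.nonempty_left {A : Ty} {S T : Set Lab} (h : Orth A S T) : S.Nonempty :=
  let ⟨σ, hσ, _⟩ := h
  ⟨σ, hσ⟩

theorem Orth.nonempty_right {A : Ty} {S T : Set Lab} (h : Orth A S T) : T.Nonempty :=
  let ⟨_, _, τ, hτ, _⟩ := h
  ⟨τ, hτ⟩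

theorem pairSet_nonempty {S T : Set Lab} (hS : S.Nonempty) (hT : T.Nonempty) :
    (pairSet S T).Nonempty :=
  let ⟨σ, hσ⟩ := hS
  let ⟨τ, hτ⟩ := hT
  ⟨.join σ τ, hσ, hτ⟩

/-- Used to see that all members of `PosT` and `NegT` are inhabited. The two halves are proved
together because `⊸` exchanges the roles of its argument. -/
theorem univ_mem (A : Ty) : Set.univ ∈ PosT A ∧ Set.univ ∈ NegT A := by
  induction A with
  | base b => exact ⟨orth_univ_right Set.univ_nonempty, fun _ h => h⟩
  | one => exact ⟨orth_univ_right Set.univ_nonempty, fun _ h => h⟩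
  | lolli A B hA hB =>
    constructor
    · exact fun S hS T hT => orth_univ_left
        (pairSet_nonempty (hA.2 S hS).nonempty_left (hT _ hB.1).nonempty_right)
    · exact fun R hR => orth_univ_right (hR _ hA.1 _ hB.2).nonempty_left
  | tensor A B hA hB =>
    constructor
    · exact fun T hT => orth_univ_left (hT _ hA.1 _ hB.1).nonempty_right
    · exact fun R hR => hR _ fun S₁ h₁ S₂ h₂ => orth_univ_right
        (pairSet_nonempty (hA.2 _ h₁).nonempty_left (hB.2 _ h₂).nonempty_left)

theorem nonempty_of_mem_posT {A : Ty} {S : Set Lab} (h : S ∈ PosT A) : S.Nonempty :=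
  ((univ_mem A).2 S h).nonempty_left

theorem nonempty_of_mem_negT {A : Ty} {T : Set Lab} (h : T ∈ NegT A) : T.Nonempty :=
  (h _ (univ_mem A).1).nonempty_right

theorem sign_tensorList (l : List Base) (p : List Dir) : (tensorList l).sign p ≠ some false := by
  induction l generalizing p with
  | nil => intro h; simpa using (Ty.sign_one h).2
  | cons b l ih =>
    cases l with
    | nil => intro h; simpa using (Ty.sign_base h).2
    | cons c l =>
      intro h
      obtain ⟨p, rfl, h⟩ | ⟨p, rfl, h⟩ := Ty.sign_tensor h
      · simpa using (Ty.sign_base h).2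
      · exact ih _ h

/-- An operator releases all its outputs at the same time; this is the set of labellings that models
the release time `N`. -/
theorem const_mem_posT (l : List Base) (N : ℚ) :
    {ρ : Lab | ∀ p, (tensorList l).sign p = some true → ρ p = N} ∈ PosT (tensorList l) := by
  induction l with
  | nil => exact orth_univ_right ⟨fun _ => N, fun _ _ => rfl⟩
  | cons b l ih =>
    cases l with
    | nil => exact orth_univ_right ⟨fun _ => N, fun _ _ => rfl⟩
    | cons c l =>
      intro T hT
      obtain ⟨ρ, ⟨h₁, h₂⟩, τ, hτ, h⟩ := hT {ρ : Lab | ∀ p, (Ty.base b).sign p = some true → ρ p = N}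
        (orth_univ_right ⟨fun _ => N, fun _ _ => rfl⟩) _ ih
      refine ⟨ρ, fun p hp => ?_, τ, hτ, h⟩
      obtain ⟨p, rfl, hp⟩ | ⟨p, rfl, hp⟩ := Ty.sign_tensor hp
      · exact h₁ p hp
      · exact h₂ p hp

/-! ## Increasing labellings of the positions -/

/-- A token goes from `p` to `q` by a structural move of the last rule, or by crossing the axiom or
the operator that it is. -/
def Deriv.RootFlow {Γ : Ctx} {M : Term} {A : Ty} (d : Deriv Γ M A) (b : Addr) (p q : Pos) : Prop :=
  d.Move b p q ∨ ∃ i, (∀ c, i ≠ .ite c) ∧ d.RootPort b i false p ∧ d.RootPort b i true q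

theorem Deriv.suffix_of_mem_bd {Γ : Ctx} {M : Term} {A : Ty} (d : Deriv Γ M A) {b : Addr}
    {s : Bool} {q : Pos} (h : q ∈ d.bd b s) : b <:+ q.addr := by
  rcases h with h | ⟨k, e, -, h⟩
  · rw [h.1]
  · rw [h.1]
    exact List.suffix_cons _ _

theorem Deriv.RootFlow.mem {Γ : Ctx} {M : Term} {A : Ty} {d : Deriv Γ M A} {b : Addr} {p q : Pos}
    (h : d.RootFlow b p q) : p ∈ d.bd b false ∧ q ∈ d.bd b true := by
  rcases h with h | ⟨i, -, hp, hq⟩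
  · rw [Deriv.move_iff] at h
    exact ⟨d.mv_mem h, d.mv_mem ((d.mv_not b false p q).2 h)⟩
  · exact ⟨d.rootPort_mem hp, d.rootPort_mem hq⟩

/-- A labelling of positions that increases along the paths of tokens that go through structural
moves, axioms and operators. -/
def Increasing (r : Judgement) (a : Addr) (τ : Pos → ℚ) : Prop :=
  ∀ e b p q, Node r a e b → e.deriv.RootFlow b p q → τ p < τ q

theorem increasing_of_prem {r : Judgement} {a : Addr} {τ : Pos → ℚ}
    (h : ∀ p q, r.deriv.RootFlow a p q → τ p < τ q)
    (h' : ∀ k e, r.deriv.prem k = some e → Increasing e (k :: a) τ) : Increasing r a τ := by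
  intro e b p q hn hf
  rcases hn.cases_head with ⟨rfl, rfl⟩ | ⟨k, r', hk, hn⟩
  · exact h p q hf
  · exact h' k r' hk e b p q hn hf

/-- The rules above `a` only touch positions whose address extends `a`. This is why labellings of
different premises can be put together without interference. -/
theorem Increasing.congr {r : Judgement} {a : Addr} {τ τ' : Pos → ℚ} (h : Increasing r a τ)
    (h' : ∀ q : Pos, a <:+ q.addr → τ' q = τ q) : Increasing r a τ' := by
  intro e b p q hn hf
  have hs := hn.suffix
  rw [h' p (hs.trans (Deriv.suffix_of_mem_bd _ hf.mem.1)),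
    h' q (hs.trans (Deriv.suffix_of_mem_bd _ hf.mem.2))]
  exact h e b p q hn hf

/-- The labelling given by `g` at the root, and by `τ₀` and `τ₁` above its premises. -/
def assemble (a : Addr) (g : Place → Lab) (τ₀ τ₁ : Pos → ℚ) (q : Pos) : ℚ :=
  if 0 :: a <:+ q.addr then τ₀ q else if 1 :: a <:+ q.addr then τ₁ q else g q.place q.path

theorem not_cons_suffix (k : ℕ) (a : Addr) : ¬ k :: a <:+ a := fun h => by
  have := h.length_le
  simp at this

theorem not_zero_cons_suffix {a c : Addr} (h : 1 :: a <:+ c) : ¬ 0 :: a <:+ c := fun h' => by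
  have := List.suffix_of_suffix_length_le h h' (by simp)
  simpa using this.eq_of_length (by simp)

@[simp] theorem assemble_root (a : Addr) (g : Place → Lab) (τ₀ τ₁ : Pos → ℚ) (pl : Place)
    (p : List Dir) : assemble a g τ₀ τ₁ ⟨a, pl, p⟩ = g pl p := by
  simp [assemble, not_cons_suffix]

@[simp] theorem assemble_zero (a : Addr) (g : Place → Lab) (τ₀ τ₁ : Pos → ℚ) (pl : Place)
    (p : List Dir) : assemble a g τ₀ τ₁ ⟨0 :: a, pl, p⟩ = τ₀ ⟨0 :: a, pl, p⟩ := by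
  simp [assemble]

@[simp] theorem assemble_one (a : Addr) (g : Place → Lab) (τ₀ τ₁ : Pos → ℚ) (pl : Place)
    (p : List Dir) : assemble a g τ₀ τ₁ ⟨1 :: a, pl, p⟩ = τ₁ ⟨1 :: a, pl, p⟩ := by
  simp [assemble, not_zero_cons_suffix (List.suffix_refl (1 :: a))]

theorem Increasing.assemble_zero {r : Judgement} {a : Addr} {g : Place → Lab} {τ₀ τ₁ : Pos → ℚ}
    (h : Increasing r (0 :: a) τ₀) : Increasing r (0 :: a) (assemble a g τ₀ τ₁) :=
  h.congr fun q hq => by simp [assemble, hq]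

theorem Increasing.assemble_one {r : Judgement} {a : Addr} {g : Place → Lab} {τ₀ τ₁ : Pos → ℚ}
    (h : Increasing r (1 :: a) τ₁) : Increasing r (1 :: a) (assemble a g τ₀ τ₁) :=
  h.congr fun q hq => by simp [assemble, hq, not_zero_cons_suffix hq]

/-- The labelling of a formula induced by a labelling of positions. -/
def labAt (τ : Pos → ℚ) (a : Addr) (pl : Place) : Lab := fun p => τ ⟨a, pl, p⟩

@[simp] theorem labAt_assemble_root (a : Addr) (g : Place → Lab) (τ₀ τ₁ : Pos → ℚ) (pl : Place) :
    labAt (assemble a g τ₀ τ₁) a pl = g pl := by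
  funext p; simp [labAt]

@[simp] theorem labAt_assemble_zero (a : Addr) (g : Place → Lab) (τ₀ τ₁ : Pos → ℚ) (pl : Place) :
    labAt (assemble a g τ₀ τ₁) (0 :: a) pl = labAt τ₀ (0 :: a) pl := by
  funext p; simp [labAt]

@[simp] theorem labAt_assemble_one (a : Addr) (g : Place → Lab) (τ₀ τ₁ : Pos → ℚ) (pl : Place) :
    labAt (assemble a g τ₀ τ₁) (1 :: a) pl = labAt τ₁ (1 :: a) pl := by
  funext p; simp [labAt]

/-- The labelling increases along the moves given by a correspondence of positions. -/
def Incr (τ : Pos → ℚ) (G : Pos → Pos → Bool → Prop) : Prop :=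
  ∀ q r, (G q r false → τ q < τ r) ∧ (G q r true → τ r < τ q)

theorem Incr.or {τ : Pos → ℚ} {G H : Pos → Pos → Bool → Prop} (hG : Incr τ G) (hH : Incr τ H) :
    Incr τ fun q r s => G q r s ∨ H q r s :=
  fun q r => ⟨fun h => h.elim (hG q r).1 (hH q r).1, fun h => h.elim (hG q r).2 (hH q r).2⟩

/-- On the right of the turnstile, tokens leave the premise at positive atoms and enter it at
negative ones, so the premise lies below. On the left, in `incr_glueVar`, the direction is reversed.
-/
theorem incr_glueConcl {τ : Pos → ℚ} {C : Ty} {f : List Dir → Pos} {b : Addr} {pre : List Dir}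
    (h : Below C (fun p => τ ⟨b, .concl, pre ++ p⟩) (fun p => τ (f p))) :
    Incr τ (glueConcl C f b pre) := by
  intro q r
  constructor
  · rintro ⟨p, hs, rfl, rfl⟩
    exact (h p).2 hs
  · rintro ⟨p, hs, rfl, rfl⟩
    exact (h p).1 hs

theorem incr_glueVar {τ : Pos → ℚ} {C : Ty} {f : List Dir → Pos} {b : Addr} {x : ℕ}
    (h : Below C (fun p => τ (f p)) (labAt τ b (.ctx x))) : Incr τ (glueVar C f b x) := by
  intro q r
  constructor
  · rintro ⟨p, hs, rfl, rfl⟩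
    exact (h p).1 hs
  · rintro ⟨p, hs, rfl, rfl⟩
    exact (h p).2 hs

theorem incr_glueCtx {τ : Pos → ℚ} {Γ : Ctx} {a b : Addr}
    (h : ∀ x C, (x, C) ∈ Γ → Below C (labAt τ a (.ctx x)) (labAt τ b (.ctx x))) :
    Incr τ (glueCtx Γ a b) := by
  intro q r
  constructor
  · rintro ⟨x, C, hx, hg⟩
    exact (incr_glueVar (h x C hx) q r).1 hg
  · rintro ⟨x, C, hx, hg⟩
    exact (incr_glueVar (h x C hx) q r).2 hg

theorem Incr.move {Γ : Ctx} {M : Term} {A : Ty} {d : Deriv Γ M A} {a : Addr} {τ : Pos → ℚ}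
    (h : Incr τ (d.Corr a)) {p q : Pos} (hm : d.Move a p q) : τ p < τ q :=
  hm.elim (h p q).1 (h q p).2

/-- The context part of an increasing labelling: it starts from labellings in given sets. -/
def CtxLab (Γ : Ctx) (S : ℕ → Set Lab) (σ t : ℕ → Lab) : Prop :=
  ∀ x B, (x, B) ∈ Γ → σ x ∈ S x ∧ Below B (σ x) (t x)

/-- A variable of the conclusion comes from exactly one premise; its label is placed halfway between
the source chosen for it and its label in that premise. -/
theorem Split.ctxLab {Θ Δ Γ : Ctx} (h : Split Θ Δ Γ) {S : ℕ → Set Lab} {σ₀ t₀ σ₁ t₁ : ℕ → Lab}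
    (h₀ : CtxLab Δ S σ₀ t₀) (h₁ : CtxLab Γ S σ₁ t₁) :
    ∃ σ g, CtxLab Θ S σ g ∧ (∀ x B, (x, B) ∈ Δ → Below B (g x) (t₀ x)) ∧
      ∀ x B, (x, B) ∈ Γ → Below B (g x) (t₁ x) := by
  have hΓ : ∀ {x B}, (x, B) ∈ Γ → x ∉ Δ.dom := fun hx hd =>
    Finset.disjoint_left.1 h.1 hd (Ctx.mem_dom hx)
  refine ⟨fun x => if x ∈ Δ.dom then σ₀ x else σ₁ x,
    fun x => if x ∈ Δ.dom then (σ₀ x).mid (t₀ x) else (σ₁ x).mid (t₁ x), ?_, ?_, ?_⟩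
  · intro x B hx
    rcases h.mem.1 hx with hx | hx
    · simpa [Ctx.mem_dom hx] using ⟨(h₀ x B hx).1, (h₀ x B hx).2.mid_right⟩
    · simpa [hΓ hx] using ⟨(h₁ x B hx).1, (h₁ x B hx).2.mid_right⟩
  · intro x B hx
    simpa [Ctx.mem_dom hx] using (h₀ x B hx).2.mid_left
  · intro x B hx
    simpa [hΓ hx] using (h₁ x B hx).2.mid_left

/-- The labellings of the right-hand side of a derivation that extend to increasing labellings
of its positions, starting from given sets of labellings for the variables. -/
def Deriv.behaviour {Γ : Ctx} {M : Term} {A : Ty} (d : Deriv Γ M A) (a : Addr)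
    (S : ℕ → Set Lab) : Set Lab :=
  {ρ | ∃ τ σ, Increasing ⟨d⟩ a τ ∧ CtxLab Γ S σ (fun x => labAt τ a (.ctx x)) ∧
    ρ = labAt τ a .concl}

/-- The labelling of the conclusion of a rule. -/
def rootLab (g : ℕ → Lab) (c : Lab) : Place → Lab
  | .ctx x => g x
  | .concl => c

/-- Covers abstraction and the conditional, whose guard is its only outer premise. Hypothesis `hr`
allows no ports but those of a conditional, and `RootFlow` does not cross these. -/
theorem increasing_of_incr_one {Γ Γ' : Ctx} {M M' : Term} {A A' : Ty} {d : Deriv Γ M A}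
    {d₀ : Deriv Γ' M' A'} {a : Addr} {g : Place → Lab} {τ₀ τ₁ : Pos → ℚ}
    (h : d.prem 0 = some ⟨d₀⟩) (h' : ∀ k, d.prem (k + 1) = none)
    (hr : ∀ p i, d.RootPort a i false p → i = .ite a)
    (h₀ : Increasing ⟨d₀⟩ (0 :: a) τ₀) (hc : Incr (assemble a g τ₀ τ₁) (d.Corr a)) :
    Increasing ⟨d⟩ a (assemble a g τ₀ τ₁) := by
  refine increasing_of_prem ?_ ?_
  · rintro p q (hm | ⟨i, hi, hp, -⟩)
    · exact hc.move hm
    · exact absurd (hr p i hp) (hi a)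
  · rintro (_ | k) e hk
    · obtain rfl := Option.some_injective _ (h.symm.trans hk)
      exact h₀.assemble_zero
    · simp [h'] at hk

theorem increasing_of_incr_two {Γ Γ' Γ'' : Ctx} {M M' M'' : Term} {A A' A'' : Ty}
    {d : Deriv Γ M A} {d₀ : Deriv Γ' M' A'} {d₁ : Deriv Γ'' M'' A''} {a : Addr} {g : Place → Lab}
    {τ₀ τ₁ : Pos → ℚ} (h : d.prem 0 = some ⟨d₀⟩) (h' : d.prem 1 = some ⟨d₁⟩)
    (h'' : ∀ k, d.prem (k + 2) = none) (hr : ∀ i s q, ¬ d.RootPort a i s q)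
    (h₀ : Increasing ⟨d₀⟩ (0 :: a) τ₀) (h₁ : Increasing ⟨d₁⟩ (1 :: a) τ₁)
    (hc : Incr (assemble a g τ₀ τ₁) (d.Corr a)) :
    Increasing ⟨d⟩ a (assemble a g τ₀ τ₁) := by
  refine increasing_of_prem ?_ ?_
  · rintro p q (hm | ⟨i, hi, hp, -⟩)
    · exact hc.move hm
    · exact absurd hp (hr _ _ _)
  · rintro (_ | _ | k) e hk
    · obtain rfl := Option.some_injective _ (h.symm.trans hk)
      exact h₀.assemble_zero
    · obtain rfl := Option.some_injective _ (h'.symm.trans hk)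
      exact h₁.assemble_one
    · simp [h''] at hk

theorem increasing_of_incr_zero {Γ : Ctx} {M : Term} {A : Ty} {d : Deriv Γ M A} {a : Addr}
    {τ : Pos → ℚ} (h : ∀ k, d.prem k = none) (h' : ∀ p q, d.RootFlow a p q → τ p < τ q) :
    Increasing ⟨d⟩ a τ :=
  increasing_of_prem h' fun k e hk => by simp [h] at hk

/-- The context of a conditional's branches: any labels will do. -/
theorem ctxLab_of_nonempty {Γ : Ctx} (hΓ : ∀ {x B C}, (x, B) ∈ Γ → (x, C) ∈ Γ → B = C)
    {S : ℕ → Set Lab} (hS : ∀ x B, (x, B) ∈ Γ → S x ∈ PosT B) : ∃ σ t, CtxLab Γ S σ t := by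
  have : ∀ x, ∃ σ t : Lab, ∀ B, (x, B) ∈ Γ → σ ∈ S x ∧ Below B σ t := by
    intro x
    by_cases hx : x ∈ Γ.dom
    · obtain ⟨B, hB⟩ := Ctx.exists_of_mem_dom hx
      obtain ⟨σ, hσ⟩ := nonempty_of_mem_posT (hS x B hB)
      obtain ⟨t, ht⟩ := exists_above B σ
      refine ⟨σ, t, fun C hC => ?_⟩
      obtain rfl := hΓ hB hC
      exact ⟨hσ, ht⟩
    · exact ⟨fun _ => 0, fun _ => 0, fun B hB => absurd (Ctx.mem_dom hB) hx⟩
  choose σ t h using this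
  exact ⟨σ, t, h⟩

/-! ### Adequacy of the interpretation. -/

theorem tensorList_bound (l : List Base) (s : Lab) :
    ∃ N : ℚ, ∀ p, (tensorList l).sign p = some true → s p < N := by
  obtain ⟨N, hN⟩ := ((tensorList l).finite_paths.image s).bddAbove
  refine ⟨N + 1, fun p hp => ?_⟩
  have := hN ⟨p, by simp [hp], rfl⟩
  linarith

theorem op_behaviour_mem {Γ : Ctx} {c : Op} (hΓ : Γ = ∅) (a : Addr) (S : ℕ → Set Lab) :
    (Deriv.op hΓ rfl : Deriv Γ (.op c) c.ty).behaviour a S ∈ PosT c.ty := by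
  intro R hR T hT
  obtain ⟨s, hs⟩ := nonempty_of_mem_posT hR
  -- The operator receives its inputs at time `N`, later than all labels of the given argument, and
  -- releases its outputs at `N + 1`. The test of the result is confronted with the release time `N
  -- + 2`, which is more than enough.
  obtain ⟨N, hN⟩ := tensorList_bound c.inputs s
  obtain ⟨u, hu, t, ht, hut⟩ := hT _ (const_mem_posT c.outputs (N + 2))
  set ρ : Lab := .join (fun _ => N) (fun _ => N + 1) with hρ
  refine ⟨ρ, ⟨fun q => ρ q.path, fun _ _ => 0, ?_, ?_, rfl⟩, .join s t, ⟨hs, ht⟩, ?_⟩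
  · refine increasing_of_incr_zero (fun _ => rfl) ?_
    rintro ⟨b, pl, p⟩ ⟨b', pl', p'⟩ (hm | ⟨i, -, ⟨-, hp⟩, ⟨-, hq⟩⟩)
    · exact (hm.elim id id).elim
    · subst hΓ
      rcases pl with x | _
      · simp [mem_seqPos_ctx] at hp
      rcases pl' with x | _
      · simp [mem_seqPos_ctx] at hq
      obtain ⟨p, rfl, -⟩ | ⟨p, rfl, h⟩ := Ty.sign_lolli hp.2
      · obtain ⟨p', rfl, h⟩ | ⟨p', rfl, -⟩ := Ty.sign_lolli hq.2
        · exact absurd h (sign_tensorList _ _)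
        · simp [hρ, Lab.join]
      · exact absurd h (sign_tensorList _ _)
  · subst hΓ
    intro x B hx
    simp at hx
  · refine below_lolli.2 ⟨fun p => ⟨hN p, fun h => absurd h (sign_tensorList _ _)⟩,
      fun p => ⟨fun h => ?_, fun h => absurd h (sign_tensorList _ _)⟩⟩
    have h₁ := (hut p).1 h
    have h₂ : u p = N + 2 := hu p h
    simp only [hρ, Lab.join_r]
    linarith

theorem ax_behaviour_mem {Γ : Ctx} {x : ℕ} {A : Ty} (hΓ : Γ = {(x, A)}) (a : Addr)
    {S : ℕ → Set Lab} (hS : S x ∈ PosT A) :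
    (Deriv.ax hΓ : Deriv Γ (.var x) A).behaviour a S ∈ PosT A := by
  refine mem_posT_of_orth fun T hT => ?_
  obtain ⟨σ, hσ, ρ, hρ, h⟩ := hT _ hS
  -- Two successive midpoints between `σ` and `ρ` label the variable and the right-hand side of the
  -- axiom, so that positive atoms of `A` increase strictly through four stages, and negative ones
  -- decrease.
  refine ⟨σ.mid ρ, ⟨fun q => rootLab (fun _ => σ.mid (σ.mid ρ)) (σ.mid ρ) q.place q.path,
    fun _ => σ, ?_, ?_, rfl⟩, ρ, hρ, h.mid_left⟩
  · refine increasing_of_incr_zero (fun _ => rfl) ?_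
    rintro ⟨b, pl, p⟩ ⟨b', pl', p'⟩ (hm | ⟨i, -, ⟨rfl, hp⟩, ⟨hi, hq⟩⟩)
    · exact (hm.elim id id).elim
    · subst hΓ
      obtain ⟨-, rfl⟩ : a = a ∧ p = p' := by simpa using hi
      have hb := h.mid_right.mid_left
      rcases pl with y | _ <;> rcases pl' with z | _
      · simp [mem_seqPos_ctx] at hp hq
        simp [hp] at hq
      · simp [mem_seqPos_ctx] at hp
        exact (hb p).1 hp.2.2
      · simp [mem_seqPos_ctx] at hq
        exact (hb p).2 hq.2.2
      · simp [mem_seqPos_concl] at hp hq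
        simp [hp] at hq
  · subst hΓ
    intro y B hy
    simp only [Finset.mem_singleton, Prod.mk.injEq] at hy
    obtain ⟨rfl, rfl⟩ := hy
    exact ⟨hσ, h.mid_right.mid_right⟩

/-- Adequacy: derivations realize their types. -/
theorem Deriv.behaviour_mem {Γ : Ctx} {M : Term} {A : Ty} (d : Deriv Γ M A) :
    ∀ (a : Addr) (S : ℕ → Set Lab), (∀ x B, (x, B) ∈ Γ → S x ∈ PosT B) →
      d.behaviour a S ∈ PosT A := by
  induction d with
  | ax hΓ =>
    intro a S hS
    exact ax_behaviour_mem hΓ a (hS _ _ (by simp [hΓ]))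
  | op hΓ hA =>
    intro a S hS
    subst hA
    exact op_behaviour_mem hΓ a S
  | star hΓ =>
    intro a S hS
    refine mem_posT_of_orth fun T hT => ?_
    obtain ⟨ρ, hρ⟩ := nonempty_of_mem_negT hT
    obtain ⟨c, hc⟩ := exists_below .one ρ
    refine ⟨c, ⟨fun q => c q.path, fun _ _ => 0, ?_, ?_, rfl⟩, ρ, hρ, hc⟩
    · refine increasing_of_incr_zero (fun _ => rfl) ?_
      rintro p q (hm | ⟨i, -, hp, -⟩)
      · exact (hm.elim id id).elim
      · exact hp.elim
    · subst hΓ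
      intro x B hx
      simp at hx
  | @lam Γ x M A B hx d ih =>
    intro a S hS
    refine mem_posT_of_orth fun T hT => ?_
    -- The set to which `hT` is applied is the behaviour of the body with `x` left free: it forgets
    -- where the labels of `x` start. It realizes `A ⊸ B`, since each argument set `S₁` can be given
    -- to the induction hypothesis as the set of sources for `x`.
    obtain ⟨_, ⟨τ₀, σ₀, hτ, hσ, rfl⟩, ρ, hρ, hb⟩ :=
      hT {ρ | ∃ τ₀ σ₀, Increasing ⟨d⟩ (0 :: a) τ₀ ∧
        CtxLab Γ S σ₀ (fun y => labAt τ₀ (0 :: a) (.ctx y)) ∧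
        ρ = .join (labAt τ₀ (0 :: a) (.ctx x)) (labAt τ₀ (0 :: a) .concl)} (by
      intro S₁ h₁ T₁ hT₁
      obtain ⟨_, ⟨τ₀, σ₀, hτ, hσ, rfl⟩, ρ, hρ, hb⟩ := hT₁ _ (ih (0 :: a) (Function.update S x S₁) (by
        intro y C hy
        rcases Finset.mem_insert.1 hy with hy | hy
        · cases hy
          simpa using h₁
        · have : y ≠ x := fun h => hx (h ▸ Ctx.mem_dom hy)
          simpa [this] using hS y C hy))
      have hx' := hσ x A (Finset.mem_insert_self _ _)
      refine ⟨_, ⟨τ₀, σ₀, hτ, ?_, rfl⟩, .join (σ₀ x) ρ, ⟨by simpa using hx'.1, hρ⟩,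
        below_lolli.2 ⟨hx'.2, hb⟩⟩
      intro y C hy
      have hyx : y ≠ x := fun h => hx (h ▸ Ctx.mem_dom hy)
      simpa [hyx] using hσ y C (Finset.mem_insert_of_mem hy))
    -- The second `τ₀` is a filler, as there is no premise number `1`.
    refine ⟨_, ⟨assemble a (rootLab (fun y => (σ₀ y).mid (labAt τ₀ (0 :: a) (.ctx y)))
      (Lab.mid (.join (labAt τ₀ (0 :: a) (.ctx x)) (labAt τ₀ (0 :: a) .concl)) ρ)) τ₀ τ₀, σ₀,
      ?_, ?_, rfl⟩, ρ, hρ, ?_⟩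
    rotate_left
    · intro y C hy
      simpa [rootLab] using ⟨(hσ y C hy).1, (hσ y C hy).2.mid_right⟩
    · simpa [rootLab] using hb.mid_left
    · have hb' := below_lolli.1 hb.mid_right
      refine increasing_of_incr_one rfl (fun _ => rfl) (fun p i h => h.elim) hτ
        (.or (incr_glueCtx ?_) (.or (incr_glueVar ?_) (incr_glueConcl ?_)))
      · intro y C hy
        simpa [rootLab] using (hσ y C hy).2.mid_left
      · simp only [assemble_root, labAt_assemble_zero,
        rootLab]
        exact hb'.1
      · simp only [assemble_root, assemble_zero, rootLab, List.nil_append]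
        exact hb'.2
  | @app Θ Δ Γ M N A B hΘ d₀ d₁ ih₀ ih₁ =>
    intro a S hS
    refine mem_posT_of_orth fun T hT => ?_
    -- The behaviour of the argument paired with `T` is a test for the function. A single
    -- orthogonality thus yields compatible labellings of both premises and of the environment.
    obtain ⟨_, ⟨τ₀, σ₀, hτ₀, hσ₀, rfl⟩, ρ, ⟨⟨τ₁, σ₁, hτ₁, hσ₁, hρ₁⟩, hρ⟩, hb⟩ :=
      pairSet_mem_negT (ih₁ (1 :: a) S fun x C hx => hS x C (hΘ.mem.2 (.inr hx))) hT _
        (ih₀ (0 :: a) S fun x C hx => hS x C (hΘ.mem.2 (.inl hx)))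
    obtain ⟨σ, g, hg, hg₀, hg₁⟩ := hΘ.ctxLab hσ₀ hσ₁
    rw [below_lolli, hρ₁] at hb
    refine ⟨_, ⟨assemble a (rootLab g ((labAt τ₀ (0 :: a) .concl).r.mid ρ.r)) τ₀ τ₁, σ, ?_,
      by simpa [rootLab] using hg, rfl⟩, ρ.r, hρ, by simpa [rootLab] using hb.2.mid_left⟩
    refine increasing_of_incr_two rfl rfl (fun _ => rfl) (fun i s q h => h.elim) hτ₀ hτ₁
      (.or (incr_glueCtx ?_) (.or (incr_glueCtx ?_) (.or (incr_glueConcl ?_) (incr_glueConcl ?_))))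
    · simpa [rootLab] using hg₀
    · simpa [rootLab] using hg₁
    · simp only [assemble_root, assemble_zero, rootLab, List.nil_append, List.cons_append]
      exact hb.2.mid_right
    · simp only [assemble_zero, assemble_one, List.nil_append]
      exact hb.1
  | @letStar Θ Δ Γ M N A hΘ d₀ d₁ ih₀ ih₁ =>
    intro a S hS
    refine mem_posT_of_orth fun T hT => ?_
    -- The consumed unit is passed on to no position, so nothing relates its label to the second
    -- premise; any labelling of the first premise will do.
    obtain ⟨_, τ₀, σ₀, hτ₀, hσ₀, rfl⟩ := nonempty_of_mem_posT
      (ih₀ (0 :: a) S fun x C hx => hS x C (hΘ.mem.2 (.inl hx)))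
    obtain ⟨_, ⟨τ₁, σ₁, hτ₁, hσ₁, rfl⟩, ρ, hρ, hb⟩ :=
      hT _ (ih₁ (1 :: a) S fun x C hx => hS x C (hΘ.mem.2 (.inr hx)))
    obtain ⟨σ, g, hg, hg₀, hg₁⟩ := hΘ.ctxLab hσ₀ hσ₁
    refine ⟨_, ⟨assemble a (rootLab g ((labAt τ₁ (1 :: a) .concl).mid ρ)) τ₀ τ₁, σ, ?_,
      by simpa [rootLab] using hg, rfl⟩, ρ, hρ, by simpa [rootLab] using hb.mid_left⟩
    refine increasing_of_incr_two rfl rfl (fun _ => rfl) (fun i s q h => h.elim) hτ₀ hτ₁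
      (.or (incr_glueCtx ?_) (.or (incr_glueCtx ?_) (incr_glueConcl ?_)))
    · simpa [rootLab] using hg₀
    · simpa [rootLab] using hg₁
    · simp only [assemble_root, assemble_one, rootLab, List.nil_append]
      exact hb.mid_right
  | @pair Θ Δ Γ M N A B hΘ d₀ d₁ ih₀ ih₁ =>
    intro a S hS
    refine mem_posT_of_orth fun T hT => ?_
    obtain ⟨ρ', ⟨⟨τ₀, σ₀, hτ₀, hσ₀, h₀⟩, ⟨τ₁, σ₁, hτ₁, hσ₁, h₁⟩⟩, ρ, hρ, hb⟩ :=
      hT _ (pairSet_mem_posT (ih₀ (0 :: a) S fun x C hx => hS x C (hΘ.mem.2 (.inl hx)))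
        (ih₁ (1 :: a) S fun x C hx => hS x C (hΘ.mem.2 (.inr hx))))
    obtain ⟨σ, g, hg, hg₀, hg₁⟩ := hΘ.ctxLab hσ₀ hσ₁
    refine ⟨_, ⟨assemble a (rootLab g (Lab.mid ρ' ρ)) τ₀ τ₁, σ, ?_, by simpa [rootLab] using hg,
      rfl⟩, ρ, hρ, by simpa [rootLab] using hb.mid_left⟩
    have hb' := below_tensor.1 hb.mid_right
    rw [h₀, h₁] at hb'
    refine increasing_of_incr_two rfl rfl (fun _ => rfl) (fun i s q h => h.elim) hτ₀ hτ₁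
      (.or (incr_glueCtx ?_) (.or (incr_glueCtx ?_) (.or (incr_glueConcl ?_) (incr_glueConcl ?_))))
    · simpa [rootLab] using hg₀
    · simpa [rootLab] using hg₁
    · simp only [assemble_root, assemble_zero, rootLab, List.nil_append]
      exact hb'.1
    · simp only [assemble_root, assemble_one, rootLab, List.nil_append]
      exact hb'.2
  | @letPair Θ Δ Γ x y M N A B C hΘ hxy hx hy d₀ d₁ ih₀ ih₁ =>
    intro a S hS
    refine mem_posT_of_orth fun T hT => ?_
    -- The body of the `let`, already connected to `T`, becomes a test for pairs.
    have hT' : {ρ' | ∃ τ₁ σ₁ ρ, Increasing ⟨d₁⟩ (1 :: a) τ₁ ∧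
        CtxLab Γ S σ₁ (fun y => labAt τ₁ (1 :: a) (.ctx y)) ∧ ρ ∈ T ∧
        Below C (labAt τ₁ (1 :: a) .concl) ρ ∧
        ρ' = .join (labAt τ₁ (1 :: a) (.ctx x)) (labAt τ₁ (1 :: a) (.ctx y))} ∈
        NegT (.tensor A B) := by
      refine mem_negT_tensor fun S₁ h₁ S₂ h₂ => ?_
      have hne : ∀ z D, (z, D) ∈ Γ → z ≠ x ∧ z ≠ y := fun z D hz =>
        ⟨fun h => hx (h ▸ Ctx.mem_dom hz), fun h => hy (h ▸ Ctx.mem_dom hz)⟩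
      obtain ⟨_, ⟨τ₁, σ₁, hτ, hσ, rfl⟩, ρ, hρ, hb⟩ :=
        hT _ (ih₁ (1 :: a) (Function.update (Function.update S x S₁) y S₂) (by
          intro z D hz
          rcases Finset.mem_insert.1 hz with hz | hz
          · cases hz
            simpa [hxy] using h₁
          rcases Finset.mem_insert.1 hz with hz | hz
          · cases hz
            simpa using h₂
          · simpa [hne z D hz] using hS z D (hΘ.mem.2 (.inr hz))))
      have hx' := hσ x A (Finset.mem_insert_self _ _)
      have hy' := hσ y B (Finset.mem_insert_of_mem (Finset.mem_insert_self _ _))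
      refine ⟨.join (σ₁ x) (σ₁ y), ⟨by simpa [hxy] using hx'.1, by simpa using hy'.1⟩, _,
        ⟨τ₁, σ₁, ρ, hτ, ?_, hρ, hb, rfl⟩, below_tensor.2 ⟨hx'.2, hy'.2⟩⟩
      intro z D hz
      simpa [hne z D hz] using
        hσ z D (Finset.mem_insert_of_mem (Finset.mem_insert_of_mem hz))
    obtain ⟨_, ⟨τ₀, σ₀, hτ₀, hσ₀, rfl⟩, _, ⟨τ₁, σ₁, ρ, hτ₁, hσ₁, hρ, hb, rfl⟩, hb'⟩ :=
      hT' _ (ih₀ (0 :: a) S fun x C hx => hS x C (hΘ.mem.2 (.inl hx)))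
    obtain ⟨σ, g, hg, hg₀, hg₁⟩ := hΘ.ctxLab hσ₀ hσ₁
    rw [below_tensor] at hb'
    refine ⟨_, ⟨assemble a (rootLab g ((labAt τ₁ (1 :: a) .concl).mid ρ)) τ₀ τ₁, σ, ?_,
      by simpa [rootLab] using hg, rfl⟩, ρ, hρ, by simpa [rootLab] using hb.mid_left⟩
    refine increasing_of_incr_two rfl rfl (fun _ => rfl) (fun i s q h => h.elim) hτ₀ hτ₁
      (.or (incr_glueCtx ?_) (.or (incr_glueCtx ?_) (.or (incr_glueConcl ?_)
        (.or (incr_glueVar ?_) (incr_glueVar ?_)))))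
    · simpa [rootLab] using hg₀
    · simpa [rootLab] using hg₁
    · simp only [assemble_root, assemble_one, rootLab, List.nil_append]
      exact hb.mid_right
    · simp only [assemble_zero, labAt_assemble_one]
      exact hb'.1
    · simp only [assemble_zero, labAt_assemble_one]
      exact hb'.2
  | @ite Θ Δ Γ M N P A hΘ d₀ d₁ d₂ ih₀ _ _ =>
    intro a S hS
    refine mem_posT_of_orth fun T hT => ?_
    obtain ⟨_, τ₀, σ₀, hτ₀, hσ₀, rfl⟩ := nonempty_of_mem_posT
      (ih₀ (0 :: a) S fun x C hx => hS x C (hΘ.mem.2 (.inl hx)))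
    obtain ⟨σ₁, t₁, h₁⟩ := ctxLab_of_nonempty d₁.ctx_functional
      fun x C hx => hS x C (hΘ.mem.2 (.inr hx))
    obtain ⟨σ, g, hg, hg₀, -⟩ := hΘ.ctxLab hσ₀ h₁
    -- Crossing the conditional is not part of `RootFlow`, so no inequality relates the guard, the
    -- context of the branches and the right-hand side: it suffices that the latter lies below some
    -- labelling in `T`.
    obtain ⟨ρ, hρ⟩ := nonempty_of_mem_negT hT
    obtain ⟨c, hc⟩ := exists_below A ρ
    refine ⟨c, ⟨assemble a (rootLab g c) τ₀ τ₀, σ, ?_, by simpa [rootLab] using hg,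
      by simp [rootLab]⟩, ρ, hρ, hc⟩
    refine increasing_of_incr_one rfl (fun _ => rfl) (fun p i h => h.1) hτ₀ (incr_glueCtx ?_)
    simpa [rootLab] using hg₀

/-- The positions of a derivation have an increasing labelling. -/
theorem Judgement.exists_increasing (r : Judgement) (a : Addr) : ∃ τ, Increasing r a τ := by
  obtain ⟨_, τ, _, h, _⟩ := nonempty_of_mem_posT
    (r.deriv.behaviour_mem a (fun _ => Set.univ) fun _ B _ => (univ_mem B).1)
  exact ⟨τ, h⟩

/-! ## Conflict-free nets -/

/-- A finite net in which every place has at most one producer and at most one consumer. -/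
structure Net (α ε : Type) where
  events : Set ε
  pre : ε → Set α
  post : ε → Set α
  start : Set α
  finite_events : events.Finite
  pre_nonempty : ∀ t ∈ events, (pre t).Nonempty
  pre_unique : ∀ t ∈ events, ∀ u ∈ events, ∀ x, x ∈ pre t → x ∈ pre u → t = u
  post_unique : ∀ t ∈ events, ∀ u ∈ events, ∀ x, x ∈ post t → x ∈ post u → t = u
  not_post_of_start : ∀ t ∈ events, ∀ x ∈ start, x ∉ post t

namespace Net

variable {α ε κ : Type} (N : Net α ε)

/-- A token at `x` is consumed by an event that produces a token at `y`. -/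
def Flow (x y : α) : Prop := ∃ t ∈ N.events, x ∈ N.pre t ∧ y ∈ N.post t

/-- The places that have been marked when the events in `S` have occurred. -/
def Marked (S : Set ε) (x : α) : Prop := x ∈ N.start ∨ ∃ t ∈ S, x ∈ N.post t

/-- The marking `X` results from the occurrence of the events in `S`. -/
structure Inv (X : Set α) (S : Set ε) : Prop where
  subset : S ⊆ N.events
  mem_iff : ∀ x, x ∈ X ↔ N.Marked S x ∧ ∀ t ∈ S, x ∉ N.pre t
  marked : ∀ t ∈ S, ∀ x ∈ N.pre t, N.Marked S x
  acc : ∀ x, N.Marked S x → Acc N.Flow x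

theorem inv_start : N.Inv N.start ∅ where
  subset := Set.empty_subset _
  mem_iff x := by simp [Marked]
  marked := by simp
  acc x hx := by
    rcases hx with hx | ⟨t, ht, -⟩
    -- Initially marked places have no producer, hence no predecessor for the flow.
    · exact ⟨_, fun y ⟨t, ht, _, h⟩ => absurd h (N.not_post_of_start t ht x hx)⟩
    · exact ht.elim

variable {N}

theorem Marked.mono {S S' : Set ε} (h : S ⊆ S') {x : α} (hx : N.Marked S x) : N.Marked S' x :=
  hx.imp id fun ⟨t, ht, h'⟩ => ⟨t, h ht, h'⟩

/-- No event occurs twice: it has emptied its input places, of which there is at least one, and they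
are not refilled. -/
theorem Inv.not_mem {X : Set α} {S : Set ε} (h : N.Inv X S) {t : ε} (ht : t ∈ N.events)
    (hX : N.pre t ⊆ X) : t ∉ S := fun hS => by
  obtain ⟨x, hx⟩ := N.pre_nonempty t ht
  exact ((h.mem_iff x).1 (hX hx)).2 t hS hx

/-- As producers are unique and `t` is new, the places it fills were never marked before. Hence
"marked and not yet consumed" still describes the tokens present. -/
theorem Inv.step {X : Set α} {S : Set ε} (h : N.Inv X S) {t : ε} (ht : t ∈ N.events)
    (hX : N.pre t ⊆ X) : N.Inv ((X \ N.pre t) ∪ N.post t) (insert t S) := by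
  have hS := h.not_mem ht hX
  have hpre : ∀ x ∈ N.pre t, N.Marked S x := fun x hx => ((h.mem_iff x).1 (hX hx)).1
  have hpost : ∀ x ∈ N.post t, ¬ N.Marked S x := by
    rintro x hx (hs | ⟨u, hu, hx'⟩)
    · exact N.not_post_of_start t ht x hs hx
    · obtain rfl := N.post_unique t ht u (h.subset hu) x hx hx'
      exact hS hu
  have hmono : ∀ {x}, N.Marked S x → N.Marked (insert t S) x := Marked.mono (Set.subset_insert _ _)
  refine ⟨Set.insert_subset ht h.subset, fun x => ⟨?_, ?_⟩, ?_, ?_⟩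
  · rintro (⟨hx, hxt⟩ | hx)
    · obtain ⟨hm, hc⟩ := (h.mem_iff x).1 hx
      refine ⟨hmono hm, ?_⟩
      rintro u (rfl | hu)
      · exact hxt
      · exact hc u hu
    · refine ⟨.inr ⟨t, Set.mem_insert _ _, hx⟩, ?_⟩
      rintro u (rfl | hu) hxu
      · exact hpost x hx (hpre x hxu)
      · exact hpost x hx (h.marked u hu x hxu)
  · rintro ⟨hs | ⟨u, rfl | hu, hx⟩, hc⟩
    · exact .inl ⟨(h.mem_iff x).2 ⟨.inl hs, fun u hu => hc u (.inr hu)⟩, hc t (.inl rfl)⟩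
    · exact .inr hx
    · exact .inl ⟨(h.mem_iff x).2 ⟨.inr ⟨u, hu, hx⟩, fun u hu => hc u (.inr hu)⟩, hc t (.inl rfl)⟩
  · rintro u (rfl | hu) x hx
    · exact hmono (hpre x hx)
    · exact hmono (h.marked u hu x hx)
  · rintro x (hs | ⟨u, rfl | hu, hx⟩)
    · exact h.acc x (.inl hs)
    -- The only producer of `x` is the event that has just occurred, so every predecessor of `x` is
    -- one of its inputs, marked earlier and therefore accessible.
    · refine ⟨_, fun y ⟨v, hv, hy, hx'⟩ => ?_⟩
      obtain rfl := N.post_unique u ht v hv x hx hx'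
      exact h.acc y (hpre y hy)
    · exact h.acc x (.inr ⟨u, hu, hx⟩)

/-- If the flow is well-founded, then all events have occurred in a marking where none is
enabled. -/
theorem Inv.eq_events {X : Set α} {S : Set ε} (h : N.Inv X S) (hwf : WellFounded N.Flow)
    (hpre : ∀ t ∈ N.events, ∀ x ∈ N.pre t, N.Marked N.events x)
    (hstuck : ∀ t ∈ N.events, ¬ N.pre t ⊆ X) : S = N.events := by
  -- Absence of conflict: a token that has reached an input of `t` can be removed by `t` only. If
  -- all inputs have been marked and `t` has not occurred, then `t` is enabled.
  have hmem : ∀ t ∈ N.events, (∀ y ∈ N.pre t, N.Marked S y) → t ∈ S := by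
    intro t ht hy
    by_contra htS
    refine hstuck t ht fun y hyt => (h.mem_iff y).2 ⟨hy y hyt, fun u hu hyu => htS ?_⟩
    obtain rfl := N.pre_unique t ht u (h.subset hu) y hyt hyu
    exact hu
  have key : ∀ x, N.Marked N.events x → N.Marked S x := by
    intro x
    induction x using hwf.induction with
    | _ x ih =>
      rintro (hs | ⟨t, ht, hx⟩)
      · exact .inl hs
      · exact .inr ⟨t, hmem t ht fun y hy => ih y ⟨t, ht, hy, hx⟩ (hpre t ht y hy), hx⟩
  exact h.subset.antisymm fun t ht => hmem t ht fun y hy => key y (hpre t ht y hy)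

variable (N)

/-- A transition system that plays the token game of a net. -/
structure Game (tok : κ → Set α) (step : κ → κ → Prop) : Prop where
  sound : ∀ C C', step C C' →
    ∃ t ∈ N.events, N.pre t ⊆ tok C ∧ tok C' = (tok C \ N.pre t) ∪ N.post t
  complete : ∀ C, ∀ t ∈ N.events, N.pre t ⊆ tok C → ∃ C', step C C'

variable {N} {tok : κ → Set α} {step : κ → κ → Prop}

theorem Game.inv (G : N.Game tok step) {C C' : κ} (hC : tok C = N.start)
    (h : Relation.ReflTransGen step C C') : ∃ S, N.Inv (tok C') S := by
  induction h with
  | refl => exact ⟨∅, hC ▸ N.inv_start⟩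
  | tail _ hs ih =>
    obtain ⟨S, hS⟩ := ih
    obtain ⟨t, ht, hp, he⟩ := G.sound _ _ hs
    exact ⟨_, he ▸ hS.step ht hp⟩

/-- Each step uses up one of the finitely many events that have not occurred yet. -/
theorem Game.acc_of_inv (G : N.Game tok step) {C : κ} {S : Set ε} (h : N.Inv (tok C) S) :
    Acc (fun C' C => step C C') C := by
  induction hk : (N.events \ S).ncard using Nat.strong_induction_on generalizing C S with
  | _ k ih =>
    refine ⟨_, fun C' hs => ?_⟩
    obtain ⟨t, ht, hp, he⟩ := G.sound _ _ hs
    refine ih _ ?_ (he ▸ h.step ht hp) rfl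
    rw [← hk]
    refine Set.ncard_lt_ncard ⟨fun u hu => ⟨hu.1, fun hS => hu.2 (.inr hS)⟩, fun hsub => ?_⟩
      (N.finite_events.subset Set.sdiff_subset)
    exact (hsub ⟨ht, h.not_mem ht hp⟩).2 (.inl rfl)

theorem Game.acc (G : N.Game tok step) {C C' : κ} (hC : tok C = N.start)
    (h : Relation.ReflTransGen step C C') : Acc (fun C' C => step C C') C' :=
  let ⟨_, hS⟩ := G.inv hC h
  G.acc_of_inv hS

end Net

theorem not_infinite_run {κ : Type} {step : κ → κ → Prop} {C : κ}
    (h : Acc (fun C' C => step C C') C) :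
    ¬ ∃ run : ℕ → κ, run 0 = C ∧ ∀ n, step (run n) (run (n + 1)) := by
  induction h with
  | intro C _ ih =>
    rintro ⟨run, rfl, hr⟩
    exact ih _ (hr 0) ⟨fun n => run (n + 1), rfl, fun n => hr (n + 1)⟩

theorem exists_stuck {κ : Type} {step : κ → κ → Prop} {C : κ}
    (h : Acc (fun C' C => step C C') C) :
    ∃ C', Relation.ReflTransGen step C C' ∧ ∀ C'', ¬ step C' C'' := by
  induction h with
  | intro C _ ih =>
    by_cases hC : ∃ C', step C C'
    · obtain ⟨C', hs⟩ := hC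
      obtain ⟨C'', h, h'⟩ := ih C' hs
      exact ⟨C'', .head hs h, h'⟩
    · exact ⟨C, .refl, not_exists.1 hC⟩

/-! ## The net of the outer part of a derivation -/

/-- Events: a structural move, or the crossing of a synchronization point. -/
inductive Event
  | link (p q : Pos)
  | sync (i : SyncPt)

/-- The event `t` of the last rule consumes (`s = false`) or produces (`s = true`) a token
at `q`. -/
def Deriv.Touch {Γ : Ctx} {M : Term} {A : Ty} (d : Deriv Γ M A) (b : Addr) (s : Bool) :
    Event → Pos → Prop
  | .link p r, q => d.Mv b false p r ∧ q = bif s then r else p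
  | .sync i, q => d.RootPort b i s q

/-- The machine can reach a final configuration. -/
def Deriv.Exec {Γ : Ctx} {M : Term} {A : Ty} (d : Deriv Γ M A) (a : Addr) : Prop :=
  ∃ C, Relation.ReflTransGen (stepOf (d.Fires a)) (d.init a) C ∧ d.Final a C

/-- If the last rule is a conditional, then both of its branches can be executed. -/
def Deriv.CanFire : ∀ {Γ : Ctx} {M : Term} {A : Ty}, Deriv Γ M A → Addr → Prop
  | _, _, _, .ite _ _ d₁ d₂, b => d₁.Exec (1 :: b) ∧ d₂.Exec (2 :: b)
  | _, _, _, _, _ => True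

/-- The address of a synchronization point. -/
def SyncPt.addr : SyncPt → Addr
  | .ite a => a
  | .op a => a
  | .ax a _ => a

/-! ### Events of a single rule, and their agreement with the transitions of the machine. -/

section Local

variable {Γ : Ctx} {M : Term} {A : Ty} (d : Deriv Γ M A) {b : Addr} {s : Bool}

theorem Deriv.rootPort_addr {i : SyncPt} {q : Pos} (h : d.RootPort b i s q) : i.addr = b := by
  cases d with
  | ax => rw [h.1]; rfl
  | op => rw [h.1]; rfl
  | ite => rw [h.1]; rfl
  | _ => exact h.elim

theorem Deriv.touch_mem {t : Event} {q : Pos} (h : d.Touch b s t q) : q ∈ d.bd b s := by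
  cases t with
  | link p r =>
    obtain ⟨h, rfl⟩ := h
    cases s with
    | false => exact d.mv_mem h
    | true => exact d.mv_mem ((d.mv_not b false p r).2 h)
  | sync i => exact d.rootPort_mem h

theorem Deriv.touch_unique {t u : Event} {q : Pos} (h : d.Touch b s t q) (h' : d.Touch b s u q) :
    t = u := by
  have mv : ∀ {p r}, d.Touch b s (.link p r) q → ∃ q', d.Mv b s q q' := by
    rintro p r ⟨h₁, rfl⟩
    cases s with
    | false => exact ⟨r, h₁⟩
    | true => exact ⟨p, (d.mv_not b false p r).2 h₁⟩
  rcases t with ⟨p, r⟩ | i <;> rcases u with ⟨p', r'⟩ | j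
  · obtain ⟨h, rfl⟩ := h
    obtain ⟨h', he⟩ := h'
    cases s with
    | false =>
      obtain rfl : p = p' := he
      rw [d.mv_unique h h']
    | true =>
      obtain rfl : r = r' := he
      rw [d.mv_unique ((d.mv_not b false p r).2 h) ((d.mv_not b false p' r).2 h')]
  · obtain ⟨q', hq⟩ := mv h
    exact (d.not_mv_of_rootPort h' hq).elim
  · obtain ⟨q', hq⟩ := mv h'
    exact (d.not_mv_of_rootPort h hq).elim
  · rw [d.rootPort_unique h h']

theorem Deriv.not_touch_of_unitPos {t : Event} {q : Pos} (h : d.UnitPos b s q) :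
    ¬ d.Touch b s t q := by
  intro h'
  rcases t with ⟨p, r⟩ | i
  · obtain ⟨h', rfl⟩ := h'
    cases s with
    | false => exact d.not_mv_of_unitPos h h'
    | true => exact d.not_mv_of_unitPos h ((d.mv_not b false p r).2 h')
  · exact d.not_rootPort_of_unitPos h h'

theorem Deriv.touch_or_unitPos {q : Pos} (h : q ∈ d.bd b s) :
    (∃ t, d.Touch b s t q) ∨ d.UnitPos b s q := by
  rcases d.bd_cases h with ⟨r, h⟩ | ⟨i, h⟩ | h
  · left
    cases s with
    | false => exact ⟨.link q r, h, rfl⟩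
    | true => exact ⟨.link r q, (d.mv_not b false r q).1 h, rfl⟩
  · exact .inl ⟨.sync i, h⟩
  · exact .inr h

theorem Deriv.unitPos_mem {q : Pos} (h : d.UnitPos b s q) : q ∈ d.bd b s := by
  cases d with
  | star =>
    cases s with
    | false => exact h.elim
    | true =>
      obtain rfl : q = ⟨b, .concl, []⟩ := h
      exact .inl ⟨rfl, rfl⟩
  | letStar hΘ d₀ d₁ =>
    cases s with
    | true => exact h.elim
    | false =>
      obtain rfl : q = ⟨0 :: b, .concl, []⟩ := h
      exact .inr ⟨0, _, rfl, rfl, rfl⟩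
  | _ => cases s <;> exact h.elim

/-- The empty product is the atom `1`, so even an operator without inputs waits for a token. This
gives events nonempty sets of inputs. -/
theorem exists_sign_tensorList (l : List Base) : ∃ p, (tensorList l).sign p = some true := by
  induction l with
  | nil => exact ⟨[], rfl⟩
  | cons b l ih =>
    cases l with
    | nil => exact ⟨[], rfl⟩
    | cons c l => exact ⟨[.left], rfl⟩

/-- Every synchronization point waits for some token. -/
theorem Deriv.exists_rootPort_false {i : SyncPt} {q : Pos} (h : d.RootPort b i s q) :
    ∃ q', d.RootPort b i false q' := by
  cases s with
  | false => exact ⟨q, h⟩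
  | true =>
    cases d with
    | @ax _ x _ hΓ =>
      subst hΓ
      obtain ⟨hi, hq⟩ := h
      obtain ⟨c, pl, p⟩ := q
      rcases pl with y | _
      · simp [mem_seqPos_ctx] at hq
        exact ⟨⟨b, .concl, p⟩, hi, rfl, hq.2.2⟩
      · simp [mem_seqPos_concl] at hq
        exact ⟨⟨b, .ctx x, p⟩, hi, rfl, A, by simp, hq.2⟩
    | @op _ c _ _ hA =>
      subst hA
      obtain ⟨p, hp⟩ := exists_sign_tensorList c.inputs
      exact ⟨⟨b, .concl, .left :: p⟩, h.1, rfl, by simp [Op.ty, Ty.sign, hp]⟩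
    | ite => exact ⟨guardPos b, h.1, .inr ⟨rfl, rfl⟩⟩
    | _ => exact h.elim

theorem Deriv.exists_touch_false {t : Event} {q : Pos} (h : d.Touch b s t q) :
    ∃ q', d.Touch b false t q' := by
  cases t with
  | link p r => exact ⟨p, h.1, rfl⟩
  | sync i => exact d.exists_rootPort_false h

/-- The tokens consumed by an event of the last rule. -/
def Deriv.preAt (b : Addr) (t : Event) : Set Token := {x | x.flag = false ∧ d.Touch b false t x.pos}

/-- The tokens produced by an event of the last rule. -/
def Deriv.postAt (b : Addr) (t : Event) : Set Token :=
  {x | (x.flag = false ∧ d.Touch b true t x.pos) ∨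
    (x.flag = true ∧ t = .sync (.ite b) ∧ x.pos = guardPos b)}

/-- The transitions that belong to the last rule. -/
def Deriv.RootFires : ∀ {Γ : Ctx} {M : Term} {A : Ty},
    Deriv Γ M A → Addr → Set Token → Set Token → Circ → Prop
  | Γ, _, A, .ax _, a, I, O, E =>
      ∃ p q, p ∈ seqPos Γ A a false ∧ q ∈ seqPos Γ A a true ∧ p.path = q.path ∧
        I = off {p} ∧ O = off {q} ∧ E = .rename p q
  | Γ, _, A, .ite (Γ := Γ') h d₀ d₁ d₂, a, I, O, E =>
      (Deriv.ite h d₀ d₁ d₂).Structural a I O E ∨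
        ∃ C₁ C₂ : Config,
          Relation.ReflTransGen (stepOf (d₁.Fires (1 :: a))) (d₁.init (1 :: a)) C₁ ∧
          d₁.Final (1 :: a) C₁ ∧
          Relation.ReflTransGen (stepOf (d₂.Fires (2 :: a))) (d₂.init (2 :: a)) C₂ ∧
          d₂.Final (2 :: a) C₂ ∧
          I = off {guardPos a} ∪ off (seqPos Γ' A a false) ∧
          O = on {guardPos a} ∪ off (seqPos Γ' A a true) ∧
          E = .ite (guardPos a)
            (.seq (.transfer a (1 :: a)) (.seq C₁.circ (.transfer (1 :: a) a)))
            (.seq (.transfer a (2 :: a)) (.seq C₂.circ (.transfer (2 :: a) a)))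
  | Γ, _, A, .op (c := c) _ _, a, I, O, E =>
      I = off (seqPos Γ A a false) ∧ O = off (seqPos Γ A a true) ∧
        E = .op c (opWires a .left c.inputs.length) (opWires a .right c.outputs.length)
  | _, _, _, d, a, I, O, E => d.Structural a I O E

theorem Deriv.fires_iff (a : Addr) (I O : Set Token) (E : Circ) :
    d.Fires a I O E ↔ d.Any false (fun e b => e.RootFires b I O E) a := by
  induction d generalizing a with
  | ax => exact Iff.rfl
  | op => exact Iff.rfl
  | star => exact ⟨False.elim, fun ⟨_, _, h, _⟩ => h.elim id id⟩
  | lam h d ih => exact or_congr Iff.rfl (ih _)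
  | app h d₀ d₁ ih₀ ih₁ => exact or_congr Iff.rfl (or_congr (ih₀ _) (ih₁ _))
  | letStar h d₀ d₁ ih₀ ih₁ => exact or_congr Iff.rfl (or_congr (ih₀ _) (ih₁ _))
  | pair h d₀ d₁ ih₀ ih₁ => exact or_congr Iff.rfl (or_congr (ih₀ _) (ih₁ _))
  | letPair _ _ _ _ d₀ d₁ ih₀ ih₁ => exact or_congr Iff.rfl (or_congr (ih₀ _) (ih₁ _))
  | ite h d₀ d₁ d₂ ih₀ _ _ =>
    constructor
    · rintro (h | h | h)
      · exact .inl (.inl h)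
      · exact .inr (.inl ((ih₀ _).1 h))
      · exact .inl (.inr h)
    · rintro ((h | h) | h | ⟨h, -⟩)
      · exact .inl h
      · exact .inr (.inr h)
      · exact .inr (.inl ((ih₀ _).2 h))
      · cases h

theorem Deriv.preAt_link {p r : Pos} (h : d.Mv b false p r) : d.preAt b (.link p r) = off {p} := by
  ext x; simp [off, Deriv.preAt, Deriv.Touch, h, and_comm]

theorem Deriv.postAt_link {p r : Pos} (h : d.Mv b false p r) :
    d.postAt b (.link p r) = off {r} := by
  ext x; simp [off, Deriv.postAt, Deriv.Touch, h, and_comm]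

/-- The transitions of the last rule are its events. -/
theorem Deriv.RootFires.exists_event {I O : Set Token} {E : Circ} (h : d.RootFires b I O E) :
    ∃ t, (∃ q, d.Touch b false t q) ∧ ((∃ i, t = .sync i) → d.CanFire b) ∧
      I = d.preAt b t ∧ O = d.postAt b t := by
  have structural : d.Structural b I O E →
      ∃ t, (∃ q, d.Touch b false t q) ∧ ((∃ i, t = .sync i) → d.CanFire b) ∧
        I = d.preAt b t ∧ O = d.postAt b t := by
    rintro ⟨p, q, hm, rfl, rfl, -⟩
    refine ⟨.link p q, ⟨p, hm, rfl⟩, by simp, ?_, ?_⟩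
    · rw [d.preAt_link hm]
    · rw [d.postAt_link hm]
  cases d with
  | ite hΘ d₀ d₁ d₂ =>
    rcases h with h | ⟨C₁, C₂, h₁, hf₁, h₂, hf₂, rfl, rfl, -⟩
    · exact structural h
    · refine ⟨.sync (.ite b), ⟨guardPos b, rfl, .inr ⟨rfl, rfl⟩⟩,
        fun _ => ⟨⟨C₁, h₁, hf₁⟩, C₂, h₂, hf₂⟩, ?_, ?_⟩
      · ext x
        simp [off, Deriv.preAt, Deriv.Touch, Deriv.RootPort]
        tauto
      · ext x
        simp [off, on, Deriv.postAt, Deriv.Touch, Deriv.RootPort]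
        tauto
  | op hΓ hA =>
    obtain ⟨rfl, rfl, -⟩ := h
    subst hA
    obtain ⟨p, hp⟩ := exists_sign_tensorList (Op.inputs ‹Op›)
    refine ⟨.sync (.op b), ⟨⟨b, .concl, .left :: p⟩, rfl, rfl, by simp [Op.ty, Ty.sign, hp]⟩,
      fun _ => trivial, ?_, ?_⟩
    · ext x
      simp [off, Deriv.preAt, Deriv.Touch, Deriv.RootPort, and_comm]
    · ext x
      simp [off, Deriv.postAt, Deriv.Touch, Deriv.RootPort, and_comm]
  | @ax _ y _ hΓ =>
    have huniq : ∀ {s : Bool} {p q : Pos}, p ∈ seqPos Γ A b s → q ∈ seqPos Γ A b s →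
        p.path = q.path → p = q := by
      subst hΓ
      rintro s ⟨c, _ | _, p⟩ ⟨c', _ | _, p'⟩ hp hq (rfl : p = p') <;>
        simp [mem_seqPos_ctx, mem_seqPos_concl] at hp hq ⊢ <;> simp_all
    obtain ⟨p, q, hp, hq, hpq, rfl, rfl, -⟩ := h
    refine ⟨.sync (.ax b p.path), ⟨p, rfl, hp⟩, fun _ => trivial, ?_, ?_⟩
    · ext x
      simp only [off, Deriv.preAt, Deriv.Touch, Deriv.RootPort, Set.mem_ofPred_eq,
        Set.mem_singleton_iff, SyncPt.ax.injEq, true_and]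
      constructor
      · rintro ⟨hx, hf⟩
        exact ⟨hf, by rw [hx], by rwa [hx]⟩
      · rintro ⟨hf, hx, hx'⟩
        exact ⟨(huniq hp hx' hx).symm, hf⟩
    · ext x
      simp only [off, Deriv.postAt, Deriv.Touch, Deriv.RootPort, Set.mem_ofPred_eq,
        Set.mem_singleton_iff, SyncPt.ax.injEq, true_and, Event.sync.injEq, reduceCtorEq,
        false_and, and_false, or_false]
      constructor
      · rintro ⟨hx, hf⟩
        exact ⟨hf, by rw [hx, hpq], by rwa [hx]⟩
      · rintro ⟨hf, hx, hx'⟩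
        exact ⟨(huniq hq hx' (hpq.symm.trans hx)).symm, hf⟩
  | _ => exact structural h

theorem Deriv.exists_rootFires {t : Event} {q : Pos} (h : d.Touch b false t q)
    (hc : (∃ i, t = .sync i) → d.CanFire b) :
    ∃ E, d.RootFires b (d.preAt b t) (d.postAt b t) E := by
  cases t with
  | link p r =>
    rw [d.preAt_link h.1, d.postAt_link h.1]
    have hs : d.Structural b (off {p}) (off {r}) (.rename p r) := ⟨p, r, h.1, rfl, rfl, rfl⟩
    cases d with
    | ax => exact (h.1.elim id id).elim
    | op => exact (h.1.elim id id).elim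
    | ite => exact ⟨_, .inl hs⟩
    | _ => exact ⟨_, hs⟩
  | sync i =>
    have hc := hc ⟨i, rfl⟩
    -- A transition is determined by any position at which it consumes a token. It is therefore
    -- enough to exhibit one that consumes a token at a port of `i`.
    have key : ∀ {I O E}, d.RootFires b I O E → (∃ q', ⟨q', false⟩ ∈ I ∧ d.RootPort b i false q') →
        ∃ E, d.RootFires b (d.preAt b (.sync i)) (d.postAt b (.sync i)) E := by
      rintro I O E hE ⟨q', hq, hp⟩
      obtain ⟨t, -, -, hI, hO⟩ := Deriv.RootFires.exists_event d hE
      rw [hI] at hq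
      obtain rfl : t = .sync i := d.touch_unique hq.2 hp
      exact ⟨E, hI ▸ hO ▸ hE⟩
    cases d with
    | @ax _ y _ hΓ =>
      subst hΓ
      obtain ⟨rfl, hq⟩ := h
      obtain ⟨c, pl, p⟩ := q
      have : ∃ q', q' ∈ seqPos {(y, A)} A b true ∧ p = q'.path := by
        rcases pl with x | _
        · simp [mem_seqPos_ctx] at hq
          exact ⟨⟨b, .concl, p⟩, ⟨rfl, hq.2.2⟩, rfl⟩
        · simp [mem_seqPos_concl] at hq
          exact ⟨⟨b, .ctx y, p⟩, ⟨rfl, A, by simp, by simpa using hq.2⟩, rfl⟩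
      obtain ⟨q', hq', he⟩ := this
      exact key ⟨_, q', hq, hq', he, rfl, rfl, rfl⟩ ⟨_, ⟨rfl, rfl⟩, rfl, hq⟩
    | op => exact key ⟨rfl, rfl, rfl⟩ ⟨q, ⟨h.2, rfl⟩, h⟩
    | ite =>
      obtain ⟨⟨C₁, h₁, hf₁⟩, C₂, h₂, hf₂⟩ := hc
      exact key (.inr ⟨C₁, C₂, h₁, hf₁, h₂, hf₂, rfl, rfl, rfl⟩)
        ⟨guardPos b, .inl ⟨rfl, rfl⟩, h.1, .inr ⟨rfl, rfl⟩⟩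
    | _ => exact h.elim

end Local

section Global

variable {r : Judgement} {a : Addr}

/-! ### Positions and the rules they belong to -/

/-- A position is shared by the rule that concludes its sequent and the rule below it, if that one
belongs to the outer part. They use it with opposite signs, and since a position has one sign, only
one of them can take it over. -/
theorem Node.bd_unique {e f : Judgement} {b c : Addr} {s : Bool} {q : Pos} (he : Node r a e b)
    (hf : Node r a f c) (hq : q ∈ e.deriv.bd b s) (hq' : q ∈ f.deriv.bd c s) : b = c ∧ e = f := by
  have mixed : ∀ {e f : Judgement} {b c : Addr}, Node r a e b → Node r a f c →
      q ∈ seqPos e.ctx e.ty b s →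
      (∃ k g, f.deriv.prem k = some g ∧ q ∈ seqPos g.ctx g.ty (k :: c) (!s)) → False := by
    rintro e f b c he hf hq ⟨k, g, hk, hq'⟩
    obtain rfl : b = k :: c := hq.1.symm.trans hq'.1
    obtain rfl := he.unique (.child hf hk)
    simpa using seqPos_disjoint e.deriv hq hq'
  have hbc : b = c := by
    rcases hq with hq | hq <;> rcases hq' with hq' | hq'
    · exact hq.1.symm.trans hq'.1
    · exact (mixed he hf hq hq').elim
    · exact (mixed hf he hq' hq).elim
    · obtain ⟨k, g, -, hg⟩ := hq
      obtain ⟨k', g', -, hg'⟩ := hq'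
      have := hg.1.symm.trans hg'.1
      simp only [List.cons.injEq] at this
      exact this.2
  subst hbc
  exact ⟨rfl, he.unique hf⟩

/-- A position where a rule takes over a token is one where another rule hands it over, unless it
belongs to the conclusion of the derivation; and conversely. -/
theorem Node.bd_swap {e : Judgement} {b : Addr} {s : Bool} {q : Pos} (he : Node r a e b)
    (hq : q ∈ e.deriv.bd b s) :
    q ∈ seqPos r.ctx r.ty a s ∨ ∃ f c, Node r a f c ∧ q ∈ f.deriv.bd c (!s) := by
  rcases hq with hq | ⟨k, g, hk, hq⟩
  · by_cases hb : b = a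
    · subst hb
      obtain rfl := he.eq_of_root rfl
      exact .inl hq
    · cases he with
      | root => exact absurd rfl hb
      | child hf hp => exact .inr ⟨_, _, hf, .inr ⟨_, _, hp, by simpa using hq⟩⟩
  · exact .inr ⟨g, k :: b, .child he hk, .inl hq⟩

theorem Node.not_bd_of_root {e : Judgement} {b : Addr} {s : Bool} {q : Pos} (he : Node r a e b)
    (hq : q ∈ seqPos r.ctx r.ty a s) : q ∉ e.deriv.bd b (!s) := by
  rintro (hq' | ⟨k, g, hk, hq'⟩)
  · obtain rfl : b = a := hq'.1.symm.trans hq.1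
    obtain rfl := he.eq_of_root rfl
    simpa using seqPos_disjoint e.deriv hq hq'
  · have h := hq.1.symm.trans hq'.1
    exact not_cons_suffix k b (h ▸ he.suffix)

/-- An event determines its rule: a move through its starting position, a synchronization point
through its address. -/
theorem Node.touch_node {e f : Judgement} {b c : Addr} {s s' : Bool} {t : Event} {q q' : Pos}
    (he : Node r a e b) (hf : Node r a f c) (hq : e.deriv.Touch b s t q)
    (hq' : f.deriv.Touch c s' t q') : b = c ∧ e = f := by
  cases t with
  | link p p' =>
    exact he.bd_unique hf (e.deriv.mv_mem hq.1) (f.deriv.mv_mem hq'.1)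
  | sync i =>
    have hbc := (e.deriv.rootPort_addr hq).symm.trans (f.deriv.rootPort_addr hq')
    subst hbc
    exact ⟨rfl, he.unique hf⟩

theorem Node.touch_unique {e f : Judgement} {b c : Addr} {s : Bool} {t u : Event} {q : Pos}
    (he : Node r a e b) (hf : Node r a f c) (hq : e.deriv.Touch b s t q)
    (hq' : f.deriv.Touch c s u q) : t = u := by
  obtain ⟨rfl, rfl⟩ := he.bd_unique hf (e.deriv.touch_mem hq) (f.deriv.touch_mem hq')
  exact e.deriv.touch_unique hq hq'

theorem Node.not_touch_of_unitPos {e f : Judgement} {b c : Addr} {s : Bool} {t : Event} {q : Pos}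
    (he : Node r a e b) (hf : Node r a f c) (hq : e.deriv.UnitPos b s q) :
    ¬ f.deriv.Touch c s t q := by
  intro hq'
  obtain ⟨rfl, rfl⟩ := he.bd_unique hf (e.deriv.unitPos_mem hq) (f.deriv.touch_mem hq')
  exact e.deriv.not_touch_of_unitPos hq hq'

/-! ### Finiteness -/

theorem Deriv.finite_any (P : Pos → ∀ {Γ : Ctx} {M : Term} {A : Ty}, Deriv Γ M A → Addr → Prop)
    (hP : ∀ {Γ : Ctx} {M : Term} {A : Ty} (d : Deriv Γ M A) (b : Addr), {q | P q d b}.Finite)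
    {Γ : Ctx} {M : Term} {A : Ty} (d : Deriv Γ M A) (a : Addr) :
    {q | d.Any false (fun e b => P q e b) a}.Finite := by
  induction d generalizing a with
  | ax => exact hP _ _
  | op => exact hP _ _
  | star => exact hP _ _
  | lam h d ih => exact (hP _ _).union (ih _)
  | app h d₀ d₁ ih₀ ih₁ => exact (hP _ _).union ((ih₀ _).union (ih₁ _))
  | letStar h d₀ d₁ ih₀ ih₁ => exact (hP _ _).union ((ih₀ _).union (ih₁ _))
  | pair h d₀ d₁ ih₀ ih₁ => exact (hP _ _).union ((ih₀ _).union (ih₁ _))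
  | letPair _ _ _ _ d₀ d₁ ih₀ ih₁ => exact (hP _ _).union ((ih₀ _).union (ih₁ _))
  | ite h d₀ d₁ d₂ ih₀ _ _ =>
    refine ((hP (.ite h d₀ d₁ d₂) a).union (ih₀ (0 :: a))).subset ?_
    rintro q (h | h | ⟨h, -⟩)
    · exact .inl h
    · exact .inr h
    · cases h

theorem Deriv.prem_le {Γ : Ctx} {M : Term} {A : Ty} (d : Deriv Γ M A) {k : ℕ} {e : Judgement}
    (h : d.prem k = some e) : k ≤ 1 := by
  rcases k with _ | _ | k
  · simp
  · simp
  · cases d <;> simp [Deriv.prem] at h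

theorem Deriv.finite_bd {Γ : Ctx} {M : Term} {A : Ty} (d : Deriv Γ M A) (b : Addr) (s : Bool) :
    (d.bd b s).Finite := by
  refine (finite_seqPos _ _ _ _).union ?_
  have : (⋃ k ∈ Set.Iic 1, {q | ∃ e, d.prem k = some e ∧
      q ∈ seqPos e.ctx e.ty (k :: b) (!s)}).Finite := by
    refine (Set.finite_Iic 1).biUnion fun k _ => ?_
    rcases h : d.prem k with _ | e
    · simp
    · simpa using finite_seqPos _ _ _ _
  refine this.subset ?_
  rintro q ⟨k, e, hk, hq⟩
  exact Set.mem_biUnion (Set.mem_Iic.2 (d.prem_le hk)) ⟨e, hk, hq⟩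

variable (r a) in
/-- The positions where tokens are consumed (`s = false`) or produced (`s = true`). -/
def portSet (s : Bool) : Set Pos := {q | ∃ e b, Node r a e b ∧ q ∈ e.deriv.bd b s}

theorem finite_portSet (s : Bool) : (portSet r a s).Finite := by
  refine (Deriv.finite_any (fun q {_ _ _} d b => q ∈ d.bd b s) (fun d b => d.finite_bd b s)
    r.deriv a).subset fun q hq => ?_
  exact (Deriv.any_false_iff (fun d b => q ∈ d.bd b s) r.deriv a).2 hq

/-! ### The net -/

variable (r a) in
/-- The events that can occur. -/
def outerEvents : Set Event :=
  {t | ∃ e b, Node r a e b ∧ (∃ q, e.deriv.Touch b false t q) ∧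
    ((∃ i, t = .sync i) → e.deriv.CanFire b)}

theorem finite_outerEvents : (outerEvents r a).Finite := by
  have : (⋃ q ∈ portSet r a false,
      {t | ∃ e b, Node r a e b ∧ e.deriv.Touch b false t q}).Finite := by
    refine (finite_portSet false).biUnion fun q _ => Set.Subsingleton.finite ?_
    rintro t ⟨e, b, he, ht⟩ u ⟨f, c, hf, hu⟩
    exact he.touch_unique hf ht hu
  refine this.subset ?_
  rintro t ⟨e, b, he, ⟨q, hq⟩, -⟩
  exact Set.mem_biUnion ⟨e, b, he, e.deriv.touch_mem hq⟩ ⟨e, b, he, hq⟩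

theorem mem_units {q : Pos} :
    q ∈ r.deriv.units a ↔ ∃ e b, Node r a e b ∧ e.deriv.UnitPos b true q := by
  refine (Deriv.any_false_iff _ _ _).trans (exists_congr fun e => exists_congr fun b =>
    and_congr Iff.rfl ?_)
  obtain ⟨d⟩ := e
  cases d <;> simp [Deriv.UnitPos]

theorem mem_unitCuts {q : Pos} :
    q ∈ r.deriv.unitCuts a ↔ ∃ e b, Node r a e b ∧ e.deriv.UnitPos b false q := by
  refine (Deriv.any_false_iff _ _ _).trans (exists_congr fun e => exists_congr fun b =>
    and_congr Iff.rfl ?_)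
  obtain ⟨d⟩ := e
  cases d <;> simp [Deriv.UnitPos]

theorem Deriv.isIte_iff {Γ : Ctx} {M : Term} {A : Ty} (d : Deriv Γ M A) (b : Addr) :
    (match d with | .ite _ _ _ _ => True | _ => False) ↔ d.RootPort b (.ite b) false (guardPos b) := by
  cases d <;> simp [Deriv.RootPort]

theorem mem_guards {q : Pos} :
    q ∈ r.deriv.guards a ↔
      ∃ e b, Node r a e b ∧ e.deriv.RootPort b (.ite b) false (guardPos b) ∧ q = guardPos b := by
  refine (Deriv.any_false_iff _ _ _).trans (exists_congr fun e => exists_congr fun b =>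
    and_congr Iff.rfl (and_congr (e.deriv.isIte_iff b) Iff.rfl))

variable (r a) in
/-- The net of the outer part of a derivation. -/
def outerNet : Net Token Event where
  events := outerEvents r a
  pre t := {x | ∃ e b, Node r a e b ∧ x ∈ e.deriv.preAt b t}
  -- The clause on `Touch` is needed because `postAt` grants the used guard to the event `.sync
  -- (.ite b)` whatever rule stands at `b`.
  post t := {x | ∃ e b, Node r a e b ∧ (∃ q, e.deriv.Touch b false t q) ∧ x ∈ e.deriv.postAt b t}
  start := (r.deriv.init a).tokens
  finite_events := finite_outerEvents
  pre_nonempty := by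
    rintro t ⟨e, b, he, ⟨q, hq⟩, -⟩
    exact ⟨⟨q, false⟩, e, b, he, rfl, hq⟩
  pre_unique := by
    rintro t - u - x ⟨e, b, he, -, hx⟩ ⟨f, c, hf, -, hx'⟩
    exact he.touch_unique hf hx hx'
  post_unique := by
    rintro t - u - x ⟨e, b, he, -, hx⟩ ⟨f, c, hf, -, hx'⟩
    rcases hx with ⟨hx, ht⟩ | ⟨hx, rfl, hg⟩ <;> rcases hx' with ⟨hx', hu⟩ | ⟨hx', rfl, hg'⟩
    · exact he.touch_unique hf ht hu
    · simp [hx] at hx'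
    · simp [hx] at hx'
    · have := hg.symm.trans hg'
      simp only [guardPos, Pos.mk.injEq, List.cons.injEq] at this
      rw [this.1.2]
  not_post_of_start := by
    rintro t - ⟨q, fl⟩ ⟨hq, rfl⟩ ⟨e, b, he, -, ⟨-, ht⟩ | ⟨h, -⟩⟩
    · rcases hq with hq | hq
      · exact he.not_bd_of_root hq (e.deriv.touch_mem ht)
      · obtain ⟨f, c, hf, hu⟩ := mem_units.1 hq
        exact hf.not_touch_of_unitPos he hu ht
    · cases h

theorem outerNet_pre {e : Judgement} {b : Addr} (he : Node r a e b) {t : Event} {q : Pos}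
    (ht : e.deriv.Touch b false t q) : (outerNet r a).pre t = e.deriv.preAt b t := by
  ext x
  constructor
  · rintro ⟨f, c, hf, hx⟩
    obtain ⟨rfl, rfl⟩ := he.touch_node hf ht hx.2
    exact hx
  · exact fun hx => ⟨e, b, he, hx⟩

theorem outerNet_post {e : Judgement} {b : Addr} (he : Node r a e b) {t : Event} {q : Pos}
    (ht : e.deriv.Touch b false t q) : (outerNet r a).post t = e.deriv.postAt b t := by
  ext x
  constructor
  · rintro ⟨f, c, hf, ⟨q', ht'⟩, hx⟩
    obtain ⟨rfl, rfl⟩ := he.touch_node hf ht ht'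
    exact hx
  · exact fun hx => ⟨e, b, he, ⟨q, ht⟩, hx⟩

/-- The machine plays the token game of the net. -/
theorem outerNet_game : (outerNet r a).Game Config.tokens (stepOf (r.deriv.Fires a)) where
  sound := by
    rintro C C' ⟨I, O, E, hF, hI, rfl⟩
    rw [Deriv.fires_iff, Deriv.any_false_iff] at hF
    obtain ⟨e, b, he, hF⟩ := hF
    obtain ⟨t, ⟨q, hq⟩, hc, rfl, rfl⟩ := Deriv.RootFires.exists_event _ hF
    refine ⟨t, ⟨e, b, he, ⟨q, hq⟩, hc⟩, ?_, ?_⟩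
    · rwa [outerNet_pre he hq]
    · rw [outerNet_pre he hq, outerNet_post he hq]
  complete := by
    rintro C t ⟨e, b, he, ⟨q, hq⟩, hc⟩ hp
    rw [outerNet_pre he hq] at hp
    obtain ⟨E, hE⟩ := e.deriv.exists_rootFires hq hc
    refine ⟨_, e.deriv.preAt b t, e.deriv.postAt b t, E, ?_, hp, rfl⟩
    rw [Deriv.fires_iff, Deriv.any_false_iff]
    exact ⟨e, b, he, hE⟩

variable (r a) in
/-- All the outer conditionals can be executed. -/
def AllCanFire : Prop := ∀ e b, Node r a e b → e.deriv.CanFire b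

variable (r a) in
/-- A token goes from `p` to `q` by some outer event. -/
def OuterFlow (p q : Pos) : Prop :=
  ∃ e b t, Node r a e b ∧ e.deriv.Touch b false t p ∧ e.deriv.Touch b true t q

theorem mem_outerEvents (hc : AllCanFire r a) {e : Judgement} {b : Addr} {s : Bool} {t : Event}
    {q : Pos} (he : Node r a e b) (ht : e.deriv.Touch b s t q) : t ∈ outerEvents r a :=
  ⟨e, b, he, e.deriv.exists_touch_false ht, fun _ => hc e b he⟩

/-- Whatever a rule hands over is either the output of one of its events or a unit that is present
from the start. -/
theorem marked_of_mem_bd_true (hc : AllCanFire r a) {e : Judgement} {b : Addr} {q : Pos}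
    (he : Node r a e b) (hq : q ∈ e.deriv.bd b true) :
    (outerNet r a).Marked (outerEvents r a) ⟨q, false⟩ := by
  rcases e.deriv.touch_or_unitPos hq with ⟨t, ht⟩ | hu
  · exact .inr ⟨t, mem_outerEvents hc he ht, e, b, he, e.deriv.exists_touch_false ht,
      .inl ⟨rfl, ht⟩⟩
  · exact .inl ⟨.inr (mem_units.2 ⟨e, b, he, hu⟩), rfl⟩

theorem marked_of_mem_bd_false (hc : AllCanFire r a) {e : Judgement} {b : Addr} {q : Pos}
    (he : Node r a e b) (hq : q ∈ e.deriv.bd b false) :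
    (outerNet r a).Marked (outerEvents r a) ⟨q, false⟩ := by
  rcases he.bd_swap hq with hq | ⟨f, c, hf, hq⟩
  · exact .inl ⟨.inl hq, rfl⟩
  · exact marked_of_mem_bd_true hc hf hq

/-- When all events have occurred the configuration is final. -/
theorem final_of_inv (hc : AllCanFire r a) {C : Config}
    (h : (outerNet r a).Inv C.tokens (outerEvents r a)) : r.deriv.Final a C := by
  ext ⟨q, fl⟩
  rw [h.mem_iff]
  cases fl with
  | true =>
    constructor
    · rintro ⟨⟨-, hf⟩ | ⟨t, -, e, b, he, ⟨q', hq'⟩, ⟨hf, -⟩ | ⟨-, rfl, rfl⟩⟩, -⟩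
      · cases hf
      · cases hf
      · refine .inr ⟨mem_guards.2 ⟨e, b, he, ?_, rfl⟩, rfl⟩
        exact (e.deriv.isIte_iff b).1 (by
          obtain ⟨d⟩ := e
          cases d <;> simp_all [Deriv.Touch, Deriv.RootPort])
    · rintro (⟨-, hf⟩ | ⟨hq, -⟩)
      · cases hf
      · obtain ⟨e, b, he, hi, rfl⟩ := mem_guards.1 hq
        refine ⟨.inr ⟨.sync (.ite b), mem_outerEvents hc he (s := false) hi, e, b, he, ⟨_, hi⟩,
          .inr ⟨rfl, rfl, rfl⟩⟩, ?_⟩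
        rintro t - ⟨f, c, -, hf, -⟩
        cases hf
  | false =>
    constructor
    · rintro ⟨hm, hn⟩
      refine .inl ⟨?_, rfl⟩
      -- A marked position lies on the way out of the derivation or is taken over by some rule. In
      -- the latter case no event consumes it, so only a place where units stop is left.
      have hpos : q ∈ seqPos r.ctx r.ty a true ∨ ∃ e b, Node r a e b ∧ q ∈ e.deriv.bd b false := by
        have hb : ∀ {e b}, Node r a e b → q ∈ e.deriv.bd b true →
            q ∈ seqPos r.ctx r.ty a true ∨ ∃ e b, Node r a e b ∧ q ∈ e.deriv.bd b false :=
          fun he hq => he.bd_swap hq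
        rcases hm with ⟨hq | hq, -⟩ | ⟨t, -, e, b, he, -, ⟨-, ht⟩ | ⟨hf, -⟩⟩
        · exact .inr ⟨r, a, .root, .inl hq⟩
        · obtain ⟨e, b, he, hu⟩ := mem_units.1 hq
          exact hb he (e.deriv.unitPos_mem hu)
        · exact hb he (e.deriv.touch_mem ht)
        · cases hf
      rcases hpos with hq | ⟨e, b, he, hq⟩
      · exact .inl hq
      · rcases e.deriv.touch_or_unitPos hq with ⟨t, ht⟩ | hu
        · exact (hn t (mem_outerEvents hc he ht) ⟨e, b, he, rfl, ht⟩).elim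
        · exact .inr (mem_unitCuts.2 ⟨e, b, he, hu⟩)
    · rintro (⟨hq | hq, -⟩ | ⟨-, hf⟩)
      · refine ⟨marked_of_mem_bd_true hc .root (.inl hq), ?_⟩
        rintro t - ⟨f, c, hf, -, ht⟩
        exact hf.not_bd_of_root hq (f.deriv.touch_mem ht)
      · obtain ⟨e, b, he, hu⟩ := mem_unitCuts.1 hq
        refine ⟨marked_of_mem_bd_false hc he (e.deriv.unitPos_mem hu), ?_⟩
        rintro t - ⟨f, c, hf, -, ht⟩
        exact he.not_touch_of_unitPos hf hu ht
      · cases hf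

end Global

/-! ### Cycles of the flow against cycles of the outer synchronization graph. -/

section Cycles

variable {r : Judgement} {a : Addr}

variable (r a) in
/-- Elementary token moves in the outer part. -/
def OuterLink (p q : Pos) : Prop := ∃ e b, Node r a e b ∧ e.deriv.Move b p q

variable (r a) in
/-- The ports of the outer synchronization points. -/
def OuterPort (i : SyncPt) (s : Bool) (q : Pos) : Prop :=
  ∃ e b, Node r a e b ∧ e.deriv.RootPort b i s q

variable (r a) in
/-- The edges of the synchronization graph of the outer part. -/
def OuterAdj (i j : SyncPt) : Prop :=
  ∃ p q, OuterPort r a i true p ∧ Relation.ReflTransGen (OuterLink r a) p q ∧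
    OuterPort r a j false q

theorem OuterPort.flow {i : SyncPt} {p q : Pos} (hp : OuterPort r a i false p)
    (hq : OuterPort r a i true q) : OuterFlow r a p q := by
  obtain ⟨e, b, he, hp⟩ := hp
  obtain ⟨f, c, hf, hq⟩ := hq
  obtain ⟨rfl, rfl⟩ := he.touch_node hf (s := false) (s' := true) (t := .sync i) hp hq
  exact ⟨e, b, .sync i, he, hp, hq⟩

theorem OuterLink.flow {p q : Pos} (h : OuterLink r a p q) : OuterFlow r a p q := by
  obtain ⟨e, b, he, h⟩ := h
  exact ⟨e, b, .link p q, he, ⟨h, rfl⟩, h, rfl⟩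

theorem OuterFlow.cases {p q : Pos} (h : OuterFlow r a p q) :
    OuterLink r a p q ∨ ∃ i, OuterPort r a i false p ∧ OuterPort r a i true q := by
  obtain ⟨e, b, ⟨p', q'⟩ | i, he, hp, hq⟩ := h
  · obtain ⟨hp, rfl⟩ := hp
    obtain ⟨hq, rfl⟩ := hq
    exact .inl ⟨e, b, he, hp⟩
  · exact .inr ⟨i, ⟨e, b, he, hp⟩, e, b, he, hq⟩

theorem OuterAdj.exists_flow {i j : SyncPt} (h : Relation.TransGen (OuterAdj r a) i j) :
    ∃ p q, OuterPort r a i true p ∧ Relation.ReflTransGen (OuterFlow r a) p q ∧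
      OuterPort r a j false q := by
  induction h with
  | single h =>
    obtain ⟨p, q, hp, h, hq⟩ := h
    exact ⟨p, q, hp, h.lift id fun _ _ h => h.flow, hq⟩
  | tail _ h ih =>
    obtain ⟨p, q, hp, hpq, hq⟩ := ih
    obtain ⟨p', q', hp', h, hq'⟩ := h
    exact ⟨p, q', hp, hpq.trans (.head (hq.flow hp') (h.lift id fun _ _ h => h.flow)), hq'⟩

/-- The path is cut at its crossings of synchronization points: each crossing completes an edge of
the graph, and what follows the last one is a simple token path. -/
theorem OuterPort.exists_adj {i : SyncPt} {p q : Pos} (hp : OuterPort r a i true p)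
    (h : Relation.ReflTransGen (OuterFlow r a) p q) :
    ∃ j p', OuterPort r a j true p' ∧ Relation.ReflTransGen (OuterAdj r a) i j ∧
      Relation.ReflTransGen (OuterLink r a) p' q := by
  induction h with
  | refl => exact ⟨i, p, hp, .refl, .refl⟩
  | tail _ h ih =>
    obtain ⟨j, p', hp', hij, hl⟩ := ih
    rcases h.cases with h | ⟨k, hk, hk'⟩
    · exact ⟨j, p', hp', hij, hl.tail h⟩
    · exact ⟨k, _, hk', hij.tail ⟨p', _, hp', hl, hk⟩, .refl⟩

/-- A cyclic flow of tokens goes through a conditional. -/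
theorem OuterFlow.exists_ite {q : Pos} (h : Relation.TransGen (OuterFlow r a) q q) :
    ∃ b u v, OuterPort r a (.ite b) false u ∧ OuterPort r a (.ite b) true v ∧
      Relation.ReflTransGen (OuterFlow r a) v u := by
  -- The label `τ` strictly increases except across conditionals, so a cycle avoiding them would
  -- give `τ q < τ q`.
  obtain ⟨τ, hτ⟩ := r.exists_increasing a
  have step : ∀ {p q}, OuterFlow r a p q → τ p < τ q ∨
      ∃ b, OuterPort r a (.ite b) false p ∧ OuterPort r a (.ite b) true q := by
    intro p q h
    rcases h.cases with ⟨e, b, he, h⟩ | ⟨i, hp, hq⟩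
    · exact .inl (hτ e b p q he (.inl h))
    · by_cases hi : ∃ b, i = .ite b
      · obtain ⟨b, rfl⟩ := hi
        exact .inr ⟨b, hp, hq⟩
      · left
        obtain ⟨e, b, he, hp⟩ := hp
        obtain ⟨f, c, hf, hq⟩ := hq
        obtain ⟨rfl, rfl⟩ := he.touch_node hf (s := false) (s' := true) (t := .sync i) hp hq
        exact hτ e b p q he (.inr ⟨i, fun c hc => hi ⟨c, hc⟩, hp, hq⟩)
  have key : ∀ {p q}, Relation.TransGen (OuterFlow r a) p q → τ p < τ q ∨
      ∃ b u v, OuterPort r a (.ite b) false u ∧ OuterPort r a (.ite b) true v ∧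
        Relation.ReflTransGen (OuterFlow r a) p u ∧
        Relation.ReflTransGen (OuterFlow r a) v q := by
    intro p q h
    induction h with
    | single h =>
      rcases step h with h | ⟨b, hp, hq⟩
      · exact .inl h
      · exact .inr ⟨b, _, _, hp, hq, .refl, .refl⟩
    | tail h' h ih =>
      rcases ih with ih | ⟨b, u, v, hu, hv, hpu, hvq⟩
      · rcases step h with h | ⟨b, hp, hq⟩
        · exact .inl (ih.trans h)
        · exact .inr ⟨b, _, _, hp, hq, h'.to_reflTransGen, .refl⟩
      · exact .inr ⟨b, u, v, hu, hv, hpu, hvq.tail h⟩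
  rcases key h with h | ⟨b, u, v, hu, hv, hqu, hvq⟩
  · exact (lt_irrefl _ h).elim
  · exact ⟨b, u, v, hu, hv, hvq.trans hqu⟩

/-- Used guards are never consumed, so a cycle of the net involves unflagged tokens only and
projects to a cycle of positions. -/
theorem outerNet_flow {x y : Token} (h : (outerNet r a).Flow x y) :
    x.flag = false ∧ x.pos ∈ portSet r a false ∧
      (y.flag = false → OuterFlow r a x.pos y.pos) := by
  obtain ⟨t, -, ⟨e, b, he, hx, ht⟩, f, c, hf, -, hy⟩ := h
  refine ⟨hx, ⟨e, b, he, e.deriv.touch_mem ht⟩, fun hfl => ?_⟩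
  rcases hy with ⟨-, ht'⟩ | ⟨hfl', -⟩
  · obtain ⟨rfl, rfl⟩ := he.touch_node hf ht ht'
    exact ⟨e, b, t, he, ht, ht'⟩
  · simp [hfl] at hfl'

theorem OuterFlow.net_flow (hc : AllCanFire r a) {p q : Pos} (h : OuterFlow r a p q) :
    (outerNet r a).Flow ⟨p, false⟩ ⟨q, false⟩ := by
  obtain ⟨e, b, t, he, hp, hq⟩ := h
  exact ⟨t, mem_outerEvents hc he hp, ⟨e, b, he, rfl, hp⟩, e, b, he, ⟨p, hp⟩, .inl ⟨rfl, hq⟩⟩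

theorem wellFounded_of_finite {α : Type} {ρ : α → α → Prop} {s : Set α} (hs : s.Finite)
    (hρ : ∀ x y, ρ x y → x ∈ s) (hirr : ∀ x, ¬ Relation.TransGen ρ x x) : WellFounded ρ := by
  have : IsStrictOrder α (Relation.TransGen ρ) :=
    { irrefl := hirr, trans := fun _ _ _ => Relation.TransGen.trans }
  have hwf := Set.wellFoundedOn_iff.1 (hs.wellFoundedOn (r := Relation.TransGen ρ))
  have hacc : ∀ x ∈ s, Acc ρ x := by
    intro x
    induction x using hwf.induction with
    | _ x ih => exact fun hx => ⟨_, fun y hy => ih y ⟨.single hy, hρ y x hy, hx⟩ (hρ y x hy)⟩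
  exact ⟨fun x => ⟨_, fun y hy => hacc y (hρ y x hy)⟩⟩

theorem not_rel_self_of_acc {α : Type} {ρ : α → α → Prop} {x : α} (h : Acc ρ x) : ¬ ρ x x := by
  induction h with
  | intro x _ ih => exact fun hx => ih x hx hx

/-- If the outer synchronization graph is acyclic, then so is the flow of the net. -/
theorem outerNet_wellFounded (h : ∀ i, ¬ Relation.TransGen (OuterAdj r a) i i) :
    WellFounded (outerNet r a).Flow := by
  have hfin : {x : Token | x.flag = false ∧ x.pos ∈ portSet r a false}.Finite := by
    refine ((finite_portSet (r := r) (a := a) false).image fun q => (⟨q, false⟩ : Token)).subset ?_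
    rintro ⟨q, fl⟩ ⟨rfl, hq⟩
    exact ⟨q, hq, rfl⟩
  refine wellFounded_of_finite hfin
    (fun x y hxy => ⟨(outerNet_flow hxy).1, (outerNet_flow hxy).2.1⟩) fun x hx => ?_
  have key : ∀ {x y : Token}, Relation.TransGen (outerNet r a).Flow x y → y.flag = false →
      Relation.TransGen (OuterFlow r a) x.pos y.pos := by
    intro x y hxy
    induction hxy with
    | single h => exact fun hy => .single ((outerNet_flow h).2.2 hy)
    | tail _ h ih => exact fun hy => (ih (outerNet_flow h).1).tail ((outerNet_flow h).2.2 hy)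
  obtain ⟨y, hxy, -⟩ := Relation.TransGen.head'_iff.1 hx
  -- The cycle is turned so as to start and end at a conditional. Cutting it there closes a cycle of
  -- the graph; without a synchronization point on it, no such cut would exist.
  obtain ⟨b, u, v, hu, hv, hvu⟩ := OuterFlow.exists_ite (key hx (outerNet_flow hxy).1)
  obtain ⟨j, p, hp, hij, hl⟩ := hv.exists_adj hvu
  exact h _ (Relation.TransGen.tail' hij ⟨p, u, hp, hl, hu⟩)

/-- The machine stops on a derivation. -/
theorem Judgement.acc_of_reachable {C : Config}
    (h : Relation.ReflTransGen (stepOf (r.deriv.Fires a)) (r.deriv.init a) C) :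
    Acc (fun C' C => stepOf (r.deriv.Fires a) C C') C :=
  outerNet_game.acc rfl h

/-- If the outer synchronization graph is acyclic and the branches of the outer conditionals can be
executed, then the machine stops only in final configurations. -/
theorem Judgement.final_of_stuck (hc : AllCanFire r a)
    (h : ∀ i, ¬ Relation.TransGen (OuterAdj r a) i i) {C : Config}
    (hC : Relation.ReflTransGen (stepOf (r.deriv.Fires a)) (r.deriv.init a) C)
    (hs : ∀ C', ¬ stepOf (r.deriv.Fires a) C C') : r.deriv.Final a C := by
  obtain ⟨S, hS⟩ := (outerNet_game (r := r) (a := a)).inv rfl hC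
  obtain rfl := hS.eq_events (outerNet_wellFounded h)
    (by
      rintro t ht ⟨q, fl⟩ ⟨e, b, he, rfl, hq⟩
      exact marked_of_mem_bd_false hc he (e.deriv.touch_mem hq))
    (fun t ht hp =>
      let ⟨C', hC'⟩ := outerNet_game.complete C t ht hp
      hs C' hC')
  exact final_of_inv hc hS

/-- If the machine reaches a final configuration, then the branches of the outer conditionals can
be executed and the outer synchronization graph is acyclic. -/
theorem Judgement.acyclic_of_final {C : Config}
    (hC : Relation.ReflTransGen (stepOf (r.deriv.Fires a)) (r.deriv.init a) C)
    (hf : r.deriv.Final a C) :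
    AllCanFire r a ∧ ∀ i, ¬ Relation.TransGen (OuterAdj r a) i i := by
  obtain ⟨S, hS⟩ := (outerNet_game (r := r) (a := a)).inv rfl hC
  -- A used guard can only come from the firing of its conditional, so a final configuration attests
  -- that every outer conditional has fired.
  have hmarked : ∀ {e b}, Node r a e b → e.deriv.RootPort b (.ite b) false (guardPos b) →
      (outerNet r a).Marked S ⟨guardPos b, true⟩ := by
    intro e b he hi
    refine ((hS.mem_iff _).1 ?_).1
    rw [hf]
    exact .inr ⟨mem_guards.2 ⟨e, b, he, hi, rfl⟩, rfl⟩
  have hc : AllCanFire r a := by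
    intro e b he
    by_cases hi : e.deriv.RootPort b (.ite b) false (guardPos b)
    · rcases hmarked he hi with ⟨-, hf⟩ | ⟨t, ht, f, c, hf, -, ⟨h, -⟩ | ⟨-, rfl, hg⟩⟩
      · cases hf
      · cases h
      · obtain rfl : b = c := by simpa [guardPos] using hg
        obtain ⟨f', c', hf', ⟨q, hq⟩, hc⟩ := hS.subset ht
        obtain ⟨rfl, rfl⟩ := he.touch_node hf' (s := false) (t := .sync (.ite b)) hi hq
        exact hc ⟨_, rfl⟩
    · obtain ⟨d⟩ := e
      cases d with
      | ite => exact absurd ⟨rfl, .inr ⟨rfl, rfl⟩⟩ hi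
      | _ => trivial
  refine ⟨hc, fun i hi => ?_⟩
  obtain ⟨p, q, hp, hpq, hq⟩ := OuterAdj.exists_flow hi
  obtain ⟨b, u, v, hu, hv, hvu⟩ :=
    OuterFlow.exists_ite (Relation.TransGen.tail' hpq (hq.flow hp))
  have hloop : Relation.TransGen (outerNet r a).Flow ⟨u, false⟩ ⟨u, false⟩ := by
    have : Relation.TransGen (OuterFlow r a) u u := .head' (hu.flow hv) hvu
    exact this.lift (fun q => (⟨q, false⟩ : Token)) fun _ _ h => h.net_flow hc
  obtain ⟨e, c, he, hu⟩ := hu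
  obtain rfl : b = c := e.deriv.rootPort_addr hu
  have hi : e.deriv.RootPort b (.ite b) false (guardPos b) := (e.deriv.isIte_iff b).1 (by
    obtain ⟨d⟩ := e
    cases d <;> simp_all [Deriv.RootPort])
  -- Firing the conditional consumes the token at `u` and produces the used guard. The latter is
  -- marked, hence accessible, and so is its predecessor `u`, which cannot lie on a loop.
  have hacc : Acc (outerNet r a).Flow ⟨u, false⟩ := (hS.acc _ (hmarked he hi)).inv
    ⟨.sync (.ite b), mem_outerEvents hc he (s := false) hi, ⟨e, b, he, rfl, hu⟩, e, b, he,
      ⟨u, hu⟩, .inr ⟨rfl, rfl, rfl⟩⟩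
  exact not_rel_self_of_acc hacc.transGen hloop

end Cycles

/-! ## The branches of the outer conditionals -/

/-- The branches of a conditional, numbered as premises. -/
def Deriv.branch : ∀ {Γ : Ctx} {M : Term} {A : Ty}, Deriv Γ M A → ℕ → Option Judgement
  | _, _, _, .ite _ _ d₁ _, 1 => some ⟨d₁⟩
  | _, _, _, .ite _ _ _ d₂, 2 => some ⟨d₂⟩
  | _, _, _, _, _ => none

theorem Deriv.exists_branch_iff {Θ Δ Γ : Ctx} {M N P : Term} {A : Ty} (hΘ : Split Θ Δ Γ)
    (d₀ : Deriv Δ M (.base .bit)) (d₁ : Deriv Γ N A) (d₂ : Deriv Γ P A)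
    (Q : ℕ → Judgement → Prop) :
    (∃ k e, (Deriv.ite hΘ d₀ d₁ d₂).branch k = some e ∧ Q k e) ↔ Q 1 ⟨d₁⟩ ∨ Q 2 ⟨d₂⟩ := by
  constructor
  · rintro ⟨_ | _ | _ | k, e, h, hQ⟩ <;> simp [Deriv.branch] at h
    · subst h
      exact .inl hQ
    · subst h
      exact .inr hQ
  · rintro (hQ | hQ)
    · exact ⟨1, _, rfl, hQ⟩
    · exact ⟨2, _, rfl, hQ⟩

theorem Deriv.canFire_iff {Γ : Ctx} {M : Term} {A : Ty} (d : Deriv Γ M A) (b : Addr) :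
    d.CanFire b ↔ ∀ k e, d.branch k = some e → e.deriv.Exec (k :: b) := by
  cases d with
  | ite hΘ d₀ d₁ d₂ =>
    constructor
    · rintro ⟨h₁, h₂⟩ (_ | _ | _ | k) e h <;> simp [Deriv.branch] at h <;> subst h
      exacts [h₁, h₂]
    · exact fun h => ⟨h 1 _ rfl, h 2 _ rfl⟩
  | _ => simp [Deriv.branch, Deriv.CanFire]

section Regions

variable (r : Judgement) (a : Addr)

/-- The branches of the outer conditionals, and their addresses. -/
def IsBranch (e : Judgement) (c : Addr) : Prop :=
  ∃ f b k, Node r a f b ∧ f.deriv.branch k = some e ∧ c = k :: b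

/-- Peels off one level of conditionals, which is the shape of the induction on nesting. -/
theorem Judgement.any_true_iff
    (P : ∀ {Γ : Ctx} {M : Term} {A : Ty}, Deriv Γ M A → Addr → Prop) :
    r.deriv.Any true P a ↔ (∃ e b, Node r a e b ∧ P e.deriv b) ∨
      ∃ e c, IsBranch r a e c ∧ e.deriv.Any true P c := by
  have key : ∀ {Γ : Ctx} {M : Term} {A : Ty} (d : Deriv Γ M A) (a : Addr), d.Any true P a ↔
      d.Any false (fun e b => P e b ∨ ∃ k f, e.branch k = some f ∧ f.deriv.Any true P (k :: b))
        a := by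
    intro Γ M A d
    have none' : ∀ {Γ : Ctx} {M : Term} {A : Ty} (d : Deriv Γ M A) (a : Addr),
        (∀ k, d.branch k = none) →
        (P d a ↔ P d a ∨ ∃ k f, d.branch k = some f ∧ f.deriv.Any true P (k :: a)) := by
      intro Γ M A d a h
      simp [h]
    induction d with
    | ax => exact fun a => none' _ a fun _ => rfl
    | op => exact fun a => none' _ a fun _ => rfl
    | star => exact fun a => none' _ a fun _ => rfl
    | lam h d ih => exact fun a => or_congr (none' _ a fun _ => rfl) (ih _)
    | app h d₀ d₁ ih₀ ih₁ =>
      exact fun a => or_congr (none' _ a fun _ => rfl) (or_congr (ih₀ _) (ih₁ _))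
    | letStar h d₀ d₁ ih₀ ih₁ =>
      exact fun a => or_congr (none' _ a fun _ => rfl) (or_congr (ih₀ _) (ih₁ _))
    | pair h d₀ d₁ ih₀ ih₁ =>
      exact fun a => or_congr (none' _ a fun _ => rfl) (or_congr (ih₀ _) (ih₁ _))
    | letPair _ _ _ _ d₀ d₁ ih₀ ih₁ =>
      exact fun a => or_congr (none' _ a fun _ => rfl) (or_congr (ih₀ _) (ih₁ _))
    | ite h d₀ d₁ d₂ ih₀ _ _ =>
      intro a
      have hb := Deriv.exists_branch_iff h d₀ d₁ d₂ fun k f => f.deriv.Any true P (k :: a)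
      constructor
      · rintro (hP | h₀ | ⟨-, h'⟩)
        · exact .inl (.inl hP)
        · exact .inr (.inl ((ih₀ _).1 h₀))
        · exact .inl (.inr (hb.2 h'))
      · rintro ((hP | h') | h₀ | ⟨hf, -⟩)
        · exact .inl hP
        · exact .inr (.inr ⟨rfl, hb.1 h'⟩)
        · exact .inr (.inl ((ih₀ _).2 h₀))
        · cases hf
  rw [key, Deriv.any_false_iff]
  constructor
  · rintro ⟨e, b, he, hP | ⟨k, f, hk, hf⟩⟩
    · exact .inl ⟨e, b, he, hP⟩
    · exact .inr ⟨f, _, ⟨e, b, k, he, hk, rfl⟩, hf⟩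
  · rintro (⟨e, b, he, hP⟩ | ⟨f, _, ⟨e, b, k, he, hk, rfl⟩, hf⟩)
    · exact ⟨e, b, he, .inl hP⟩
    · exact ⟨e, b, he, .inr ⟨k, f, hk, hf⟩⟩

theorem Deriv.suffix_of_any_true
    (P : ∀ {Γ : Ctx} {M : Term} {A : Ty}, Deriv Γ M A → Addr → Prop) {x : Addr}
    (hP : ∀ {Γ : Ctx} {M : Term} {A : Ty} (d : Deriv Γ M A) (b : Addr), P d b → b <:+ x)
    {Γ : Ctx} {M : Term} {A : Ty} (d : Deriv Γ M A) {a : Addr} (h : d.Any true P a) : a <:+ x := by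
  have cons : ∀ {k : ℕ} {a : Addr}, k :: a <:+ x → a <:+ x := fun h =>
    (List.suffix_cons _ _).trans h
  induction d generalizing a with
  | ax => exact hP _ _ h
  | op => exact hP _ _ h
  | star => exact hP _ _ h
  | lam _ d ih => exact h.elim (hP _ _) fun h => cons (ih h)
  | app _ d₀ d₁ ih₀ ih₁ =>
    exact h.elim (hP _ _) fun h => h.elim (fun h => cons (ih₀ h)) fun h => cons (ih₁ h)
  | letStar _ d₀ d₁ ih₀ ih₁ =>
    exact h.elim (hP _ _) fun h => h.elim (fun h => cons (ih₀ h)) fun h => cons (ih₁ h)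
  | pair _ d₀ d₁ ih₀ ih₁ =>
    exact h.elim (hP _ _) fun h => h.elim (fun h => cons (ih₀ h)) fun h => cons (ih₁ h)
  | letPair _ _ _ _ d₀ d₁ ih₀ ih₁ =>
    exact h.elim (hP _ _) fun h => h.elim (fun h => cons (ih₀ h)) fun h => cons (ih₁ h)
  | ite _ d₀ d₁ d₂ ih₀ ih₁ ih₂ =>
    rcases h with h | h | ⟨-, h | h⟩
    · exact hP _ _ h
    · exact cons (ih₀ h)
    · exact cons (ih₁ h)
    · exact cons (ih₂ h)

/-- Elementary token moves, at any depth. -/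
def DeepLink (p q : Pos) : Prop := r.deriv.Any true (fun d b => d.Move b p q) a

/-- The ports of the synchronization points, at any depth. -/
def DeepPort (i : SyncPt) (s : Bool) (q : Pos) : Prop :=
  r.deriv.Any true (fun d b => d.RootPort b i s q) a

/-- The edges of the synchronization graph. -/
def DeepAdj (i j : SyncPt) : Prop :=
  ∃ p q, DeepPort r a i true p ∧ Relation.ReflTransGen (DeepLink r a) p q ∧
    DeepPort r a j false q

/-- The synchronization graph is acyclic. -/
def DeepAcyclic : Prop := ∀ i, ¬ Relation.TransGen (DeepAdj r a) i i

/-- The token moves in a region: the outer part, or one of the branches. -/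
def RegionLink : Option (Judgement × Addr) → Pos → Pos → Prop
  | none, p, q => OuterLink r a p q
  | some (e, c), p, q => IsBranch r a e c ∧ DeepLink e c p q

/-- The ports in a region. -/
def RegionPort : Option (Judgement × Addr) → SyncPt → Bool → Pos → Prop
  | none, i, s, q => OuterPort r a i s q
  | some (e, c), i, s, q => IsBranch r a e c ∧ DeepPort e c i s q

/-- The edges of the synchronization graph in a region. -/
def RegionAdj (k : Option (Judgement × Addr)) (i j : SyncPt) : Prop :=
  ∃ p q, RegionPort r a k i true p ∧ Relation.ReflTransGen (RegionLink r a k) p q ∧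
    RegionPort r a k j false q

/-- The addresses in a region. -/
def Region : Option (Judgement × Addr) → Addr → Prop
  | none, x => ∃ e, Node r a e x
  | some (e, c), x => IsBranch r a e c ∧ c <:+ x

variable {r a}

theorem deepLink_iff {p q : Pos} : DeepLink r a p q ↔ ∃ k, RegionLink r a k p q := by
  refine (r.any_true_iff a _).trans ⟨?_, ?_⟩
  · rintro (h | ⟨e, c, h, h'⟩)
    · exact ⟨none, h⟩
    · exact ⟨some (e, c), h, h'⟩
  · rintro ⟨_ | ⟨e, c⟩, h⟩
    · exact .inl h
    · exact .inr ⟨e, c, h.1, h.2⟩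

theorem deepPort_iff {i : SyncPt} {s : Bool} {q : Pos} :
    DeepPort r a i s q ↔ ∃ k, RegionPort r a k i s q := by
  refine (r.any_true_iff a _).trans ⟨?_, ?_⟩
  · rintro (h | ⟨e, c, h, h'⟩)
    · exact ⟨none, h⟩
    · exact ⟨some (e, c), h, h'⟩
  · rintro ⟨_ | ⟨e, c⟩, h⟩
    · exact .inl h
    · exact .inr ⟨e, c, h.1, h.2⟩

theorem RegionAdj.deepAdj {k : Option (Judgement × Addr)} {i j : SyncPt}
    (h : RegionAdj r a k i j) : DeepAdj r a i j := by
  obtain ⟨p, q, hp, hpq, hq⟩ := h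
  exact ⟨p, q, deepPort_iff.2 ⟨k, hp⟩, hpq.lift id fun _ _ h => deepLink_iff.2 ⟨k, h⟩,
    deepPort_iff.2 ⟨k, hq⟩⟩

/-- Outer addresses only descend through premises, and at a conditional the guard and the branches
have different numbers. -/
theorem Node.not_branch_suffix {e f : Judgement} {b x : Addr} {k : ℕ} (he : Node r a e b)
    (hk : (e.deriv.branch k).isSome) (hf : Node r a f x) : ¬ k :: b <:+ x := by
  induction hf with
  | root => exact fun h => not_cons_suffix k b (h.trans he.suffix)
  | @child f f' c j hf hp ih =>
    intro h
    rcases List.suffix_cons_iff.1 h with h | h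
    · obtain ⟨rfl, rfl⟩ := List.cons.inj h
      obtain rfl := he.unique hf
      obtain ⟨d⟩ := e
      rcases k with _ | _ | k <;> cases d <;> simp [Deriv.branch, Deriv.prem] at hk hp
    · exact ih h

/-- Addresses tell regions apart: two branches whose addresses are suffixes of a common one are
comparable, and neither can contain the conditional of the other. -/
theorem Region.unique {k l : Option (Judgement × Addr)} {x : Addr} (hk : Region r a k x)
    (hl : Region r a l x) : k = l := by
  rcases k with _ | ⟨e, c⟩ <;> rcases l with _ | ⟨e', c'⟩
  · rfl
  · obtain ⟨f, hf⟩ := hk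
    obtain ⟨⟨g, b, j, hg, hj, rfl⟩, hs⟩ := hl
    exact (hg.not_branch_suffix (by simp [hj]) hf hs).elim
  · obtain ⟨f, hf⟩ := hl
    obtain ⟨⟨g, b, j, hg, hj, rfl⟩, hs⟩ := hk
    exact (hg.not_branch_suffix (by simp [hj]) hf hs).elim
  · obtain ⟨⟨g, b, j, hg, hj, rfl⟩, hs⟩ := hk
    obtain ⟨⟨g', b', j', hg', hj', rfl⟩, hs'⟩ := hl
    have hc : j :: b = j' :: b' := by
      rcases List.suffix_or_suffix_of_suffix hs hs' with h | h
      · rcases List.suffix_cons_iff.1 h with h | h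
        · exact h
        · exact (hg.not_branch_suffix (by simp [hj]) hg' h).elim
      · rcases List.suffix_cons_iff.1 h with h | h
        · exact h.symm
        · exact (hg'.not_branch_suffix (by simp [hj']) hg h).elim
    obtain ⟨rfl, rfl⟩ := List.cons.inj hc
    obtain rfl := hg.unique hg'
    rw [Option.some_injective _ (hj.symm.trans hj')]

theorem Node.region_of_mem_bd {e : Judgement} {b : Addr} {s : Bool} {q : Pos} (he : Node r a e b)
    (hq : q ∈ e.deriv.bd b s) : ∃ f, Node r a f q.addr := by
  rcases hq with hq | ⟨k, g, hk, hq⟩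
  · exact ⟨e, hq.1 ▸ he⟩
  · exact ⟨g, hq.1 ▸ .child he hk⟩

theorem RegionLink.region {k : Option (Judgement × Addr)} {p q : Pos}
    (h : RegionLink r a k p q) : Region r a k p.addr ∧ Region r a k q.addr := by
  rcases k with _ | ⟨e, c⟩
  · obtain ⟨e, b, he, h⟩ := h
    exact ⟨he.region_of_mem_bd (e.deriv.mv_mem h),
      he.region_of_mem_bd (e.deriv.mv_mem ((e.deriv.mv_not b false p q).2 h))⟩
  · refine ⟨⟨h.1, Deriv.suffix_of_any_true _ (fun d b hm => ?_) e.deriv h.2⟩,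
      ⟨h.1, Deriv.suffix_of_any_true _ (fun d b hm => ?_) e.deriv h.2⟩⟩
    · exact d.suffix_of_mem_bd (d.mv_mem hm)
    · exact d.suffix_of_mem_bd (d.mv_mem ((d.mv_not b false p q).2 hm))

theorem RegionPort.region {k : Option (Judgement × Addr)} {i : SyncPt} {s : Bool} {q : Pos}
    (h : RegionPort r a k i s q) : Region r a k i.addr ∧ Region r a k q.addr := by
  rcases k with _ | ⟨e, c⟩
  · obtain ⟨e, b, he, h⟩ := h
    exact ⟨⟨e, (e.deriv.rootPort_addr h).symm ▸ he⟩, he.region_of_mem_bd (e.deriv.rootPort_mem h)⟩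
  · refine ⟨⟨h.1, Deriv.suffix_of_any_true _ (fun d b hm => ?_) e.deriv h.2⟩,
      ⟨h.1, Deriv.suffix_of_any_true _ (fun d b hm => ?_) e.deriv h.2⟩⟩
    · rw [d.rootPort_addr hm]
    · exact d.suffix_of_mem_bd (d.rootPort_mem hm)

/-- No move leads across the border of a branch: a conditional identifies only the context of its
guard. A path therefore stays in the region where it starts. -/
theorem DeepAdj.exists_region {i j : SyncPt} (h : DeepAdj r a i j) :
    ∃ k, RegionAdj r a k i j := by
  obtain ⟨p, q, hp, hpq, hq⟩ := h
  obtain ⟨k, hp⟩ := deepPort_iff.1 hp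
  obtain ⟨l, hq'⟩ := deepPort_iff.1 hq
  have key : Relation.ReflTransGen (RegionLink r a k) p q ∧ Region r a k q.addr := by
    clear hq hq'
    induction hpq with
    | refl => exact ⟨.refl, hp.region.2⟩
    | tail _ h ih =>
      obtain ⟨m, h⟩ := deepLink_iff.1 h
      obtain rfl := ih.2.unique h.region.1
      exact ⟨ih.1.tail h, h.region.2⟩
  obtain rfl := key.2.unique hq'.region.2
  exact ⟨k, p, q, hp, key.1, hq'⟩

theorem RegionAdj.region {k : Option (Judgement × Addr)} {i j : SyncPt}
    (h : RegionAdj r a k i j) : Region r a k i.addr ∧ Region r a k j.addr := by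
  obtain ⟨p, q, hp, -, hq⟩ := h
  exact ⟨hp.region.1, hq.region.1⟩

/-- The synchronization graph is the disjoint union of the outer one and of those of the
branches. -/
theorem deepAcyclic_iff :
    DeepAcyclic r a ↔ (∀ i, ¬ Relation.TransGen (OuterAdj r a) i i) ∧
      ∀ e b, Node r a e b → ∀ k f, e.deriv.branch k = some f → DeepAcyclic f (k :: b) := by
  constructor
  · intro h
    refine ⟨fun i hi => h i (hi.lift id fun _ _ h => RegionAdj.deepAdj (k := none) h), ?_⟩
    intro e b he k f hk i hi
    have hb : IsBranch r a f (k :: b) := ⟨e, b, k, he, hk, rfl⟩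
    refine h i (hi.lift id fun i j ⟨p, q, hp, hpq, hq⟩ =>
      RegionAdj.deepAdj (k := some (f, k :: b)) ⟨p, q, ⟨hb, hp⟩, ?_, ⟨hb, hq⟩⟩)
    exact hpq.lift id fun _ _ h => ⟨hb, h⟩
  · rintro ⟨h, h'⟩ i hi
    have key : ∀ {i j}, Relation.TransGen (DeepAdj r a) i j →
        ∃ k, Relation.TransGen (RegionAdj r a k) i j ∧ Region r a k j.addr := by
      intro i j hij
      induction hij with
      | single h =>
        obtain ⟨k, h⟩ := h.exists_region
        exact ⟨k, .single h, h.region.2⟩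
      | tail _ h ih =>
        obtain ⟨k, ih, hk⟩ := ih
        obtain ⟨l, h⟩ := h.exists_region
        obtain rfl := hk.unique h.region.1
        exact ⟨k, ih.tail h, h.region.2⟩
    obtain ⟨_ | ⟨e, c⟩, hk, -⟩ := key hi
    · exact h i hk
    · obtain ⟨_, hadj, -⟩ := Relation.TransGen.head'_iff.1 hk
      obtain ⟨p, q, hp, -, -⟩ := hadj
      obtain ⟨f, b, j, hf, hj, rfl⟩ := hp.1
      refine h' f b hf j e hj i (hk.lift id ?_)
      rintro i j ⟨p, q, hp, hpq, hq⟩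
      exact ⟨p, q, hp.2, hpq.lift id fun _ _ h => h.2, hq.2⟩

/-- Acyclicity of the branches makes the outer conditionals executable; the machine terminates in
any case, and the configuration where it gets stuck is then final. Conversely, a final configuration
shows that the outer graph is acyclic and that all these branches were executable. -/
theorem Judgement.exec_iff_of_branches
    (h : ∀ e b, Node r a e b → ∀ k f, e.deriv.branch k = some f →
      (f.deriv.Exec (k :: b) ↔ DeepAcyclic f (k :: b))) :
    r.deriv.Exec a ↔ DeepAcyclic r a := by
  rw [deepAcyclic_iff]
  constructor
  · rintro ⟨C, hC, hf⟩
    obtain ⟨hc, hacyc⟩ := Judgement.acyclic_of_final hC hf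
    exact ⟨hacyc, fun e b he k f hk => (h e b he k f hk).1
      ((e.deriv.canFire_iff b).1 (hc e b he) k f hk)⟩
  · rintro ⟨hacyc, hb⟩
    have hc : AllCanFire r a := fun e b he => (e.deriv.canFire_iff b).2 fun k f hk =>
      (h e b he k f hk).2 (hb e b he k f hk)
    obtain ⟨C, hC, hs⟩ := exists_stuck (Judgement.acc_of_reachable (r := r) (a := a) .refl)
    exact ⟨C, hC, Judgement.final_of_stuck hc hacyc hC hs⟩

end Regions

/-! ### Induction on the nesting of conditionals. -/

theorem Deriv.exec_branch_iff {Γ : Ctx} {M : Term} {A : Ty} (d : Deriv Γ M A) :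
    ∀ a e b, Node ⟨d⟩ a e b → ∀ k f, e.deriv.branch k = some f →
      (f.deriv.Exec (k :: b) ↔ DeepAcyclic f (k :: b)) := by
  -- The statement concerns all outer conditionals, not the derivation itself. The induction
  -- hypothesis for a branch is then just what `Judgement.exec_iff_of_branches` requires there,
  -- while the premises take care of the other outer rules.
  have step : ∀ {Γ : Ctx} {M : Term} {A : Ty} (d : Deriv Γ M A),
      (∀ k f, d.branch k = some f → ∀ a e b, Node f a e b → ∀ k g, e.deriv.branch k = some g →
        (g.deriv.Exec (k :: b) ↔ DeepAcyclic g (k :: b))) →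
      (∀ k f, d.prem k = some f → ∀ a e b, Node f a e b → ∀ k g, e.deriv.branch k = some g →
        (g.deriv.Exec (k :: b) ↔ DeepAcyclic g (k :: b))) →
      ∀ a e b, Node ⟨d⟩ a e b → ∀ k f, e.deriv.branch k = some f →
      (f.deriv.Exec (k :: b) ↔ DeepAcyclic f (k :: b)) := by
    intro Γ M A d hb hp a e b he k f hk
    rcases he.cases_head with ⟨rfl, rfl⟩ | ⟨j, g, hj, hn⟩
    · exact Judgement.exec_iff_of_branches (hb k f hk _)
    · exact hp j g hj _ e b hn k f hk
  induction d with
  | ax =>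
    refine step _ ?_ ?_ <;> intro _ _ h
    · simp [Deriv.branch] at h
    · simp [Deriv.prem] at h
  | op =>
    refine step _ ?_ ?_ <;> intro _ _ h
    · simp [Deriv.branch] at h
    · simp [Deriv.prem] at h
  | star =>
    refine step _ ?_ ?_ <;> intro _ _ h
    · simp [Deriv.branch] at h
    · simp [Deriv.prem] at h
  | lam h d ih =>
    refine step _ (fun k f h => by simp [Deriv.branch] at h) ?_
    rintro (_ | k) f h <;> simp [Deriv.prem] at h
    subst h
    exact ih
  | app h d₀ d₁ ih₀ ih₁ =>
    refine step _ (fun k f h => by simp [Deriv.branch] at h) ?_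
    rintro (_ | _ | k) f h <;> simp [Deriv.prem] at h <;> subst h
    exacts [ih₀, ih₁]
  | letStar h d₀ d₁ ih₀ ih₁ =>
    refine step _ (fun k f h => by simp [Deriv.branch] at h) ?_
    rintro (_ | _ | k) f h <;> simp [Deriv.prem] at h <;> subst h
    exacts [ih₀, ih₁]
  | pair h d₀ d₁ ih₀ ih₁ =>
    refine step _ (fun k f h => by simp [Deriv.branch] at h) ?_
    rintro (_ | _ | k) f h <;> simp [Deriv.prem] at h <;> subst h
    exacts [ih₀, ih₁]
  | letPair _ _ _ _ d₀ d₁ ih₀ ih₁ =>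
    refine step _ (fun k f h => by simp [Deriv.branch] at h) ?_
    rintro (_ | _ | k) f h <;> simp [Deriv.prem] at h <;> subst h
    exacts [ih₀, ih₁]
  | ite h d₀ d₁ d₂ ih₀ ih₁ ih₂ =>
    refine step _ ?_ ?_
    · rintro (_ | _ | _ | k) f h <;> simp [Deriv.branch] at h <;> subst h
      exacts [ih₁, ih₂]
    · rintro (_ | k) f h <;> simp [Deriv.prem] at h
      subst h
      exact ih₀

/-- The machine can reach a final configuration if and only if the synchronization graph is
acyclic. -/
theorem Deriv.exec_iff {Γ : Ctx} {M : Term} {A : Ty} (d : Deriv Γ M A) (a : Addr) :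
    d.Exec a ↔ DeepAcyclic ⟨d⟩ a :=
  Judgement.exec_iff_of_branches (r := ⟨d⟩) (d.exec_branch_iff a)

theorem Deriv.final_of_stuck {Γ : Ctx} {M : Term} {A : Ty} (d : Deriv Γ M A) {a : Addr}
    (h : DeepAcyclic ⟨d⟩ a) {C : Config}
    (hC : Relation.ReflTransGen (stepOf (d.Fires a)) (d.init a) C)
    (hs : ∀ C', ¬ stepOf (d.Fires a) C C') : d.Final a C := by
  have h' := deepAcyclic_iff.1 h
  refine Judgement.final_of_stuck (r := ⟨d⟩) ?_ h'.1 hC hs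
  exact fun e b he => (e.deriv.canFire_iff b).2 fun k f hk =>
    (d.exec_branch_iff a e b he k f hk).2 (h'.2 e b he k f hk)

/-- Both ends of an edge have a port, so restricting the nodes to synchronization points of `π`
removes no cycle. -/
theorem Deriv.acyclicDigraph_iff {Γ : Ctx} {M : Term} {A : Ty} (π : Deriv Γ M A) :
    AcyclicDigraph π.syncGraph ↔ DeepAcyclic ⟨π⟩ [] := by
  constructor
  · intro h i hi
    have key : ∀ {i j}, Relation.TransGen (DeepAdj ⟨π⟩ []) i j →
        ∃ (hi : i ∈ π.syncPoints) (hj : j ∈ π.syncPoints),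
          Relation.TransGen π.syncGraph.Adj ⟨i, hi⟩ ⟨j, hj⟩ := by
      intro i j hij
      induction hij with
      | single h =>
        obtain ⟨p, q, hp, hpq, hq⟩ := h
        exact ⟨⟨true, p, hp⟩, ⟨false, q, hq⟩, .single ⟨p, q, hp, hpq, hq⟩⟩
      | tail _ h ih =>
        obtain ⟨hi, hj, ih⟩ := ih
        obtain ⟨p, q, hp, hpq, hq⟩ := h
        exact ⟨hi, ⟨false, q, hq⟩, ih.tail ⟨p, q, hp, hpq, hq⟩⟩
    obtain ⟨hi, _, h'⟩ := key hi
    exact h _ h'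
  · exact fun h v hv => h v.1 (hv.lift Subtype.val fun _ _ h => h)

end QLambda

/-! ### The proposition. -/

theorem mainTheorem4 {Γ : QLambda.Ctx} {M : QLambda.Term} {A : QLambda.Ty}
    (π : QLambda.Deriv Γ M A) :
    (QLambda.AcyclicDigraph π.syncGraph ↔ ∀ C, π.Reachable C → ¬ π.Deadlock C) ∧
    (QLambda.AcyclicDigraph π.syncGraph →
      (¬ ∃ run : ℕ → QLambda.Config, run 0 = π.init [] ∧ ∀ n, π.Step (run n) (run (n + 1))) ∧
      ∀ C, π.Reachable C → ∃ C', Relation.ReflTransGen π.Step C C' ∧ π.Final [] C' ∧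
        ∀ q ∈ QLambda.seqPos Γ A [] true, (⟨q, false⟩ : QLambda.Token) ∈ C'.tokens) := by
  have hacc : ∀ C, π.Reachable C → Acc (fun C' C => π.Step C C') C := fun C hC =>
    QLambda.Judgement.acc_of_reachable (r := ⟨π⟩) (a := []) hC
  rw [π.acyclicDigraph_iff]
  refine ⟨⟨fun h C hC hd => hd.1 (π.final_of_stuck h hC hd.2), fun h => ?_⟩, fun h => ⟨?_, ?_⟩⟩
  · obtain ⟨C, hC, hs⟩ := QLambda.exists_stuck (hacc _ .refl)
    refine (π.exec_iff []).1 ⟨C, hC, ?_⟩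
    by_contra hf
    exact h C hC ⟨hf, hs⟩
  · exact QLambda.not_infinite_run (hacc _ .refl)
  · intro C hC
    obtain ⟨C', hC', hs⟩ := QLambda.exists_stuck (hacc C hC)
    have hf := π.final_of_stuck h (hC.trans hC') hs
    refine ⟨C', hC', hf, fun q hq => ?_⟩
    rw [hf]
    exact .inl ⟨.inl hq, rfl⟩
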